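/- Let $\Sigma$ be an oriented smooth surface with boundary and let $\mathsf g$ be a hyperbolic 0-metric on $\Sigma$: a Riemannian metric on the interior, of Gauss curvature $-1$, such that $\varrho^2\mathsf g$ extends to a smooth Riemannian metric on $\Sigma$ for (local) boundary defining functions $\varrho$. By a hyperbolic chart we mean an oriented chart of $\Sigma$ that is an isometry from $\mathsf g$ to $(dx^2+dy^2)/y^2$ on an open subset of the closed upper half-plane $\{y\ge 0\}$. Hyperbolic charts exist around every boundary point, and their restrictions to $\partial\Sigma$ define a projective structure on $\partial\Sigma$ (an atlas with values in $\mathbb R\subset\mathbb R\mathrm P(1)$ and locally constant transition maps in $\mathrm{PSL}(2,\mathbb R)$). The Hill potential of $\mathsf g$ in a local boundary coordinate $x$ is the unique smooth function $T$ such that, for all local solutions $u_1,u_2$ of $u''+Tu=0$ with Wronskian $u_1u_2'-u_1'u_2=-1$, the map $(u_1:u_2)$ is a chart of this projective structure. Let $x,y$ be oriented local coordinates ($dx\wedge dy>0$) on an open set $U\subset\Sigma$, with $y$ a boundary defining function for $\partial\Sigma\cap U$. Then there are smooth functions $a>0$ and $c$ of the boundary coordinate $x$ on $\partial\Sigma\cap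 U$ such that the Riemannian volume form satisfies $$\mathrm{vol}_{\mathsf g}=y^{-2}a(x)\,dx\wedge dy+O(y^{-1})$$ near $\partial\Sigma\cap U$ (that is, $y$ times the remainder extends smoothly to the boundary), and, with $k(x,y)$ the geodesic curvature of the curve $t\mapsto(x+t,y)$ at $t=0$, $$c(x)=\lim_{y\to0^+}\frac{k(x,y)-1}{y^2}.$$ The Hill potential of $\mathsf g$ in the coordinate $x$ exists, is unique, and is given by $$T=\frac12\left(\frac{a''}{a}-\frac32\Big(\frac{a'}{a}\Big)^2\right)+\frac{a^2}{2}\,c .$$ -/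

import Mathlib

open scoped Manifold ContDiff Topology

noncomputable section

/-! ### Surfaces with boundary, local coordinates, orientations

A surface with boundary is a smooth manifold `M` modelled on the closed half-plane
`EuclideanHalfSpace 2 = {q : ℝ² | 0 ≤ q 0}`.  Throughout, a chart `φ` of `M` is read as a pair of
local coordinates `(x, y)` with `y = q 0` (a boundary defining function) and `x = q 1`. -/

/-- A chart of a surface with boundary, with values in the closed half-plane. -/
abbrev SurfaceChart (M : Type*) [TopologicalSpace M] : Type _ :=
  OpenPartialHomeomorph M (EuclideanHalfSpace 2)

/-- The coordinate domain `{(x, y)}` of the chart `φ`: a relatively open subset of `{y ≥ 0}`. -/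
def coordDom {M : Type*} [TopologicalSpace M] (φ : SurfaceChart M) : Set (ℝ × ℝ) :=
  {z | !₂[z.2, z.1] ∈ (φ.extend (𝓡∂ 2)).target}

/-- The part of the coordinate domain on the boundary line `y = 0`: an open subset of `ℝ`, the range
of the coordinate `x` on the boundary of the surface. -/
def bdryDom {M : Type*} [TopologicalSpace M] (φ : SurfaceChart M) : Set ℝ :=
  {x | (x, (0 : ℝ)) ∈ coordDom φ}

/-- The point of the surface with coordinates `z = (x, y)`. -/
def coordPt {M : Type*} [TopologicalSpace M] (φ : SurfaceChart M) (z : ℝ × ℝ) : M :=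
  (φ.extend (𝓡∂ 2)).symm !₂[z.2, z.1]

/-- The coordinate basis of `ℝ × ℝ`: index `0` is the direction of `x`, index `1` that of `y`. -/
def basisVec (i : Fin 2) : ℝ × ℝ := if i = 0 then (1, 0) else (0, 1)

/-- The transition map from `φ` to `ψ` has positive Jacobian determinant (one-sided derivatives at
the boundary). -/
def PositiveTransition {M : Type*} [TopologicalSpace M] (φ ψ : SurfaceChart M) : Prop :=
  ∀ p ∈ φ.source ∩ ψ.source,
    0 < (fderivWithin ℝ (ψ.extend (𝓡∂ 2) ∘ (φ.extend (𝓡∂ 2)).symm)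
      (Set.range (𝓡∂ 2)) (φ.extend (𝓡∂ 2) p)).det

/-- An orientation of the surface, given as its maximal atlas of oriented charts, that is,
of the coordinates `(x, y)` with `dx ∧ dy > 0`. -/
structure SurfaceOrientation (M : Type*) [TopologicalSpace M]
    [ChartedSpace (EuclideanHalfSpace 2) M] where
  charts : Set (SurfaceChart M)
  subset_maximalAtlas : charts ⊆ IsManifold.maximalAtlas (𝓡∂ 2) ∞ M
  cover : ∀ p : M, ∃ φ ∈ charts, p ∈ φ.source
  positive : ∀ φ ∈ charts, ∀ ψ ∈ charts, PositiveTransition φ ψ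
  maximal : ∀ φ ∈ IsManifold.maximalAtlas (𝓡∂ 2) ∞ M,
    (∀ ψ ∈ charts, PositiveTransition φ ψ) → φ ∈ charts

/-! ### 0-metrics -/

/-- The matrix `(g(∂ᵢ, ∂ⱼ))` of a field of bilinear forms in the coordinates `φ` (used at points
with `y > 0`). -/
def coordMatrix {M : Type*} [TopologicalSpace M] [ChartedSpace (EuclideanHalfSpace 2) M]
    (b : ∀ p : M, LinearMap.BilinForm ℝ (TangentSpace (𝓡∂ 2) p))
    (φ : SurfaceChart M) (z : ℝ × ℝ) : Matrix (Fin 2) (Fin 2) ℝ :=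
  fun i j => b (coordPt φ z)
    (mfderiv 𝓘(ℝ, ℝ × ℝ) (𝓡∂ 2) (coordPt φ) z (basisVec i))
    (mfderiv 𝓘(ℝ, ℝ × ℝ) (𝓡∂ 2) (coordPt φ) z (basisVec j))

/-- A 0-metric on a surface with boundary: a metric on the interior such that `y² g` extends to
a smooth Riemannian metric up to the boundary, for local boundary defining functions `y`.  The value
of `form` at boundary points carries no information and is never used. -/
structure ZeroMetric (M : Type*) [TopologicalSpace M]
    [ChartedSpace (EuclideanHalfSpace 2) M] where
  form : ∀ p : M, LinearMap.BilinForm ℝ (TangentSpace (𝓡∂ 2) p)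
  extends_to_boundary : ∀ φ ∈ IsManifold.maximalAtlas (𝓡∂ 2) ∞ M,
    ∃ H : ℝ × ℝ → Matrix (Fin 2) (Fin 2) ℝ,
      (∀ i j, ContDiffOn ℝ ∞ (fun z => H z i j) (coordDom φ)) ∧
      (∀ z ∈ coordDom φ, (H z).PosDef) ∧
      ∀ z ∈ coordDom φ, 0 < z.2 → coordMatrix form φ z = (z.2 ^ 2)⁻¹ • H z

/-- The matrix of a 0-metric in the coordinates `φ`. -/
def ZeroMetric.matrix {M : Type*} [TopologicalSpace M] [ChartedSpace (EuclideanHalfSpace 2) M]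
    (g : ZeroMetric M) (φ : SurfaceChart M) (z : ℝ × ℝ) : Matrix (Fin 2) (Fin 2) ℝ :=
  coordMatrix g.form φ z

/-! ### Gauss curvature through moving coframes

A 1-form `p dx + q dy` in coordinates is the function `z ↦ ![p z, q z]`, a 2-form is its coefficient
of `dx ∧ dy`. -/

/-- Partial derivative in the direction `x` (`i = 0`) or `y` (`i = 1`). -/
def pderiv (i : Fin 2) (f : ℝ × ℝ → ℝ) (z : ℝ × ℝ) : ℝ := fderiv ℝ f z (basisVec i)

/-- The wedge product of two 1-forms. -/
def wedge (α β : ℝ × ℝ → Fin 2 → ℝ) (z : ℝ × ℝ) : ℝ := α z 0 * β z 1 - α z 1 * β z 0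

/-- The exterior derivative of a 1-form. -/
def dform (α : ℝ × ℝ → Fin 2 → ℝ) (z : ℝ × ℝ) : ℝ :=
  pderiv 0 (fun w => α w 1) z - pderiv 1 (fun w => α w 0) z

/-- `α₁, α₂` is a smooth oriented orthonormal coframe on `V` for the metric with matrix `G`. -/
def IsOrthonormalCoframe (G : ℝ × ℝ → Matrix (Fin 2) (Fin 2) ℝ) (V : Set (ℝ × ℝ))
    (α₁ α₂ : ℝ × ℝ → Fin 2 → ℝ) : Prop :=
  ContDiffOn ℝ ∞ α₁ V ∧ ContDiffOn ℝ ∞ α₂ V ∧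
  (∀ z ∈ V, ∀ i j, G z i j = α₁ z i * α₁ z j + α₂ z i * α₂ z j) ∧
  ∀ z ∈ V, 0 < wedge α₁ α₂ z

/-- `κ` is the spin connection of `α₁, α₂`: `dα₁ = -κ ∧ α₂` and `dα₂ = κ ∧ α₁`. -/
def IsSpinConnection (V : Set (ℝ × ℝ)) (α₁ α₂ κ : ℝ × ℝ → Fin 2 → ℝ) : Prop :=
  ContDiffOn ℝ ∞ κ V ∧
  ∀ z ∈ V, dform α₁ z = -wedge κ α₂ z ∧ dform α₂ z = wedge κ α₁ z

/-- The 0-metric is hyperbolic: on the interior its Gauss curvature `K`, which is defined by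
`dκ = K α₁ ∧ α₂` for local oriented orthonormal coframes with spin connection `κ`, equals `-1`. -/
def IsHyperbolic {M : Type*} [TopologicalSpace M] [ChartedSpace (EuclideanHalfSpace 2) M]
    (o : SurfaceOrientation M) (g : ZeroMetric M) : Prop :=
  ∀ φ ∈ o.charts, ∀ V : Set (ℝ × ℝ), IsOpen V → V ⊆ coordDom φ → (∀ z ∈ V, 0 < z.2) →
    ∀ α₁ α₂ κ : ℝ × ℝ → Fin 2 → ℝ,
      IsOrthonormalCoframe (g.matrix φ) V α₁ α₂ → IsSpinConnection V α₁ α₂ κ →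
      ∀ z ∈ V, dform κ z = (-1) * wedge α₁ α₂ z

/-! ### Volume form and geodesic curvature -/

/-- The coefficient of `dx ∧ dy` in the Riemannian volume form. -/
def volCoeff (G : ℝ × ℝ → Matrix (Fin 2) (Fin 2) ℝ) (z : ℝ × ℝ) : ℝ := √(G z).det

/-- Christoffel symbols `Γᵏᵢⱼ` of the metric with matrix `G`. -/
def christoffel (G : ℝ × ℝ → Matrix (Fin 2) (Fin 2) ℝ) (k i j : Fin 2) (z : ℝ × ℝ) : ℝ :=
  (1 / 2) * ∑ l, (G z)⁻¹ k l *
    (pderiv i (fun w => G w j l) z + pderiv j (fun w => G w i l) z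
      - pderiv l (fun w => G w i j) z)

/-- The components of the velocity of a curve. -/
def velocity (γ : ℝ → ℝ × ℝ) (i : Fin 2) (t : ℝ) : ℝ :=
  if i = 0 then deriv (fun s => (γ s).1) t else deriv (fun s => (γ s).2) t

/-- The components of the covariant acceleration `∇_γ' γ'` of a curve. -/
def acceleration (G : ℝ × ℝ → Matrix (Fin 2) (Fin 2) ℝ) (γ : ℝ → ℝ × ℝ) (k : Fin 2) (t : ℝ) : ℝ :=
  deriv (velocity γ k) t +
    ∑ i, ∑ j, christoffel G k i j (γ t) * velocity γ i t * velocity γ j t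

/-- The signed geodesic curvature `vol(γ', ∇_γ' γ') / |γ'|³` of a regular curve; it is positive
where the curve bends to the left with respect to the orientation `dx ∧ dy`. -/
def geodesicCurvature (G : ℝ × ℝ → Matrix (Fin 2) (Fin 2) ℝ) (γ : ℝ → ℝ × ℝ) (t : ℝ) : ℝ :=
  volCoeff G (γ t) *
      (velocity γ 0 t * acceleration G γ 1 t - velocity γ 1 t * acceleration G γ 0 t) /
    √(∑ i, ∑ j, G (γ t) i j * velocity γ i t * velocity γ j t) ^ 3

/-- The geodesic curvature `k(x, y)` of the horizontal curve `t ↦ (x + t, y)` at `t = 0`. -/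
def horizontalCurvature {M : Type*} [TopologicalSpace M]
    [ChartedSpace (EuclideanHalfSpace 2) M] (g : ZeroMetric M) (φ : SurfaceChart M)
    (x y : ℝ) : ℝ :=
  geodesicCurvature (g.matrix φ) (fun t => (x + t, y)) 0

/-- `vol = y⁻² a(x) dx ∧ dy + O(y⁻¹)`, where a form is `O(y⁻¹)` if its product with `y` extends
smoothly to the boundary. -/
def IsVolumeLeadingCoeff {M : Type*} [TopologicalSpace M]
    [ChartedSpace (EuclideanHalfSpace 2) M] (g : ZeroMetric M) (φ : SurfaceChart M)
    (a : ℝ → ℝ) : Prop :=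
  ∃ r : ℝ × ℝ → ℝ, ContDiffOn ℝ ∞ r {z ∈ coordDom φ | z.1 ∈ bdryDom φ} ∧
    ∀ z ∈ coordDom φ, z.1 ∈ bdryDom φ → 0 < z.2 →
      volCoeff (g.matrix φ) z = (z.2 ^ 2)⁻¹ * a z.1 + z.2⁻¹ * r z

/-! ### The boundary Hill potential -/

/-- An oriented chart `ψ` which is a 0-isometry from an open subset of the surface
onto an open subset of the closed upper half-plane with its metric `(dx² + dy²) / y²`.  These are the
(half-plane valued) charts of the hyperbolic structure given by `g`. -/
def IsHyperbolicChart {M : Type*} [TopologicalSpace M] [ChartedSpace (EuclideanHalfSpace 2) M]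
    (o : SurfaceOrientation M) (g : ZeroMetric M) (ψ : SurfaceChart M) : Prop :=
  ψ ∈ o.charts ∧ ∀ z ∈ coordDom ψ, 0 < z.2 → g.matrix ψ z = (z.2 ^ 2)⁻¹ • 1

/-- The boundary restriction of the chart `ψ`, as a function of the boundary coordinate `x` of
`φ`.  For hyperbolic charts `ψ`, these are the (real-valued) charts of the projective
structure on the boundary which is induced by the hyperbolic structure. -/
def bdryChart {M : Type*} [TopologicalSpace M] (φ ψ : SurfaceChart M) (x : ℝ) : ℝ :=
  (ψ.extend (𝓡∂ 2) (coordPt φ (x, 0))) 1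

/-- The map `(u₁ : u₂)` from the open set `J` to the real projective line is compatible with all
charts `f` of the induced projective structure on the boundary: locally
`(u₁ : u₂) = h • (f : 1)`, for a constant `h` in `SL(2, ℝ)`. -/
def IsProjectiveBoundaryChart {M : Type*} [TopologicalSpace M]
    [ChartedSpace (EuclideanHalfSpace 2) M] (o : SurfaceOrientation M) (g : ZeroMetric M)
    (φ : SurfaceChart M) (J : Set ℝ) (u₁ u₂ : ℝ → ℝ) : Prop :=
  ∀ ψ, IsHyperbolicChart o g ψ → ∀ x₀ ∈ J, coordPt φ (x₀, 0) ∈ ψ.source →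
    ∃ h : Matrix.SpecialLinearGroup (Fin 2) ℝ, ∀ᶠ x in 𝓝 x₀, ∃ s : ℝ, s ≠ 0 ∧
      ![u₁ x, u₂ x] = s • ((h : Matrix (Fin 2) (Fin 2) ℝ).mulVec ![bdryChart φ ψ x, 1])

/-- `T` is, in the boundary coordinate `x` of `φ`, the Hill potential of the hyperbolic 0-metric `g`:
hyperbolic charts exist around all boundary points of the domain of `φ`, so that the
boundary has an induced projective structure, and the Hill operator `L = d²/dx² + T` is the one
which corresponds to this projective structure, that is, `(u₁ : u₂)` is a chart of the projective
structure for all local solutions of `L u = 0` with Wronskian `u₁ u₂' - u₁' u₂ = -1`. -/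
def IsHillPotential {M : Type*} [TopologicalSpace M] [ChartedSpace (EuclideanHalfSpace 2) M]
    (o : SurfaceOrientation M) (g : ZeroMetric M) (φ : SurfaceChart M) (T : ℝ → ℝ) : Prop :=
  ContDiffOn ℝ ∞ T (bdryDom φ) ∧
  (∀ x ∈ bdryDom φ, ∃ ψ, IsHyperbolicChart o g ψ ∧ coordPt φ (x, 0) ∈ ψ.source) ∧
  ∀ J : Set ℝ, IsOpen J → J ⊆ bdryDom φ → ∀ u₁ u₂ : ℝ → ℝ,
    ContDiffOn ℝ ∞ u₁ J → ContDiffOn ℝ ∞ u₂ J →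
    (∀ x ∈ J, deriv (deriv u₁) x + T x * u₁ x = 0) →
    (∀ x ∈ J, deriv (deriv u₂) x + T x * u₂ x = 0) →
    (∀ x ∈ J, u₁ x * deriv u₂ x - deriv u₁ x * u₂ x = -1) →
    IsProjectiveBoundaryChart o g φ J u₁ u₂

end

/-! A hyperbolic metric carries a flat `sl(2, ℝ)`-connection whose parallel sections develop the
surface into the upper half-plane. For a 0-metric this connection has, in a suitable frame,
coefficients that are smooth up to the boundary. Its restriction to the boundary is Hill's equation,
so the potential can be read off from the coefficients of the metric.

A Cholesky factorisation of `y² g` gives the coframe `(p dx + q dy)/y`, `d dy/y`. The Gauss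
equation, multiplied by powers of `y` and evaluated at `y = 0`, forces `d = 1 + yν` and `p_y - q_x +
pν = y d σ` with `ν`, `σ` smooth up to the boundary (`IsHalfOpen.exists_normalForm`). With `τ = (qσ
- ν_x)/p` the spin connection is `κ = (yσ - p/y) dx + (yτ - q/y) dy`, and curvature `-1` becomes
`τ_x - σ_y = -σν`. The volume form is `y⁻² p d dx ∧ dy`, whence `a = p(x, 0)`. Horizontal curves
have curvature `-κ(∂x)/(p/y) = 1 - y²σ/p`, whence `c = -σ/p` at `y = 0`.

These equations say that a trace-free linear system for `(P, Q)` is flat (`IsParallelSection`). Two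
solutions of determinant one give `w = (Q₁ + iyP₁)/(Q₂ + iyP₂)` with `dw = (p dx + (q + id) dy)/(Q₂
+ iyP₂)²` and `Im w = y/|Q₂ + iyP₂|²`. Thus `w` pulls the half-plane metric back to `g`; by an
inverse function theorem at the boundary it is a hyperbolic chart
(`IsParallelBasis.exists_hyperbolicChart`). On `y = 0` the system reads `P' = σQ/2`, `Q' = pP`, so
`Q₁/√p` and `Q₂/√p` solve Hill's equation with the asserted potential. Their Wronskian is `-1` and
their quotient is the boundary value of `w` (`HyperbolicNormalForm.isHillBasis`).

Any other hyperbolic chart differs from `w` on the boundary by a map with vanishing Schwarzian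
derivative, hence by a Möbius map (`IsHyperbolicChart.exists_moebius`). So the potential above is a
Hill potential. It is the only one because a normalised basis of solutions determines the potential
through its projective class (`IsHillBasis.potential_eq`). -/

noncomputable section

/-! ### Calculus on relatively open subsets of the closed half-plane -/

/-- The closed half-plane `{(x, y) | 0 ≤ y}`. -/
def closedHalfPlane : Set (ℝ × ℝ) := {z | 0 ≤ z.2}

theorem convex_closedHalfPlane : Convex ℝ closedHalfPlane :=
  convex_halfSpace_ge (IsLinearMap.mk (fun _ _ => rfl) fun _ _ => rfl) 0

theorem isClosed_closedHalfPlane : IsClosed closedHalfPlane :=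
  isClosed_le continuous_const continuous_snd

theorem closedHalfPlane_mem_nhds {z : ℝ × ℝ} (hz : 0 < z.2) : closedHalfPlane ∈ 𝓝 z :=
  Filter.mem_of_superset ((isOpen_lt continuous_const continuous_snd).mem_nhds hz)
    fun _ h => le_of_lt (α := ℝ) h

theorem interior_closedHalfPlane : interior closedHalfPlane = {z | 0 < z.2} := by
  have h : closedHalfPlane = Set.univ ×ˢ Set.Ici (0 : ℝ) := by
    ext z; simp [closedHalfPlane]
  rw [h, interior_prod_eq, interior_univ, interior_Ici]
  ext z; simp

theorem uniqueDiffOn_closedHalfPlane : UniqueDiffOn ℝ closedHalfPlane :=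
  uniqueDiffOn_convex convex_closedHalfPlane
    ⟨(0, 1), by rw [interior_closedHalfPlane]; exact one_pos (α := ℝ)⟩

/-- Relatively open subsets of the closed half-plane. -/
structure IsHalfOpen (D : Set (ℝ × ℝ)) : Prop where
  subset : D ⊆ closedHalfPlane
  mem_nhdsWithin : ∀ z ∈ D, D ∈ 𝓝[closedHalfPlane] z

namespace IsHalfOpen

variable {D D' : Set (ℝ × ℝ)}

theorem nhdsWithin_eq (hD : IsHalfOpen D) {z : ℝ × ℝ} (hz : z ∈ D) :
    𝓝[D] z = 𝓝[closedHalfPlane] z :=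
  le_antisymm (nhdsWithin_mono _ hD.subset)
    (nhdsWithin_le_of_mem (hD.mem_nhdsWithin z hz))

theorem uniqueDiffOn (hD : IsHalfOpen D) : UniqueDiffOn ℝ D := fun z hz =>
  (uniqueDiffOn_closedHalfPlane z (hD.subset hz)).mono_nhds (hD.nhdsWithin_eq hz).ge

theorem mem_nhds (hD : IsHalfOpen D) {z : ℝ × ℝ} (hz : z ∈ D) (hz' : 0 < z.2) : D ∈ 𝓝 z := by
  have h := hD.mem_nhdsWithin z hz
  rwa [nhdsWithin_eq_nhds.2 (closedHalfPlane_mem_nhds hz')] at h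

theorem of_isOpen {O : Set (ℝ × ℝ)} (hO : IsOpen O) : IsHalfOpen (closedHalfPlane ∩ O) where
  subset := Set.inter_subset_left
  mem_nhdsWithin _ hz := Filter.inter_mem self_mem_nhdsWithin
    (mem_nhdsWithin_of_mem_nhds (hO.mem_nhds hz.2))

theorem inter (hD : IsHalfOpen D) (hD' : IsHalfOpen D') : IsHalfOpen (D ∩ D') where
  subset := Set.inter_subset_left.trans hD.subset
  mem_nhdsWithin z hz := Filter.inter_mem (hD.mem_nhdsWithin z hz.1) (hD'.mem_nhdsWithin z hz.2)

theorem isOpen_interior (hD : IsHalfOpen D) : IsOpen {z ∈ D | 0 < z.2} :=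
  isOpen_iff_mem_nhds.2 fun _ hz => Filter.inter_mem (hD.mem_nhds hz.1 hz.2)
    ((isOpen_lt continuous_const continuous_snd).mem_nhds hz.2)

theorem preimage_continuousOn (hD : IsHalfOpen D) {X : Type*} [TopologicalSpace X]
    {f : ℝ × ℝ → X} (hf : ContinuousOn f D) {O : Set X} (hO : IsOpen O) :
    IsHalfOpen (D ∩ f ⁻¹' O) where
  subset := Set.inter_subset_left.trans hD.subset
  mem_nhdsWithin z hz := by
    rw [← hD.nhdsWithin_eq hz.1]
    exact Filter.inter_mem self_mem_nhdsWithin (hf z hz.1 (hO.mem_nhds hz.2))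

theorem mem_closure_interior (hD : IsHalfOpen D) {z : ℝ × ℝ} (hz : z ∈ D) :
    (𝓝[{z ∈ D | 0 < z.2}] z).NeBot := by
  rw [← mem_closure_iff_nhdsWithin_neBot]
  have h0 : 0 ≤ z.2 := hD.subset hz
  have h1 : Filter.Tendsto (fun t : ℝ => (z.1, z.2 + t)) (𝓝[>] 0) (𝓝 z) := by
    have : Continuous fun t : ℝ => (z.1, z.2 + t) := by fun_prop
    have h := this.tendsto 0
    simp only [add_zero] at h
    exact h.mono_left nhdsWithin_le_nhds
  have h2 : Filter.Tendsto (fun t : ℝ => (z.1, z.2 + t)) (𝓝[>] 0) (𝓝[closedHalfPlane] z) :=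
    tendsto_nhdsWithin_iff.2 ⟨h1, by
      filter_upwards [self_mem_nhdsWithin] with t ht
      exact add_nonneg h0 (le_of_lt ht)⟩
  refine mem_closure_of_tendsto h1 ?_
  filter_upwards [h2 (hD.mem_nhdsWithin z hz), self_mem_nhdsWithin] with t ht ht'
  exact ⟨ht, add_pos_of_nonneg_of_pos h0 ht'⟩

/-- Points with `y > 0` are dense in a relatively open set. This is how boundary identities arise
below: an identity valid for `y > 0` is divided by a power of `y`, extended by continuity, and
evaluated at `y = 0`. -/
theorem eqOn_of_eqOn_interior (hD : IsHalfOpen D) {X : Type*} [TopologicalSpace X] [T2Space X]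
    {f g : ℝ × ℝ → X} (hf : ContinuousOn f D) (hg : ContinuousOn g D)
    (h : ∀ z ∈ D, 0 < z.2 → f z = g z) : ∀ z ∈ D, f z = g z := by
  intro z hz
  have := hD.mem_closure_interior hz
  have hs : {z ∈ D | 0 < z.2} ⊆ D := fun _ h => h.1
  refine tendsto_nhds_unique ((hf z hz).mono_left (nhdsWithin_mono _ hs))
    (((hg z hz).mono_left (nhdsWithin_mono _ hs)).congr' ?_)
  filter_upwards [self_mem_nhdsWithin] with w hw
  exact (h w hw.1 hw.2).symm

/-- The part of a relatively open set on the boundary line is open. -/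
theorem isOpen_boundary (hD : IsHalfOpen D) : IsOpen {x : ℝ | (x, (0 : ℝ)) ∈ D} := by
  refine isOpen_iff_mem_nhds.2 fun x hx => ?_
  have h : Filter.Tendsto (fun t : ℝ => (t, (0 : ℝ))) (𝓝 x) (𝓝[closedHalfPlane] (x, 0)) :=
    tendsto_nhdsWithin_iff.2 ⟨(by fun_prop : Continuous fun t : ℝ => (t, (0 : ℝ))).tendsto x,
      Filter.Eventually.of_forall fun t => le_refl (0 : ℝ)⟩
  exact h (hD.mem_nhdsWithin _ hx)

end IsHalfOpen

/-- `f` has partial derivatives `a`, `b` at `z` (one-sided at the boundary). -/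
def HasPartials (f : ℝ × ℝ → ℝ) (a b : ℝ) (z : ℝ × ℝ) : Prop :=
  HasFDerivWithinAt f (a • ContinuousLinearMap.fst ℝ ℝ ℝ + b • ContinuousLinearMap.snd ℝ ℝ ℝ)
    closedHalfPlane z

/-- The partial derivatives of `f`, one-sided at the boundary of the closed half-plane. -/
def hderiv (i : Fin 2) (f : ℝ × ℝ → ℝ) (z : ℝ × ℝ) : ℝ :=
  fderivWithin ℝ f closedHalfPlane z (basisVec i)

theorem clm_eq_fst_snd (L : ℝ × ℝ →L[ℝ] ℝ) :
    L = L (basisVec 0) • ContinuousLinearMap.fst ℝ ℝ ℝ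
      + L (basisVec 1) • ContinuousLinearMap.snd ℝ ℝ ℝ := by
  ext <;> simp [basisVec]

/-! ### Rules for one-sided partial derivatives. -/

section Partials

variable {f g : ℝ × ℝ → ℝ} {a b a' b' : ℝ} {z : ℝ × ℝ} {D : Set (ℝ × ℝ)}

theorem DifferentiableWithinAt.hasPartials (h : DifferentiableWithinAt ℝ f closedHalfPlane z) :
    HasPartials f (hderiv 0 f z) (hderiv 1 f z) z := by
  have h' := h.hasFDerivWithinAt
  rwa [clm_eq_fst_snd (fderivWithin ℝ f closedHalfPlane z)] at h'

theorem ContDiffOn.differentiableWithinAt_half (hf : ContDiffOn ℝ ∞ f D) (hD : IsHalfOpen D)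
    (hz : z ∈ D) : DifferentiableWithinAt ℝ f closedHalfPlane z :=
  ((hf.differentiableOn (by simp)) z hz).mono_of_mem_nhdsWithin
    (hD.mem_nhdsWithin z hz)

theorem ContDiffOn.hasPartials (hf : ContDiffOn ℝ ∞ f D) (hD : IsHalfOpen D) (hz : z ∈ D) :
    HasPartials f (hderiv 0 f z) (hderiv 1 f z) z :=
  (hf.differentiableWithinAt_half hD hz).hasPartials

namespace HasPartials

theorem hderiv_zero (h : HasPartials f a b z) (hz : z ∈ closedHalfPlane) : hderiv 0 f z = a := by
  unfold hderiv
  rw [HasFDerivWithinAt.fderivWithin h (uniqueDiffOn_closedHalfPlane z hz)]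
  simp [basisVec]

theorem hderiv_one (h : HasPartials f a b z) (hz : z ∈ closedHalfPlane) : hderiv 1 f z = b := by
  unfold hderiv
  rw [HasFDerivWithinAt.fderivWithin h (uniqueDiffOn_closedHalfPlane z hz)]
  simp [basisVec]

theorem hasFDerivAt (h : HasPartials f a b z) (hz : 0 < z.2) : HasFDerivAt f
    (a • ContinuousLinearMap.fst ℝ ℝ ℝ + b • ContinuousLinearMap.snd ℝ ℝ ℝ) z :=
  HasFDerivWithinAt.hasFDerivAt h (closedHalfPlane_mem_nhds hz)

theorem pderiv_zero (h : HasPartials f a b z) (hz : 0 < z.2) : pderiv 0 f z = a := by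
  unfold pderiv
  rw [(h.hasFDerivAt hz).fderiv]
  simp [basisVec]

theorem pderiv_one (h : HasPartials f a b z) (hz : 0 < z.2) : pderiv 1 f z = b := by
  unfold pderiv
  rw [(h.hasFDerivAt hz).fderiv]
  simp [basisVec]

theorem congr_coeff (h : HasPartials f a b z) (ha : a = a') (hb : b = b') :
    HasPartials f a' b' z := ha ▸ hb ▸ h

theorem congr_of_eqOn (h : HasPartials f a b z) (hD : IsHalfOpen D) (hz : z ∈ D)
    (hfg : ∀ w ∈ D, g w = f w) : HasPartials g a b z :=
  HasFDerivWithinAt.congr_of_eventuallyEq h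
    (Filter.eventually_of_mem (hD.mem_nhdsWithin z hz) hfg) (hfg z hz)

theorem const (c : ℝ) : HasPartials (fun _ => c) 0 0 z := by
  unfold HasPartials
  simpa using hasFDerivWithinAt_const c z closedHalfPlane

theorem snd : HasPartials Prod.snd 0 1 z := by
  unfold HasPartials
  simpa using (hasFDerivAt_snd (𝕜 := ℝ) (p := z)).hasFDerivWithinAt

theorem add (h : HasPartials f a b z) (h' : HasPartials g a' b' z) :
    HasPartials (fun w => f w + g w) (a + a') (b + b') z := by
  refine (HasFDerivWithinAt.fun_add h h').congr_fderiv ?_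
  ext <;> simp

theorem sub (h : HasPartials f a b z) (h' : HasPartials g a' b' z) :
    HasPartials (fun w => f w - g w) (a - a') (b - b') z := by
  refine (HasFDerivWithinAt.fun_sub h h').congr_fderiv ?_
  ext <;> simp

theorem neg (h : HasPartials f a b z) : HasPartials (fun w => -f w) (-a) (-b) z := by
  refine (HasFDerivWithinAt.fun_neg h).congr_fderiv ?_
  ext <;> simp

theorem mul (h : HasPartials f a b z) (h' : HasPartials g a' b' z) :
    HasPartials (fun w => f w * g w) (a * g z + f z * a') (b * g z + f z * b') z := by
  refine (HasFDerivWithinAt.fun_mul h h').congr_fderiv ?_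
  ext <;> simp <;> ring

theorem comp_hasDerivAt {φ : ℝ → ℝ} {c : ℝ} (hφ : HasDerivAt φ c (f z))
    (h : HasPartials f a b z) : HasPartials (fun w => φ (f w)) (c * a) (c * b) z := by
  refine (hφ.comp_hasFDerivWithinAt z h).congr_fderiv ?_
  ext <;> simp

theorem inv (h : HasPartials f a b z) (h0 : f z ≠ 0) :
    HasPartials (fun w => (f w)⁻¹) (-a / f z ^ 2) (-b / f z ^ 2) z :=
  (comp_hasDerivAt (hasDerivAt_inv h0) h).congr_coeff (by ring) (by ring)

theorem div (h : HasPartials f a b z) (h' : HasPartials g a' b' z) (h0 : g z ≠ 0) :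
    HasPartials (fun w => f w / g w) ((a * g z - f z * a') / g z ^ 2)
      ((b * g z - f z * b') / g z ^ 2) z := by
  simp only [div_eq_mul_inv]
  refine (h.mul (h'.inv h0)).congr_coeff ?_ ?_ <;> field_simp <;> ring

theorem pow_two (h : HasPartials f a b z) :
    HasPartials (fun w => f w ^ 2) (2 * f z * a) (2 * f z * b) z := by
  simp only [_root_.pow_two]
  exact (h.mul h).congr_coeff (by ring) (by ring)

/-- The derivative along the horizontal line through `z`. -/
theorem hasDerivAt_fst (h : HasPartials f a b z) (hz : z ∈ closedHalfPlane) :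
    HasDerivAt (fun x => f (x, z.2)) a z.1 := by
  have h1 : HasDerivAt (fun x : ℝ => (x, z.2)) (1, 0) z.1 :=
    (hasDerivAt_id z.1).prodMk (hasDerivAt_const _ _)
  have h2 := HasFDerivWithinAt.comp_hasDerivWithinAt (t := closedHalfPlane) (l := f)
    (f := fun x : ℝ => (x, z.2)) z.1 h
    (h1.hasDerivWithinAt (s := Set.univ)) (fun x _ => hz)
  simpa [Function.comp_def] using h2

end HasPartials

theorem ContDiffOn.hderiv (i : Fin 2) (hf : ContDiffOn ℝ ∞ f D) (hD : IsHalfOpen D) :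
    ContDiffOn ℝ ∞ (hderiv i f) D := by
  have h : ContDiffOn ℝ ∞ (fun z => fderivWithin ℝ f D z (basisVec i)) D :=
    (hf.fderivWithin hD.uniqueDiffOn (by simp)).clm_apply contDiffOn_const
  refine h.congr fun z hz => ?_
  unfold _root_.hderiv
  rw [fderivWithin_congr_set' (y := z)]
  exact Filter.Eventually.filter_mono nhdsWithin_le_nhds
    (nhdsWithin_eq_iff_eventuallyEq.1 (hD.nhdsWithin_eq hz).symm)

theorem hderiv_eq_pderiv (i : Fin 2) (hz : 0 < z.2) : hderiv i f z = pderiv i f z := by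
  unfold hderiv pderiv
  rw [fderivWithin_of_mem_nhds (closedHalfPlane_mem_nhds hz)]

/-- Symmetry of the second partial derivatives. -/
theorem ContDiffOn.hderiv_comm (hf : ContDiffOn ℝ ∞ f D) (hD : IsHalfOpen D) (hz : z ∈ D) :
    _root_.hderiv 0 (_root_.hderiv 1 f) z = _root_.hderiv 1 (_root_.hderiv 0 f) z := by
  -- Both mixed derivatives are continuous up to the boundary, so the classical symmetry for `y > 0`
  -- suffices.
  refine hD.eqOn_of_eqOn_interior ((hf.hderiv 1 hD).hderiv 0 hD).continuousOn
    ((hf.hderiv 0 hD).hderiv 1 hD).continuousOn (fun z hz hz' => ?_) z hz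
  have hfz : ContDiffAt ℝ ∞ f z := hf.contDiffAt (hD.mem_nhds hz hz')
  have key : ∀ i j : Fin 2, _root_.hderiv i (_root_.hderiv j f) z
      = fderiv ℝ (fderiv ℝ f) z (basisVec i) (basisVec j) := by
    intro i j
    rw [hderiv_eq_pderiv i hz']
    unfold pderiv
    have h1 : _root_.hderiv j f =ᶠ[𝓝 z] fun w => fderiv ℝ f w (basisVec j) := by
      filter_upwards [(isOpen_lt continuous_const continuous_snd).mem_nhds hz'] with w hw
      exact hderiv_eq_pderiv j hw
    have h2 : DifferentiableAt ℝ (fderiv ℝ f) z :=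
      (hfz.fderiv_right (m := 1) (by norm_cast)).differentiableAt (by simp)
    rw [h1.fderiv_eq, fderiv_clm_apply h2 (differentiableAt_const _)]
    simp
  rw [key, key]
  exact hfz.isSymmSndFDerivAt (by simp; norm_cast) _ _

end Partials

/-! ### Uniform differentiability and division by the boundary defining function -/

/-- A continuously differentiable function on a compact convex set is uniformly differentiable. -/
theorem Convex.exists_forall_norm_sub_le {F G : Type*} [NormedAddCommGroup F] [NormedSpace ℝ F]
    [NormedAddCommGroup G] [NormedSpace ℝ G] {s : Set F} (hs : Convex ℝ s) (hc : IsCompact s)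
    {f : F → G} {f' : F → F →L[ℝ] G} (hf : ∀ z ∈ s, HasFDerivWithinAt f (f' z) s z)
    (hf' : ContinuousOn f' s) {ε : ℝ} (hε : 0 < ε) :
    ∃ δ > 0, ∀ z ∈ s, ∀ w ∈ s, ‖w - z‖ < δ → ‖f w - f z - f' z (w - z)‖ ≤ ε * ‖w - z‖ := by
  obtain ⟨δ, hδ, h⟩ := Metric.uniformContinuousOn_iff.1
    (hc.uniformContinuousOn_of_continuous hf') ε hε
  refine ⟨δ, hδ, fun z hz w hw hzw => ?_⟩
  -- Mean value inequality on the convex set `s ∩ ball z δ`, where uniform continuity keeps `f'`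
  -- within `ε` of `f' z`.
  refine Convex.norm_image_sub_le_of_norm_hasFDerivWithin_le' (s := s ∩ Metric.ball z δ)
    (f' := f') (fun v hv => (hf v hv.1).mono Set.inter_subset_left) (fun v hv => ?_)
    (hs.inter (convex_ball z δ)) ⟨hz, Metric.mem_ball_self hδ⟩
    ⟨hw, by rwa [Metric.mem_ball, dist_eq_norm]⟩
  rw [← dist_eq_norm]
  exact (h v hv.1 z hz hv.2).le

/-- A weighted integral over the vertical segment from the boundary line to `z`. -/
def vertInt (k : ℕ) (F : ℝ × ℝ → ℝ) (z : ℝ × ℝ) : ℝ := ∫ t in (0 : ℝ)..1, t ^ k * F (z.1, t * z.2)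

/-! ### Differentiation of vertical integrals under the integral sign. -/

section VertInt

variable {s : Set (ℝ × ℝ)} {F : ℝ × ℝ → ℝ}

theorem vertInt_integrable (hv : ∀ z ∈ s, ∀ t ∈ Set.Icc (0 : ℝ) 1, (z.1, t * z.2) ∈ s)
    (hF : ContinuousOn F s) (k : ℕ) {z : ℝ × ℝ} (hz : z ∈ s) :
    IntervalIntegrable (fun t => t ^ k * F (z.1, t * z.2)) MeasureTheory.volume 0 1 := by
  apply ContinuousOn.intervalIntegrable
  rw [Set.uIcc_of_le zero_le_one]
  refine (continuousOn_pow k).mul (hF.comp (by fun_prop) fun t ht => hv z hz t ht)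

/-- The remainder of the first-order expansion is the weighted integral of the remainders of `F`,
which are uniformly small on the compact convex set. The `y`-derivative acquires a factor `t` from
the chain rule, which is why the weights `t ^ k` are carried along. -/
theorem hasFDerivWithinAt_vertInt (hs : Convex ℝ s) (hc : IsCompact s)
    (hv : ∀ z ∈ s, ∀ t ∈ Set.Icc (0 : ℝ) 1, (z.1, t * z.2) ∈ s)
    {F' : ℝ × ℝ → ℝ × ℝ →L[ℝ] ℝ} (hF : ∀ z ∈ s, HasFDerivWithinAt F (F' z) s z)
    (hF' : ContinuousOn F' s) (k : ℕ) {z : ℝ × ℝ} (hz : z ∈ s) :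
    HasFDerivWithinAt (vertInt k F)
      (vertInt k (fun w => F' w (1, 0)) z • ContinuousLinearMap.fst ℝ ℝ ℝ
        + vertInt (k + 1) (fun w => F' w (0, 1)) z • ContinuousLinearMap.snd ℝ ℝ ℝ) s z := by
  have hFc : ContinuousOn F s := fun z hz => (hF z hz).continuousWithinAt
  rw [hasFDerivWithinAt_iff_isLittleO, Asymptotics.isLittleO_iff]
  intro ε hε
  obtain ⟨δ, hδ, h⟩ := hs.exists_forall_norm_sub_le hc hF hF' hε
  filter_upwards [self_mem_nhdsWithin, mem_nhdsWithin_of_mem_nhds (Metric.ball_mem_nhds z hδ)]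
    with w hw hwz
  have hx : ContinuousOn (fun w => F' w (1, 0)) s := hF'.clm_apply continuousOn_const
  have hy : ContinuousOn (fun w => F' w (0, 1)) s := hF'.clm_apply continuousOn_const
  have e : vertInt k F w - vertInt k F z
      - (vertInt k (fun w => F' w (1, 0)) z • ContinuousLinearMap.fst ℝ ℝ ℝ
        + vertInt (k + 1) (fun w => F' w (0, 1)) z • ContinuousLinearMap.snd ℝ ℝ ℝ) (w - z)
      = ∫ t in (0 : ℝ)..1, t ^ k * (F (w.1, t * w.2) - F (z.1, t * z.2)
          - F' (z.1, t * z.2) ((w.1, t * w.2) - (z.1, t * z.2))) := by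
    simp only [vertInt, add_apply, smul_apply,
      ContinuousLinearMap.coe_fst', ContinuousLinearMap.coe_snd', smul_eq_mul]
    rw [← intervalIntegral.integral_mul_const, ← intervalIntegral.integral_mul_const,
      ← intervalIntegral.integral_sub (vertInt_integrable hv hFc k hw)
        (vertInt_integrable hv hFc k hz),
      ← intervalIntegral.integral_add ((vertInt_integrable hv hx k hz).mul_const _)
        ((vertInt_integrable hv hy (k + 1) hz).mul_const _),
      ← intervalIntegral.integral_sub
        ((vertInt_integrable hv hFc k hw).sub (vertInt_integrable hv hFc k hz))
        (((vertInt_integrable hv hx k hz).mul_const _).add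
          ((vertInt_integrable hv hy (k + 1) hz).mul_const _))]
    congr 1
    ext t
    have : ((w.1, t * w.2) - (z.1, t * z.2) : ℝ × ℝ)
        = (w - z).1 • ((1, 0) : ℝ × ℝ) + (t * (w - z).2) • ((0, 1) : ℝ × ℝ) := by
      ext <;> simp; ring
    rw [this, map_add, map_smul, map_smul, smul_eq_mul, smul_eq_mul]
    ring
  rw [e]
  have hb := intervalIntegral.norm_integral_le_of_norm_le_const (a := (0 : ℝ)) (b := 1)
    (C := ε * ‖w - z‖) (f := fun t => t ^ k * (F (w.1, t * w.2) - F (z.1, t * z.2)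
          - F' (z.1, t * z.2) ((w.1, t * w.2) - (z.1, t * z.2)))) ?_
  · simpa using hb
  intro t ht
  rw [Set.uIoc_of_le zero_le_one] at ht
  have ht' : t ∈ Set.Icc (0 : ℝ) 1 := ⟨ht.1.le, ht.2⟩
  -- Vertical contraction is 1-Lipschitz for the maximum norm, so a single `δ` serves all `t`.
  have hle : ‖((w.1, t * w.2) - (z.1, t * z.2) : ℝ × ℝ)‖ ≤ ‖w - z‖ := by
    rw [Prod.norm_def, Prod.norm_def]
    refine max_le_max le_rfl ?_
    simp only [Prod.snd_sub, ← mul_sub, norm_mul]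
    refine mul_le_of_le_one_left (norm_nonneg _) ?_
    rw [Real.norm_of_nonneg ht.1.le]; exact ht.2
  have h1 := h _ (hv z hz t ht') _ (hv w hw t ht') (hle.trans_lt (by rwa [← dist_eq_norm]))
  rw [norm_mul, norm_pow, Real.norm_of_nonneg ht.1.le]
  refine (mul_le_of_le_one_left (norm_nonneg _) (pow_le_one₀ ht.1.le ht.2)).trans ?_
  exact h1.trans (mul_le_mul_of_nonneg_left hle hε.le)

/-- The partial derivatives of a vertical integral are again vertical integrals, of partial
derivatives of `F` with weights `k` and `k + 1`. The induction on the order of differentiability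
therefore runs over all `F` and `k` at once. -/
theorem contDiffOn_vertInt (hs : Convex ℝ s) (hc : IsCompact s) (hu : UniqueDiffOn ℝ s)
    (hv : ∀ z ∈ s, ∀ t ∈ Set.Icc (0 : ℝ) 1, (z.1, t * z.2) ∈ s)
    (hF : ContDiffOn ℝ ∞ F s) (k : ℕ) : ContDiffOn ℝ ∞ (vertInt k F) s := by
  rw [contDiffOn_infty]
  intro n
  have hd : ∀ {F : ℝ × ℝ → ℝ}, ContDiffOn ℝ ∞ F s → ∀ z ∈ s,
      HasFDerivWithinAt F (fderivWithin ℝ F s z) s z := fun hF z hz =>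
    (hF.differentiableOn (by simp) z hz).hasFDerivWithinAt
  have hdc : ∀ {F : ℝ × ℝ → ℝ}, ContDiffOn ℝ ∞ F s → ContDiffOn ℝ ∞ (fderivWithin ℝ F s) s :=
    fun hF => hF.fderivWithin hu (by simp)
  induction n generalizing F k with
  | zero =>
    exact contDiffOn_zero.2 fun z hz =>
      (hasFDerivWithinAt_vertInt hs hc hv (hd hF) (hdc hF).continuousOn k hz).continuousWithinAt
  | succ n ih =>
    have hder := fun z (hz : z ∈ s) =>
      hasFDerivWithinAt_vertInt hs hc hv (hd hF) (hdc hF).continuousOn k hz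
    push_cast
    rw [contDiffOn_succ_iff_fderivWithin hu]
    refine ⟨fun z hz => (hder z hz).differentiableWithinAt, by simp, ?_⟩
    refine ContDiffOn.congr ?_ fun z hz => (hder z hz).fderivWithin (hu z hz)
    exact ((ih ((hdc hF).clm_apply contDiffOn_const) k).smul contDiffOn_const).add
      ((ih ((hdc hF).clm_apply contDiffOn_const) (k + 1)).smul contDiffOn_const)

end VertInt

/-- Boxes based on the boundary line. -/
def baseBox (x ε : ℝ) : Set (ℝ × ℝ) := Set.Icc (x - ε) (x + ε) ×ˢ Set.Icc 0 ε

theorem convex_baseBox (x ε : ℝ) : Convex ℝ (baseBox x ε) :=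
  (convex_Icc _ _).prod (convex_Icc _ _)

theorem isCompact_baseBox (x ε : ℝ) : IsCompact (baseBox x ε) := isCompact_Icc.prod isCompact_Icc

theorem uniqueDiffOn_baseBox (x : ℝ) {ε : ℝ} (hε : 0 < ε) : UniqueDiffOn ℝ (baseBox x ε) :=
  (uniqueDiffOn_Icc (by linarith)).prod (uniqueDiffOn_Icc hε)

theorem mem_baseBox_self (x : ℝ) {ε : ℝ} (hε : 0 ≤ ε) : (x, (0 : ℝ)) ∈ baseBox x ε :=
  ⟨⟨by simpa, by simpa⟩, ⟨le_rfl, hε⟩⟩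

theorem baseBox_subset_closedHalfPlane (x ε : ℝ) : baseBox x ε ⊆ closedHalfPlane :=
  fun _ hz => hz.2.1

theorem baseBox_mem_nhdsWithin (x : ℝ) {ε : ℝ} (hε : 0 < ε) :
    baseBox x ε ∈ 𝓝[closedHalfPlane] (x, 0) := by
  have : Set.Icc (x - ε) (x + ε) ×ˢ Set.Icc (-ε) ε ∈ 𝓝 (x, (0 : ℝ)) :=
    prod_mem_nhds (Icc_mem_nhds (by linarith) (by linarith))
      (Icc_mem_nhds (by linarith) (by linarith))
  filter_upwards [self_mem_nhdsWithin, mem_nhdsWithin_of_mem_nhds this] with z hz hz'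
  exact ⟨hz'.1, hz, hz'.2.2⟩

theorem IsHalfOpen.exists_baseBox_subset {D : Set (ℝ × ℝ)} (hD : IsHalfOpen D) {x : ℝ}
    (hx : (x, (0 : ℝ)) ∈ D) : ∃ ε > 0, baseBox x ε ⊆ D := by
  obtain ⟨ε, hε, h⟩ := Metric.mem_nhdsWithin_iff.1 (hD.mem_nhdsWithin _ hx)
  refine ⟨ε / 2, by positivity, fun z hz => h ⟨?_, hz.2.1⟩⟩
  rw [Metric.mem_ball, Prod.dist_eq, max_lt_iff, Real.dist_eq, Real.dist_eq, abs_lt, abs_lt]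
  have h1 := hz.1.1
  have h2 := hz.1.2
  have h3 := hz.2.1
  have h4 := hz.2.2
  refine ⟨⟨?_, ?_⟩, ⟨?_, ?_⟩⟩ <;> simp only [] <;> linarith

theorem IsHalfOpen.snd_nonneg {D : Set (ℝ × ℝ)} (hD : IsHalfOpen D) {z : ℝ × ℝ} (hz : z ∈ D) :
    0 ≤ z.2 := hD.subset hz

/-- A smooth function that vanishes on the boundary line is `y` times a smooth function. -/
theorem IsHalfOpen.exists_eq_snd_mul {D : Set (ℝ × ℝ)} (hD : IsHalfOpen D) {f : ℝ × ℝ → ℝ}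
    (hf : ContDiffOn ℝ ∞ f D) (h0 : ∀ z ∈ D, z.2 = 0 → f z = 0) :
    ∃ g, ContDiffOn ℝ ∞ g D ∧ ∀ z ∈ D, f z = z.2 * g z := by
  classical
  -- Hadamard's lemma: near the boundary line this quotient is `∫₀¹ f_y(x, t y) dt`, whose value at
  -- `y = 0` is `f_y`. Away from the line the quotient is visibly smooth.
  set g : ℝ × ℝ → ℝ := fun z => if 0 < z.2 then f z / z.2 else hderiv 1 f z with hg
  refine ⟨g, fun z hz => ?_, fun z hz => ?_⟩
  · rcases (hD.snd_nonneg hz).lt_or_eq with hpos | hzero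
    · have h1 : ContDiffWithinAt ℝ ∞ (fun w : ℝ × ℝ => f w / w.2) D z :=
        (hf z hz).div contDiffWithinAt_snd hpos.ne'
      refine h1.congr_of_eventuallyEq ?_ (by simp [hg, hpos])
      refine mem_nhdsWithin_of_mem_nhds ?_
      filter_upwards [(isOpen_lt continuous_const continuous_snd).mem_nhds hpos] with w hw
      simp only [hg]; rw [if_pos hw]
    · obtain ⟨x, y⟩ := z
      obtain rfl : 0 = y := hzero
      obtain ⟨ε, hε, hb⟩ := hD.exists_baseBox_subset hz
      have hv : ∀ z ∈ baseBox x ε, ∀ t ∈ Set.Icc (0 : ℝ) 1, (z.1, t * z.2) ∈ baseBox x ε :=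
        fun z hz t ht => ⟨hz.1, mul_nonneg ht.1 hz.2.1,
          (mul_le_of_le_one_left hz.2.1 ht.2).trans hz.2.2⟩
      have h1 := contDiffOn_vertInt (convex_baseBox x ε) (isCompact_baseBox x ε)
        (uniqueDiffOn_baseBox x hε) hv ((hf.hderiv 1 hD).mono hb) 0
      have h2 : ContDiffOn ℝ ∞ g (baseBox x ε) := by
        refine h1.congr fun z hz => ?_
        simp only [hg, vertInt, pow_zero, one_mul]
        split_ifs with hpos
        · rw [div_eq_iff hpos.ne', ← intervalIntegral.integral_mul_const]
          have hc : ContinuousOn (fun t : ℝ => f (z.1, t * z.2)) (Set.Icc 0 1) :=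
            (hf.continuousOn.mono hb).comp (by fun_prop) fun t ht => hv z hz t ht
          rw [intervalIntegral.integral_eq_sub_of_hasDerivAt_of_le zero_le_one hc]
          · have h00 : f (z.1, 0) = 0 := h0 _ (by simpa using hb (hv z hz 0 (by simp))) rfl
            simp [h00]
          · intro t ht
            have ht' := hv z hz t ⟨ht.1.le, ht.2.le⟩
            have h3 := (hf.hasPartials hD (hb ht')).hasFDerivAt (mul_pos ht.1 hpos)
            have h4 : HasDerivAt (fun t : ℝ => (z.1, t * z.2)) (0, z.2) t := by
              simpa using (hasDerivAt_const t z.1).prodMk ((hasDerivAt_id t).mul_const z.2)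
            simpa [Function.comp_def] using h3.comp_hasDerivAt t h4
          · have := vertInt_integrable hv ((hf.hderiv 1 hD).continuousOn.mono hb) 0 hz
            simpa using this.mul_const z.2
        · have : z.2 = 0 := le_antisymm (not_lt.1 hpos) hz.2.1
          obtain ⟨z1, z2⟩ := z
          simp only at this
          simp [this]
      refine (h2 (x, 0) (mem_baseBox_self x hε.le)).mono_of_mem_nhdsWithin ?_
      rw [hD.nhdsWithin_eq hz]
      exact baseBox_mem_nhdsWithin x hε
  · rcases (hD.snd_nonneg hz).lt_or_eq with hpos | hzero
    · simp only [hg]; rw [if_pos hpos]; field_simp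
    · rw [← hzero, zero_mul]; exact h0 z hz hzero.symm

/-! ### Parallel sections of flat connections on trivial bundles over compact convex sets -/

section Parallel

variable {F E : Type*} [NormedAddCommGroup F] [NormedSpace ℝ F]
  [NormedAddCommGroup E] [NormedSpace ℝ E]

/-- On the ball of radius `‖r₀‖` about `r₀` vectors have norm at most `2‖r₀‖`, so the speed is at
most `‖r₀‖` and the solution stays in the ball up to time one. The bound `1 / 2` is chosen for this.
-/
theorem exists_linearODE_solution [CompleteSpace E] {A : ℝ → E →L[ℝ] E}
    (hA : ContinuousOn A (Set.Icc 0 1)) (hb : ∀ t ∈ Set.Icc (0 : ℝ) 1, ‖A t‖ ≤ 1 / 2) (r₀ : E) :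
    ∃ α : ℝ → E, α 0 = r₀ ∧
      ∀ t ∈ Set.Icc (0 : ℝ) 1, HasDerivWithinAt α (A t (α t)) (Set.Icc 0 1) t := by
  have h : IsPicardLindelof (fun t r => A t r) (tmin := 0) (tmax := 1) ⟨0, by simp⟩ r₀
      ‖r₀‖₊ 0 ‖r₀‖₊ 1 :=
    { lipschitzOnWith := fun t ht => by
        refine LipschitzWith.lipschitzOnWith ((A t).lipschitz.weaken ?_)
        rw [← NNReal.coe_le_coe]
        exact (hb t ht).trans (by norm_num)
      continuousOn := fun r _ => hA.clm_apply continuousOn_const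
      norm_le := fun t ht r hr => by
        have h1 : ‖r‖ ≤ 2 * ‖r₀‖ := by
          have := norm_le_norm_add_norm_sub' r r₀
          rw [Metric.mem_closedBall, dist_eq_norm] at hr
          simp only [coe_nnnorm] at hr
          linarith
        calc ‖A t r‖ ≤ 1 / 2 * (2 * ‖r₀‖) := (A t).le_of_opNorm_le_of_le (hb t ht) h1
          _ = ‖r₀‖₊ := by rw [coe_nnnorm]; ring
      mul_max_le := by simp }
  obtain ⟨α, h0, h1⟩ := h.exists_eq_forall_mem_Icc_hasDerivWithinAt₀
  exact ⟨α, h0, h1⟩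

/-- Grönwall's inequality with rate `1 / 2` gives the constant `2 (exp (1 / 2) - 1)`, which is at
most `2` because `e < 4`. -/
theorem norm_le_of_forced_linearODE {A : ℝ → E →L[ℝ] E}
    (hb : ∀ t ∈ Set.Icc (0 : ℝ) 1, ‖A t‖ ≤ 1 / 2) {u f : ℝ → E} {e : ℝ} (h0 : u 0 = 0)
    (hu : ∀ t ∈ Set.Icc (0 : ℝ) 1, HasDerivWithinAt u (A t (u t) + f t) (Set.Icc 0 1) t)
    (hf : ∀ t ∈ Set.Icc (0 : ℝ) 1, ‖f t‖ ≤ e) : ‖u 1‖ ≤ 2 * e := by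
  have he : 0 ≤ e := (norm_nonneg _).trans (hf 0 (by simp))
  have h := norm_le_gronwallBound_of_norm_deriv_right_le (f := u)
    (f' := fun t => A t (u t) + f t) (δ := 0) (K := 1 / 2) (ε := e) (a := 0) (b := 1)
    (fun t ht => (hu t ht).continuousWithinAt)
    (fun t ht => (hu t ⟨ht.1, ht.2.le⟩).mono_of_mem_nhdsWithin
      (Filter.mem_of_superset (Icc_mem_nhdsGE ht.2) (Set.Icc_subset_Icc_left ht.1)))
    (by simp [h0])
    (fun t ht => (norm_add_le _ _).trans (add_le_add
      ((A t).le_of_opNorm_le (hb t ⟨ht.1, ht.2.le⟩) _) (hf t ⟨ht.1, ht.2.le⟩)))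
    1 (by simp)
  refine h.trans ?_
  rw [gronwallBound_of_K_ne_0 (by norm_num)]
  have h2 : Real.exp (1 / 2 * (1 - 0)) ≤ 2 := by
    have h3 : Real.exp (1 / 2 * (1 - 0)) ^ 2 < 2 ^ 2 := by
      rw [← Real.exp_nat_mul]
      have := Real.exp_one_lt_d9
      norm_num at this ⊢
      linarith
    exact (lt_of_pow_lt_pow_left₀ 2 (by norm_num) h3).le
  have : e / (1 / 2) * (Real.exp (1 / 2 * (1 - 0)) - 1) ≤ e / (1 / 2) * 1 :=
    mul_le_mul_of_nonneg_left (by linarith) (by positivity)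
  linarith

set_option maxSynthPendingDepth 3 in
/-- A flat connection on a trivial bundle over a compact convex set has parallel sections with
arbitrary initial values. -/
theorem exists_parallel [CompleteSpace E] {s : Set F} (hs : Convex ℝ s) (hc : IsCompact s)
    {A : F → F →L[ℝ] E →L[ℝ] E} {A' : F → F →L[ℝ] F →L[ℝ] E →L[ℝ] E}
    (hA : ∀ z ∈ s, HasFDerivWithinAt A (A' z) s z) (hA' : ContinuousOn A' s)
    (flat : ∀ z ∈ s, ∀ v w r, A' z v w r + A z w (A z v r) = A' z w v r + A z v (A z w r))
    {z₀ : F} (hz₀ : z₀ ∈ s) (hsmall : ∀ z ∈ s, ∀ w ∈ s, ‖A z (w - z₀)‖ ≤ 1 / 2) (r₀ : E) :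
    ∃ r : F → E, r z₀ = r₀ ∧ ∀ z ∈ s, HasFDerivWithinAt r ((A z).flip (r z)) s z := by
  classical
  have hAc : ContinuousOn A s := fun z hz => (hA z hz).continuousWithinAt
  have hγ : ∀ z ∈ s, ∀ t ∈ Set.Icc (0 : ℝ) 1, z₀ + t • (z - z₀) ∈ s := fun z hz t ht =>
    hs.add_smul_sub_mem hz₀ hz ht
  have hγc : ∀ z : F, Continuous fun t : ℝ => z₀ + t • (z - z₀) := fun z => by fun_prop
  -- The candidate for the parallel section is parallel transport along the segment from `z₀` to
  -- `z`, evaluated at time one.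
  have hsol : ∀ z ∈ s, ∃ α : ℝ → E, α 0 = r₀ ∧ ∀ t ∈ Set.Icc (0 : ℝ) 1,
      HasDerivWithinAt α (A (z₀ + t • (z - z₀)) (z - z₀) (α t)) (Set.Icc 0 1) t := fun z hz =>
    exists_linearODE_solution
      ((hAc.comp (hγc z).continuousOn (hγ z hz)).clm_apply continuousOn_const)
      (fun t ht => hsmall _ (hγ z hz t ht) z hz) r₀
  choose! ρ hρ0 hρ using hsol
  obtain ⟨C, hC⟩ := hc.exists_bound_of_continuousOn hAc
  obtain ⟨C', hC'⟩ := hc.exists_bound_of_continuousOn hA'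
  obtain ⟨R, hR⟩ := hc.exists_bound_of_continuousOn (f := fun z => z - z₀) (by fun_prop)
  have hC0 : 0 ≤ C := (norm_nonneg _).trans (hC z₀ hz₀)
  have hC'0 : 0 ≤ C' := (norm_nonneg _).trans (hC' z₀ hz₀)
  have hR0 : 0 ≤ R := (norm_nonneg _).trans (hR z₀ hz₀)
  have hval : ∀ z ∈ s, z₀ + (1 : ℝ) • (z - z₀) = z := fun z _ => by simp
  refine ⟨fun z => ρ z 1, ?_, fun z hz => ?_⟩
  -- For `z = z₀` the segment is constant, so the transported vector has derivative zero.
  · have h := norm_le_of_forced_linearODE (A := fun _ => 0) (u := fun t => ρ z₀ t - r₀)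
      (f := fun _ => 0) (e := 0) (by simp) (by simp [hρ0 z₀ hz₀]) (fun t ht => by
        simpa using (hρ z₀ hz₀ t ht).sub_const r₀) (by simp)
    simpa [sub_eq_zero] using h
  · obtain ⟨M, hM⟩ := isCompact_Icc.exists_bound_of_continuousOn
      (fun t ht => (hρ z hz t ht).continuousWithinAt : ContinuousOn (ρ z) (Set.Icc 0 1))
    have hM0 : 0 ≤ M := (norm_nonneg _).trans (hM 0 (by simp))
    rw [hasFDerivWithinAt_iff_isLittleO, Asymptotics.isLittleO_iff]
    intro η hη
    -- `Q ‖h‖²` bounds the quadratic part of the forcing term found below. Requiring `ε (M R + 1)`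
    -- and `‖h‖ (Q + 1)` to be at most `η / 4` makes the forcing at most `‖h‖ η / 2`, and the factor
    -- `2` of the Grönwall estimate turns this into `η ‖h‖`.
    set Q : ℝ := M * (C' + ((C' + 1) * R + C) * C) with hQ
    have hQ0 : 0 ≤ Q := by positivity
    set ε : ℝ := min 1 (η / (4 * (M * R + 1))) with hε
    have hεpos : 0 < ε := lt_min one_pos (by positivity)
    obtain ⟨δ, hδ, hrem⟩ := hs.exists_forall_norm_sub_le hc hA hA' hεpos
    filter_upwards [self_mem_nhdsWithin, mem_nhdsWithin_of_mem_nhds (Metric.ball_mem_nhds z hδ),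
      mem_nhdsWithin_of_mem_nhds (Metric.ball_mem_nhds z
        (by positivity : 0 < η / (4 * (Q + 1))))] with w hw hwδ hwQ
    rw [Metric.mem_ball, dist_eq_norm] at hwδ hwQ
    set h := w - z with hh
    set v := z - z₀ with hv
    have hvh : w - z₀ = v + h := by rw [hv, hh]; abel
    -- `B t (ρ z t)` is the expected first variation of `ρ z t` when the end point moves by `h`: the
    -- point at time `t` moves by `t • h`, and a parallel section changes by `A` in that direction.
    -- At `t = 1` it is the claimed derivative.
    set B : ℝ → E →L[ℝ] E := fun t => A (z₀ + t • v) (t • h) with hB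
    set rem : ℝ → F →L[ℝ] E →L[ℝ] E := fun t =>
      A (z₀ + t • (w - z₀)) - A (z₀ + t • v) - A' (z₀ + t • v) (t • h) with hremdef
    have hdiff : ∀ t : ℝ, (z₀ + t • (w - z₀)) - (z₀ + t • v) = t • h := fun t => by
      rw [hvh, smul_add]; abel
    have hth : ∀ t ∈ Set.Icc (0 : ℝ) 1, ‖t • h‖ ≤ ‖h‖ := fun t ht => by
      rw [norm_smul, Real.norm_of_nonneg ht.1]
      exact mul_le_of_le_one_left (norm_nonneg _) ht.2
    have hremb : ∀ t ∈ Set.Icc (0 : ℝ) 1, ‖rem t‖ ≤ ε * ‖h‖ := fun t ht => by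
      have h1 := hrem _ (hγ z hz t ht) _ (hγ w hw t ht)
        (by rw [hdiff]; exact (hth t ht).trans_lt hwδ)
      rw [hdiff] at h1
      exact h1.trans (mul_le_mul_of_nonneg_left (hth t ht) hεpos.le)
    have key := norm_le_of_forced_linearODE (A := fun t => A (z₀ + t • (w - z₀)) (w - z₀))
      (u := fun t => ρ w t - ρ z t - B t (ρ z t))
      (f := fun t => rem t (v + h) (ρ z t) + A' (z₀ + t • v) (t • h) h (ρ z t)
        + ((A' (z₀ + t • v) (t • h) (v + h) + rem t (v + h) + A (z₀ + t • v) h) (B t (ρ z t))))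
      (e := ‖h‖ * (η / 2))
      (fun t ht => hsmall _ (hγ w hw t ht) w hw) (by simp [hρ0 z hz, hρ0 w hw, hB])
      (fun t ht => ?_) (fun t ht => ?_)
    · have e1 : ρ w 1 - ρ z 1 - B 1 (ρ z 1) = ρ w 1 - ρ z 1 - (A z).flip (ρ z 1) (w - z) := by
        simp only [hB, one_smul, hv, add_sub_cancel, ContinuousLinearMap.flip_apply, hh]
      simp only [e1] at key
      linarith
    · have d1 : HasDerivWithinAt (fun t : ℝ => z₀ + t • v) v (Set.Icc 0 1) t := by
        simpa using (((hasDerivAt_id t).smul_const v).const_add z₀).hasDerivWithinAt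
      have d2 := (hA _ (hγ z hz t ht)).comp_hasDerivWithinAt t d1 (hγ z hz)
      have d3 : HasDerivWithinAt (fun t : ℝ => t • h) h (Set.Icc 0 1) t := by
        simpa using ((hasDerivAt_id t).smul_const h).hasDerivWithinAt
      have hρz : ∀ t ∈ Set.Icc (0 : ℝ) 1,
          HasDerivWithinAt (ρ z) (A (z₀ + t • v) v (ρ z t)) (Set.Icc 0 1) t := hρ z hz
      have d2 : HasDerivWithinAt (fun t => A (z₀ + t • v)) (A' (z₀ + t • v) v)
        (Set.Icc 0 1) t := d2
      have d4 := ((hρ w hw t ht).sub (hρz t ht)).sub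
        ((d2.clm_apply d3).clm_apply (hρz t ht))
      refine d4.congr_deriv ?_
      -- Flatness exchanges the directions `v` and `t • h`. It cancels all terms of first order in
      -- `h`, leaving the remainder of `A` and quadratic terms as forcing.
      have hfl : _ = _ := flat (z₀ + t • v) (hγ z hz t ht) v (t • h) (ρ z t)
      have hAw : A (z₀ + t • (w - z₀)) = rem t + A (z₀ + t • v) + A' (z₀ + t • v) (t • h) := by
        simp only [hremdef]; abel
      simp only [hAw]
      rw [hvh]
      simp only [hB, map_add, map_sub, add_apply]
      rw [← sub_eq_zero] at hfl ⊢
      rw [← neg_eq_zero, ← hfl]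
      abel
    · have hz' := hγ z hz t ht
      have hvR : ‖v + h‖ ≤ R := by rw [← hvh]; exact hR w hw
      have hε1 : ε ≤ 1 := min_le_left _ _
      have hε2 : ε * (M * R + 1) ≤ η / 4 := by
        have := min_le_right 1 (η / (4 * (M * R + 1)))
        rw [← hε] at this
        calc ε * (M * R + 1) ≤ η / (4 * (M * R + 1)) * (M * R + 1) :=
              mul_le_mul_of_nonneg_right this (by positivity)
          _ = η / 4 := by field_simp
      have hQ2 : ‖h‖ * (Q + 1) ≤ η / 4 := by
        calc ‖h‖ * (Q + 1) ≤ η / (4 * (Q + 1)) * (Q + 1) :=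
              mul_le_mul_of_nonneg_right hwQ.le (by positivity)
          _ = η / 4 := by field_simp
      have hh0 : 0 ≤ ‖h‖ := norm_nonneg h
      have hρM := hM t ht
      have b1 : ‖rem t (v + h) (ρ z t)‖ ≤ ε * ‖h‖ * R * M :=
        ContinuousLinearMap.le_of_opNorm_le_of_le _
          (ContinuousLinearMap.le_of_opNorm_le_of_le _ (hremb t ht) hvR) hρM
      have bA' : ‖A' (z₀ + t • v) (t • h)‖ ≤ C' * ‖h‖ :=
        ContinuousLinearMap.le_of_opNorm_le_of_le _ (hC' _ hz') (hth t ht)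
      have b2 : ‖A' (z₀ + t • v) (t • h) h (ρ z t)‖ ≤ C' * ‖h‖ * ‖h‖ * M :=
        ContinuousLinearMap.le_of_opNorm_le_of_le _
          (ContinuousLinearMap.le_of_opNorm_le_of_le _ bA' le_rfl) hρM
      have b3 : ‖A' (z₀ + t • v) (t • h) (v + h) + rem t (v + h) + A (z₀ + t • v) h‖
          ≤ C' * ‖h‖ * R + 1 * ‖h‖ * R + C * ‖h‖ := by
        refine norm_add₃_le.trans (add_le_add_three ?_ ?_ ?_)
        · exact ContinuousLinearMap.le_of_opNorm_le_of_le _ bA' hvR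
        · exact ContinuousLinearMap.le_of_opNorm_le_of_le _
            ((hremb t ht).trans (mul_le_mul_of_nonneg_right hε1 hh0)) hvR
        · exact ContinuousLinearMap.le_of_opNorm_le_of_le _ (hC _ hz') le_rfl
      have b4 : ‖B t (ρ z t)‖ ≤ C * ‖h‖ * M :=
        ContinuousLinearMap.le_of_opNorm_le_of_le _
          (ContinuousLinearMap.le_of_opNorm_le_of_le _ (hC _ hz') (hth t ht)) hρM
      have b5 := ContinuousLinearMap.le_of_opNorm_le_of_le _ b3 b4
      refine (norm_add₃_le.trans (add_le_add_three b1 b2 b5)).trans ?_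
      have e2 : ε * ‖h‖ * R * M + C' * ‖h‖ * ‖h‖ * M
          + (C' * ‖h‖ * R + 1 * ‖h‖ * R + C * ‖h‖) * (C * ‖h‖ * M)
          = ‖h‖ * (ε * (M * R) + ‖h‖ * Q) := by rw [hQ]; ring
      rw [e2]
      refine mul_le_mul_of_nonneg_left ?_ hh0
      nlinarith

end Parallel

/-! ### The inverse function theorem at the boundary of the half-plane -/

/-- The derivative is continuous up to the boundary, hence within `c` of `L` on a half-ball. A
half-ball is convex, so the mean value inequality applies. -/
theorem IsHalfOpen.exists_approximatesLinearOn {D : Set (ℝ × ℝ)} (hD : IsHalfOpen D)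
    {F : ℝ × ℝ → ℝ × ℝ} (hF : ContDiffOn ℝ ∞ F D) {x : ℝ} (hx : (x, (0 : ℝ)) ∈ D)
    {L : ℝ × ℝ →L[ℝ] ℝ × ℝ} (hL : HasFDerivWithinAt F L closedHalfPlane (x, 0))
    {c : ℝ} (hc : 0 < c) :
    ∃ δ > 0, closedHalfPlane ∩ Metric.ball (x, 0) δ ⊆ D ∧
      ∀ z ∈ closedHalfPlane ∩ Metric.ball (x, 0) δ, ∀ w ∈ closedHalfPlane ∩ Metric.ball (x, 0) δ,
        ‖F w - F z - L (w - z)‖ ≤ c * ‖w - z‖ := by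
  have hcont := (hF.fderivWithin hD.uniqueDiffOn (m := ∞) (by simp)).continuousOn
  have hL' : fderivWithin ℝ F D (x, 0) = L :=
    (hL.mono hD.subset).fderivWithin (hD.uniqueDiffOn _ hx)
  have h1 : ∀ᶠ z in 𝓝[closedHalfPlane] (x, 0), z ∈ D ∧ ‖fderivWithin ℝ F D z - L‖ < c := by
    rw [← hD.nhdsWithin_eq hx]
    have := Metric.continuousWithinAt_iff'.1 (hcont _ hx) c hc
    rw [hL'] at this
    filter_upwards [self_mem_nhdsWithin, this] with z hz hz'
    exact ⟨hz, by rwa [← dist_eq_norm]⟩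
  obtain ⟨δ, hδ, h⟩ := Metric.mem_nhdsWithin_iff.1 h1
  rw [Set.inter_comm] at h
  refine ⟨δ, hδ, fun z hz => (h hz).1, fun z hz w hw => ?_⟩
  refine Convex.norm_image_sub_le_of_norm_hasFDerivWithin_le'
    (s := closedHalfPlane ∩ Metric.ball (x, 0) δ) (f' := fderivWithin ℝ F D)
    (fun v hv => ?_) (fun v hv => (h hv).2.le)
    (convex_closedHalfPlane.inter (convex_ball _ _)) hz hw
  exact ((hF.differentiableOn (by simp)) v (h hv).1).hasFDerivWithinAt.mono fun u hu => (h hu).1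

/-- Extension of a map across the boundary line, by reflection. -/
def reflectExtend (F : ℝ × ℝ → ℝ × ℝ) (z : ℝ × ℝ) : ℝ × ℝ :=
  if 0 ≤ z.2 then F z else (2 : ℝ) • F (z.1, 0) - F (z.1, -z.2)

theorem reflectExtend_of_nonneg {F : ℝ × ℝ → ℝ × ℝ} {z : ℝ × ℝ} (hz : 0 ≤ z.2) :
    reflectExtend F z = F z := if_pos hz

theorem reflectExtend_of_nonpos {F : ℝ × ℝ → ℝ × ℝ} {z : ℝ × ℝ} (hz : z.2 ≤ 0) :
    reflectExtend F z = (2 : ℝ) • F (z.1, 0) - F (z.1, -z.2) := by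
  unfold reflectExtend
  split_ifs with h
  · obtain ⟨a, b⟩ := z
    obtain rfl : b = 0 := le_antisymm hz h
    simp [two_smul]
  · rfl

/-- The reflection `2 F(x, 0) - F(x, -y)` has the same first-order behaviour as `F` at the boundary
point. With approximation constant `c / 4` above the line, the constant below is `2 · c/4 + c/4`.
Strict differentiability makes the usual inverse function theorem available. -/
theorem IsHalfOpen.hasStrictFDerivAt_reflectExtend {D : Set (ℝ × ℝ)} (hD : IsHalfOpen D)
    {F : ℝ × ℝ → ℝ × ℝ} (hF : ContDiffOn ℝ ∞ F D) {x : ℝ} (hx : (x, (0 : ℝ)) ∈ D)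
    {L : ℝ × ℝ →L[ℝ] ℝ × ℝ} (hL : HasFDerivWithinAt F L closedHalfPlane (x, 0)) :
    HasStrictFDerivAt (reflectExtend F) L (x, 0) := by
  rw [hasStrictFDerivAt_iff_isLittleO, Asymptotics.isLittleO_iff]
  intro c hc
  obtain ⟨δ, hδ, -, h⟩ := hD.exists_approximatesLinearOn hF hx hL (by positivity : 0 < c / 4)
  have hmem : ∀ z : ℝ × ℝ, z ∈ Metric.ball (x, (0 : ℝ)) δ ↔ |z.1 - x| < δ ∧ |z.2| < δ := by
    intro z
    rw [Metric.mem_ball, Prod.dist_eq, max_lt_iff, Real.dist_eq, Real.dist_eq, sub_zero]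
  have hnorm : ∀ a b : ℝ, ∀ z : ℝ × ℝ, |a| ≤ |z.1| → |b| ≤ |z.2| → ‖((a, b) : ℝ × ℝ)‖ ≤ ‖z‖ :=
    fun a b z ha hb => max_le_max ha hb
  have lower : ∀ z ∈ Metric.ball (x, (0 : ℝ)) δ, ∀ w ∈ Metric.ball (x, (0 : ℝ)) δ,
      z.2 ≤ 0 → w.2 ≤ 0 →
      ‖reflectExtend F w - reflectExtend F z - L (w - z)‖ ≤ 3 * (c / 4) * ‖w - z‖ := by
    intro z hz w hw hz0 hw0
    rw [hmem] at hz hw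
    have h1 := h (z.1, 0) ⟨le_refl (0 : ℝ), (hmem _).2 ⟨hz.1, by simpa using hδ⟩⟩
      (w.1, 0) ⟨le_refl (0 : ℝ), (hmem _).2 ⟨hw.1, by simpa using hδ⟩⟩
    have h2 := h (z.1, -z.2) ⟨neg_nonneg.2 hz0, (hmem _).2 ⟨hz.1, by simpa using hz.2⟩⟩
      (w.1, -w.2) ⟨neg_nonneg.2 hw0, (hmem _).2 ⟨hw.1, by simpa using hw.2⟩⟩
    have n1 : ‖((w.1, 0) - (z.1, 0) : ℝ × ℝ)‖ ≤ ‖w - z‖ := hnorm _ _ _ le_rfl (by simp)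
    have n2 : ‖((w.1, -w.2) - (z.1, -z.2) : ℝ × ℝ)‖ ≤ ‖w - z‖ :=
      hnorm _ _ _ le_rfl (by rw [← abs_neg]; simp [sub_eq_add_neg, add_comm])
    rw [reflectExtend_of_nonpos hz0, reflectExtend_of_nonpos hw0]
    have e1 : w - z = (2 : ℝ) • ((w.1, 0) - (z.1, 0) : ℝ × ℝ)
        - ((w.1, -w.2) - (z.1, -z.2)) := by
      ext <;> simp <;> ring
    have e2 : (2 : ℝ) • F (w.1, 0) - F (w.1, -w.2) - ((2 : ℝ) • F (z.1, 0) - F (z.1, -z.2))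
        - L (w - z)
        = (2 : ℝ) • (F (w.1, 0) - F (z.1, 0) - L ((w.1, 0) - (z.1, 0)))
          - (F (w.1, -w.2) - F (z.1, -z.2) - L ((w.1, -w.2) - (z.1, -z.2))) := by
      rw [e1, map_sub L, map_smul]
      module
    rw [e2]
    refine (norm_sub_le _ _).trans ?_
    rw [norm_smul, Real.norm_of_nonneg (by norm_num : (0 : ℝ) ≤ 2)]
    have := mul_le_mul_of_nonneg_left n1 (by positivity : 0 ≤ c / 4)
    have := mul_le_mul_of_nonneg_left n2 (by positivity : 0 ≤ c / 4)
    linarith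
  -- Points on opposite sides are compared through the foot `(z.1, 0)` of the upper one; both
  -- distances to the foot are at most `‖w - z‖`, and `3c/4 + c/4 = c`.
  have mixed : ∀ z ∈ Metric.ball (x, (0 : ℝ)) δ, ∀ w ∈ Metric.ball (x, (0 : ℝ)) δ,
      0 ≤ z.2 → w.2 ≤ 0 →
      ‖reflectExtend F w - reflectExtend F z - L (w - z)‖ ≤ c * ‖w - z‖ := by
    intro z hz w hw hz0 hw0
    have hz' := (hmem _).1 hz
    have hm : ((z.1, 0) : ℝ × ℝ) ∈ Metric.ball (x, (0 : ℝ)) δ :=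
      (hmem _).2 ⟨hz'.1, by simpa using hδ⟩
    have h1 := lower (z.1, 0) hm w hw le_rfl hw0
    have h2 := h z ⟨hz0, hz⟩ (z.1, 0) ⟨le_refl (0 : ℝ), hm⟩
    have h2' : ‖reflectExtend F (z.1, 0) - reflectExtend F z - L ((z.1, 0) - z)‖
        ≤ c / 4 * ‖((z.1, 0) - z : ℝ × ℝ)‖ := by
      rwa [reflectExtend_of_nonneg le_rfl, reflectExtend_of_nonneg hz0]
    have n1 : ‖w - (z.1, 0)‖ ≤ ‖w - z‖ := hnorm _ _ _ le_rfl (by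
      simp only [Prod.snd_sub, sub_zero]
      rw [abs_of_nonpos hw0, abs_of_nonpos (by linarith)]; linarith)
    have n2 : ‖((z.1, 0) - z : ℝ × ℝ)‖ ≤ ‖w - z‖ := hnorm _ _ _ (by simp) (by
      simp only [Prod.snd_sub, zero_sub, abs_neg]
      rw [abs_of_nonneg hz0, abs_of_nonpos (by linarith)]; linarith)
    have e : reflectExtend F w - reflectExtend F z - L (w - z)
        = (reflectExtend F w - reflectExtend F (z.1, 0) - L (w - (z.1, 0)))
          + (reflectExtend F (z.1, 0) - reflectExtend F z - L ((z.1, 0) - z)) := by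
      simp only [map_sub]; abel
    rw [e]
    refine (norm_add_le _ _).trans ?_
    have := mul_le_mul_of_nonneg_left n1 (by positivity : 0 ≤ c / 4)
    have := mul_le_mul_of_nonneg_left n2 (by positivity : 0 ≤ c / 4)
    linarith
  have hnhds : Metric.ball (x, (0 : ℝ)) δ ×ˢ Metric.ball (x, (0 : ℝ)) δ
      ∈ 𝓝 (((x, 0), (x, 0)) : (ℝ × ℝ) × (ℝ × ℝ)) :=
    prod_mem_nhds (Metric.ball_mem_nhds _ hδ) (Metric.ball_mem_nhds _ hδ)
  filter_upwards [hnhds] with ⟨w, z⟩ ⟨hw, hz⟩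
  have hcw : 0 ≤ c * ‖w - z‖ := by positivity
  rcases le_total 0 z.2 with hz0 | hz0 <;> rcases le_total 0 w.2 with hw0 | hw0
  · have := h z ⟨hz0, hz⟩ w ⟨hw0, hw⟩
    simp only [reflectExtend_of_nonneg hz0, reflectExtend_of_nonneg hw0]
    linarith
  · exact mixed z hz w hw hz0 hw0
  · have := mixed w hw z hz hw0 hz0
    rw [norm_sub_rev w z]
    refine le_trans (le_of_eq ?_) this
    rw [← norm_neg]
    congr 1
    simp only [map_sub]; abel
  · have := lower z hz w hw hz0 hw0
    simp only
    linarith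

/-- The inverse of a smooth map of relatively open sets with invertible derivatives is smooth. -/
theorem IsHalfOpen.contDiffOn_inverse {N N' : Set (ℝ × ℝ)} (hN : IsHalfOpen N)
    (hN' : IsHalfOpen N') {F G : ℝ × ℝ → ℝ × ℝ} (hF : ContDiffOn ℝ ∞ F N)
    (hinv : ∀ z ∈ N, ∃ L : (ℝ × ℝ) ≃L[ℝ] (ℝ × ℝ), (L : ℝ × ℝ →L[ℝ] ℝ × ℝ) = fderivWithin ℝ F N z)
    (hG : ContinuousOn G N') (hGN : Set.MapsTo G N' N) (hFG : ∀ w ∈ N', F (G w) = w) :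
    ContDiffOn ℝ ∞ G N' := by
  -- The derivative of `G` is inversion applied to `F' ∘ G`, so each order of smoothness of `G`
  -- yields the next.
  have hder : ∀ w ∈ N', HasFDerivWithinAt G
      (ContinuousLinearMap.inverse (fderivWithin ℝ F N (G w))) N' w := by
    intro w hw
    obtain ⟨L, hL⟩ := hinv _ (hGN hw)
    have h1 := (hF.differentiableOn (by simp) _ (hGN hw)).hasFDerivWithinAt
    rw [← hL] at h1 ⊢
    rw [ContinuousLinearMap.inverse_equiv]
    exact HasFDerivWithinAt.of_local_left_inverse
      ((hG w hw).tendsto_nhdsWithin hGN) h1 hw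
      (Filter.eventually_of_mem self_mem_nhdsWithin hFG)
  rw [contDiffOn_infty]
  intro n
  induction n with
  | zero => exact contDiffOn_zero.2 hG
  | succ n ih =>
    push_cast
    rw [contDiffOn_succ_iff_fderivWithin hN'.uniqueDiffOn]
    refine ⟨fun w hw => (hder w hw).differentiableWithinAt, by simp, ?_⟩
    refine ContDiffOn.congr ?_ fun w hw => (hder w hw).fderivWithin (hN'.uniqueDiffOn w hw)
    have h2 : ContDiffOn ℝ n (fun w => fderivWithin ℝ F N (G w)) N' :=
      ((hF.fderivWithin hN.uniqueDiffOn (m := n) (by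
        exact_mod_cast le_top)).comp ih hGN)
    intro w hw
    obtain ⟨L, hL⟩ := hinv _ (hGN hw)
    refine ContDiffAt.comp_contDiffWithinAt (g := ContinuousLinearMap.inverse)
      (f := fun w => fderivWithin ℝ F N (G w)) w ?_ (h2 w hw)
    rw [← hL]
    exact contDiffAt_map_inverse L

/-- The inverse function theorem at a boundary point of the closed half-plane. -/
theorem IsHalfOpen.exists_local_inverse {D : Set (ℝ × ℝ)} (hD : IsHalfOpen D)
    {F : ℝ × ℝ → ℝ × ℝ} (hF : ContDiffOn ℝ ∞ F D)
    (h0 : ∀ z ∈ D, z.2 = 0 → (F z).2 = 0) (hpos : ∀ z ∈ D, 0 < z.2 → 0 < (F z).2)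
    {x : ℝ} (hx : (x, (0 : ℝ)) ∈ D) {L : (ℝ × ℝ) ≃L[ℝ] (ℝ × ℝ)}
    (hL : HasFDerivWithinAt F (L : ℝ × ℝ →L[ℝ] ℝ × ℝ) closedHalfPlane (x, 0)) :
    ∃ (N N' : Set (ℝ × ℝ)) (G : ℝ × ℝ → ℝ × ℝ), IsHalfOpen N ∧ N ⊆ D ∧ (x, (0 : ℝ)) ∈ N ∧
      IsHalfOpen N' ∧ Set.MapsTo F N N' ∧ Set.MapsTo G N' N ∧ (∀ z ∈ N, G (F z) = z) ∧
      (∀ w ∈ N', F (G w) = w) ∧ ContDiffOn ℝ ∞ G N' := by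
  -- Invertibility of the derivative is an open condition; `D₁` is where it holds.
  set D₁ : Set (ℝ × ℝ) := D ∩ (fderivWithin ℝ F D) ⁻¹'
    Set.range ((↑) : ((ℝ × ℝ) ≃L[ℝ] (ℝ × ℝ)) → (ℝ × ℝ →L[ℝ] ℝ × ℝ)) with hD₁
  have hD₁o : IsHalfOpen D₁ := hD.preimage_continuousOn
    (hF.fderivWithin hD.uniqueDiffOn (m := ∞) (by simp)).continuousOn ContinuousLinearEquiv.isOpen
  have hx₁ : (x, (0 : ℝ)) ∈ D₁ :=
    ⟨hx, L, ((hL.mono hD.subset).fderivWithin (hD.uniqueDiffOn _ hx)).symm⟩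
  have hF₁ : ContDiffOn ℝ ∞ F D₁ := hF.mono Set.inter_subset_left
  obtain ⟨δ, hδ, hball, -⟩ := hD₁o.exists_approximatesLinearOn hF₁ hx₁ hL one_pos
  have hstrict := hD₁o.hasStrictFDerivAt_reflectExtend hF₁ hx₁ hL
  set e := (hstrict.toOpenPartialHomeomorph (reflectExtend F)).restrOpen
    (Metric.ball (x, 0) δ) Metric.isOpen_ball with he
  have he_coe : ∀ z, e z = reflectExtend F z := fun z => by
    simp [he, HasStrictFDerivAt.toOpenPartialHomeomorph_coe]
  have hsrc : ∀ z ∈ e.source, z ∈ Metric.ball (x, (0 : ℝ)) δ := fun z hz => by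
    rw [he, OpenPartialHomeomorph.restrOpen_source] at hz
    exact hz.2
  have hxsrc : (x, (0 : ℝ)) ∈ e.source := by
    rw [he, OpenPartialHomeomorph.restrOpen_source]
    exact ⟨hstrict.mem_toOpenPartialHomeomorph_source, Metric.mem_ball_self hδ⟩
  -- Below the line the extension has second component `-(F (z.1, -z.2)).2 < 0`, so the local
  -- inverse sends the closed half-plane into itself.
  have hsign : ∀ z ∈ e.source, 0 ≤ (reflectExtend F z).2 → 0 ≤ z.2 := by
    intro z hz hz'
    by_contra hneg
    push Not at hneg
    have hzb := hsrc z hz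
    rw [Metric.mem_ball, Prod.dist_eq, max_lt_iff, Real.dist_eq, Real.dist_eq, sub_zero] at hzb
    have m1 : ((z.1, 0) : ℝ × ℝ) ∈ D₁ := hball ⟨le_refl (0 : ℝ), by
      rw [Metric.mem_ball, Prod.dist_eq, max_lt_iff, Real.dist_eq, Real.dist_eq, sub_zero]
      exact ⟨hzb.1, by simpa using hδ⟩⟩
    have m2 : ((z.1, -z.2) : ℝ × ℝ) ∈ D₁ := hball ⟨neg_nonneg.2 hneg.le, by
      rw [Metric.mem_ball, Prod.dist_eq, max_lt_iff, Real.dist_eq, Real.dist_eq, sub_zero]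
      exact ⟨hzb.1, by simpa using hzb.2⟩⟩
    rw [reflectExtend_of_nonpos hneg.le] at hz'
    have h1 := h0 _ m1.1 rfl
    have h2 := hpos _ m2.1 (neg_pos.2 hneg)
    simp only [Prod.snd_sub, Prod.smul_snd, h1, smul_zero, zero_sub] at hz'
    linarith
  have hN : IsHalfOpen (closedHalfPlane ∩ e.source) := .of_isOpen e.open_source
  have hN' : IsHalfOpen (closedHalfPlane ∩ e.target) := .of_isOpen e.open_target
  have hsub : closedHalfPlane ∩ e.source ⊆ D₁ := fun z hz => hball ⟨hz.1, hsrc z hz.2⟩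
  have hGN : Set.MapsTo e.symm (closedHalfPlane ∩ e.target) (closedHalfPlane ∩ e.source) := by
    intro w hw
    have h1 := e.map_target hw.2
    refine ⟨hsign _ h1 ?_, h1⟩
    rw [← he_coe, e.right_inv hw.2]
    exact hw.1
  have hFG : ∀ w ∈ closedHalfPlane ∩ e.target, F (e.symm w) = w := fun w hw => by
    rw [← reflectExtend_of_nonneg (F := F) (hGN hw).1, ← he_coe, e.right_inv hw.2]
  refine ⟨closedHalfPlane ∩ e.source, closedHalfPlane ∩ e.target, e.symm, hN,
    fun z hz => (hsub hz).1, ⟨le_refl (0 : ℝ), hxsrc⟩, hN', fun z hz => ?_, hGN, fun z hz => ?_,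
    hFG, ?_⟩
  · refine ⟨?_, ?_⟩
    · rcases (hN.snd_nonneg hz).lt_or_eq with h | h
      · exact (hpos z (hsub hz).1 h).le
      · exact (h0 z (hsub hz).1 h.symm).ge
    · rw [← reflectExtend_of_nonneg (F := F) hz.1, ← he_coe]
      exact e.map_source hz.2
  · rw [← reflectExtend_of_nonneg (F := F) hz.1, ← he_coe, e.left_inv hz.2]
  · refine hN.contDiffOn_inverse hN' (hF₁.mono hsub) (fun z hz => ?_)
      (e.continuousOn_symm.mono Set.inter_subset_right) hGN hFG
    obtain ⟨L', hL'⟩ := (hsub hz).2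
    refine ⟨L', hL'.trans ?_⟩
    have h1 := ((hF.differentiableOn (by simp)) z (hsub hz).1).hasFDerivWithinAt
    exact ((h1.mono (fun z hz => (hsub hz).1)).fderivWithin (hN.uniqueDiffOn z hz)).symm

/-! ### Normal form of a hyperbolic 0-metric in coordinates -/

/-- A smooth positive-definite field of matrices is `[[p², p q], [p q, q² + d²]]` with smooth
functions `p, d > 0` and `q`. -/
theorem exists_cholesky {D : Set (ℝ × ℝ)} {H : ℝ × ℝ → Matrix (Fin 2) (Fin 2) ℝ}
    (hs : ∀ i j, ContDiffOn ℝ ∞ (fun z => H z i j) D) (hpos : ∀ z ∈ D, (H z).PosDef) :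
    ∃ p q d : ℝ × ℝ → ℝ, ContDiffOn ℝ ∞ p D ∧ ContDiffOn ℝ ∞ q D ∧ ContDiffOn ℝ ∞ d D ∧
      (∀ z ∈ D, 0 < p z) ∧ (∀ z ∈ D, 0 < d z) ∧ ∀ z ∈ D, H z 0 0 = p z ^ 2 ∧
        H z 0 1 = p z * q z ∧ H z 1 0 = p z * q z ∧ H z 1 1 = q z ^ 2 + d z ^ 2 := by
  have h00 : ∀ z ∈ D, 0 < H z 0 0 := fun z hz => (hpos z hz).diag_pos
  have hsym : ∀ z ∈ D, H z 1 0 = H z 0 1 := fun z hz => by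
    simpa using (hpos z hz).isHermitian.apply 0 1
  have hdet : ∀ z ∈ D, 0 < H z 0 0 * H z 1 1 - H z 0 1 * H z 0 1 := fun z hz => by
    have := (hpos z hz).det_pos
    rwa [Matrix.det_fin_two, hsym z hz] at this
  have hp : ContDiffOn ℝ ∞ (fun z => √(H z 0 0)) D := (hs 0 0).sqrt fun z hz => (h00 z hz).ne'
  have hp0 : ∀ z ∈ D, 0 < √(H z 0 0) := fun z hz => Real.sqrt_pos.2 (h00 z hz)
  -- This is the Schur complement `det H / H₀₀`.
  have hd0 : ∀ z ∈ D, 0 < H z 1 1 - (H z 0 1 / √(H z 0 0)) ^ 2 := fun z hz => by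
    rw [div_pow, Real.sq_sqrt (h00 z hz).le, sub_pos, div_lt_iff₀ (h00 z hz)]
    nlinarith [hdet z hz]
  have hq : ContDiffOn ℝ ∞ (fun z => H z 0 1 / √(H z 0 0)) D :=
    (hs 0 1).div hp fun z hz => (hp0 z hz).ne'
  refine ⟨fun z => √(H z 0 0), fun z => H z 0 1 / √(H z 0 0),
    fun z => √(H z 1 1 - (H z 0 1 / √(H z 0 0)) ^ 2), hp, hq,
    ((hs 1 1).sub (hq.pow 2)).sqrt fun z hz => (hd0 z hz).ne', hp0,
    fun z hz => Real.sqrt_pos.2 (hd0 z hz), fun z hz => ⟨?_, ?_, ?_, ?_⟩⟩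
  · exact (Real.sq_sqrt (h00 z hz).le).symm
  · rw [mul_div_cancel₀ _ (hp0 z hz).ne']
  · rw [mul_div_cancel₀ _ (hp0 z hz).ne', hsym z hz]
  · rw [Real.sq_sqrt (hd0 z hz).le]; ring

theorem contDiffOn_vec2 {D : Set (ℝ × ℝ)} {f g : ℝ × ℝ → ℝ} (hf : ContDiffOn ℝ ∞ f D)
    (hg : ContDiffOn ℝ ∞ g D) : ContDiffOn ℝ ∞ (fun z => ![f z, g z]) D := by
  rw [contDiffOn_pi]
  intro i
  fin_cases i
  · exact hf
  · exact hg

/-- A spin connection for the coframe `(p dx + q dy) / y`, `d dy / y`. -/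
theorem isSpinConnection_of_eq {D : Set (ℝ × ℝ)} (hD : IsHalfOpen D) {p q d k₀ k₁ : ℝ × ℝ → ℝ}
    (hp : ContDiffOn ℝ ∞ p D) (hq : ContDiffOn ℝ ∞ q D) (hd : ContDiffOn ℝ ∞ d D)
    (hk₀ : ContDiffOn ℝ ∞ k₀ {z ∈ D | 0 < z.2}) (hk₁ : ContDiffOn ℝ ∞ k₁ {z ∈ D | 0 < z.2})
    (h₁ : ∀ z ∈ D, 0 < z.2 → k₀ z * d z = hderiv 1 p z - hderiv 0 q z - p z / z.2)
    (h₂ : ∀ z ∈ D, 0 < z.2 → k₁ z * p z = k₀ z * q z - hderiv 0 d z) :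
    IsSpinConnection {z ∈ D | 0 < z.2} (fun z => ![p z / z.2, q z / z.2])
      (fun z => ![0, d z / z.2]) (fun z => ![k₀ z, k₁ z]) := by
  refine ⟨contDiffOn_vec2 hk₀ hk₁, fun z ⟨hz, hz'⟩ => ?_⟩
  have hp' := (hp.hasPartials hD hz).div .snd hz'.ne'
  have hq' := (hq.hasPartials hD hz).div .snd hz'.ne'
  have hd' := (hd.hasPartials hD hz).div .snd hz'.ne'
  have e₁ := h₁ z hz hz'
  have e₂ := h₂ z hz hz'
  simp only [dform, wedge, Matrix.cons_val_zero, Matrix.cons_val_one]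
  rw [hq'.pderiv_zero hz', hp'.pderiv_one hz', hd'.pderiv_zero hz',
    (HasPartials.const (0 : ℝ)).pderiv_one hz']
  field_simp at e₁ ⊢
  constructor
  · linarith
  · linear_combination z.2 * e₂

/-- The metric with matrix `G` for `y > 0` has the orthonormal coframe `(p dx + q dy) / y`,
`(1 + y ν) dy / y`, and its Gauss curvature is `-1`.  The latter is expressed by a flatness equation
in terms of the smooth function `σ`. -/
structure HyperbolicNormalForm (D : Set (ℝ × ℝ)) (G : ℝ × ℝ → Matrix (Fin 2) (Fin 2) ℝ)
    (p q ν σ : ℝ × ℝ → ℝ) : Prop where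
  smooth_p : ContDiffOn ℝ ∞ p D
  smooth_q : ContDiffOn ℝ ∞ q D
  smooth_ν : ContDiffOn ℝ ∞ ν D
  smooth_σ : ContDiffOn ℝ ∞ σ D
  p_pos : ∀ z ∈ D, 0 < p z
  d_pos : ∀ z ∈ D, 0 < 1 + z.2 * ν z
  matrix_eq : ∀ z ∈ D, 0 < z.2 → G z 0 0 = (z.2 ^ 2)⁻¹ * p z ^ 2 ∧
    G z 0 1 = (z.2 ^ 2)⁻¹ * (p z * q z) ∧ G z 1 0 = (z.2 ^ 2)⁻¹ * (p z * q z) ∧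
    G z 1 1 = (z.2 ^ 2)⁻¹ * (q z ^ 2 + (1 + z.2 * ν z) ^ 2)
  σ_eq : ∀ z ∈ D, z.2 * (1 + z.2 * ν z) * σ z = hderiv 1 p z - hderiv 0 q z + p z * ν z
  flat : ∀ z ∈ D, hderiv 0 (fun w => (q w * σ w - hderiv 0 ν w) / p w) z - hderiv 1 σ z
    = -(σ z * ν z)

/-- For arbitrary Cholesky coefficients the spin connection and the Gauss equation have poles at `y
= 0`. Cancelling these poles order by order yields `d = 1` on the boundary, then the vanishing of
`p_y - q_x + pν` there, and the remaining regular equation is `flat`. -/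
theorem IsHalfOpen.exists_normalForm {D : Set (ℝ × ℝ)} (hD : IsHalfOpen D)
    {G H : ℝ × ℝ → Matrix (Fin 2) (Fin 2) ℝ}
    (hs : ∀ i j, ContDiffOn ℝ ∞ (fun z => H z i j) D) (hpos : ∀ z ∈ D, (H z).PosDef)
    (hG : ∀ z ∈ D, 0 < z.2 → G z = (z.2 ^ 2)⁻¹ • H z)
    (hK : ∀ α₁ α₂ κ : ℝ × ℝ → Fin 2 → ℝ, IsOrthonormalCoframe G {z ∈ D | 0 < z.2} α₁ α₂ →
      IsSpinConnection {z ∈ D | 0 < z.2} α₁ α₂ κ →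
      ∀ z ∈ {z ∈ D | 0 < z.2}, dform κ z = (-1) * wedge α₁ α₂ z) :
    ∃ p q ν σ, HyperbolicNormalForm D G p q ν σ := by
  obtain ⟨p, q, d, hp, hq, hd, hp0, hd0, hH⟩ := exists_cholesky hs hpos
  have hVD : {z ∈ D | 0 < z.2} ⊆ D := fun z hz => hz.1
  have hy0 : ∀ z ∈ {z ∈ D | 0 < z.2}, z.2 ≠ 0 := fun z hz => hz.2.ne'
  have hy : ContDiffOn ℝ ∞ (fun z : ℝ × ℝ => z.2) {z ∈ D | 0 < z.2} := contDiffOn_snd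
  have hGz : ∀ z ∈ D, 0 < z.2 → G z 0 0 = (z.2 ^ 2)⁻¹ * p z ^ 2 ∧
      G z 0 1 = (z.2 ^ 2)⁻¹ * (p z * q z) ∧ G z 1 0 = (z.2 ^ 2)⁻¹ * (p z * q z) ∧
      G z 1 1 = (z.2 ^ 2)⁻¹ * (q z ^ 2 + d z ^ 2) := fun z hz hz' => by
    obtain ⟨h1, h2, h3, h4⟩ := hH z hz
    rw [hG z hz hz']
    simp only [Matrix.smul_apply, smul_eq_mul, h1, h2, h3, h4, and_self]
  have hframe : IsOrthonormalCoframe G {z ∈ D | 0 < z.2} (fun z => ![p z / z.2, q z / z.2])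
      (fun z => ![0, d z / z.2]) := by
    refine ⟨contDiffOn_vec2 ((hp.mono hVD).div hy hy0) ((hq.mono hVD).div hy hy0),
      contDiffOn_vec2 contDiffOn_const ((hd.mono hVD).div hy hy0), fun z ⟨hz, hz'⟩ => ?_,
      fun z ⟨hz, hz'⟩ => ?_⟩
    · obtain ⟨h1, h2, h3, h4⟩ := hGz z hz hz'
      intro i j
      fin_cases i <;> fin_cases j <;> simp [h1, h2, h3, h4] <;> field_simp
    · have := hp0 z hz
      have := hd0 z hz
      simp only [wedge, Matrix.cons_val_zero, Matrix.cons_val_one, mul_zero, sub_zero]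
      positivity
  -- The Gauss equation, for any `k₀`, `k₁` solving the structure equations. It is used twice:
  -- before and after `ν` and `σ` have been split off.
  have hcurv : ∀ k₀ k₁ : ℝ × ℝ → ℝ, ContDiffOn ℝ ∞ k₀ {z ∈ D | 0 < z.2} →
      ContDiffOn ℝ ∞ k₁ {z ∈ D | 0 < z.2} →
      (∀ z ∈ D, 0 < z.2 → k₀ z * d z = hderiv 1 p z - hderiv 0 q z - p z / z.2) →
      (∀ z ∈ D, 0 < z.2 → k₁ z * p z = k₀ z * q z - hderiv 0 d z) →
      ∀ z ∈ D, 0 < z.2 → pderiv 0 k₁ z - pderiv 1 k₀ z = -(p z * d z / z.2 ^ 2) := by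
    intro k₀ k₁ hk₀ hk₁ h₁ h₂ z hz hz'
    have := hK _ _ _ hframe (isSpinConnection_of_eq hD hp hq hd hk₀ hk₁ h₁ h₂) z ⟨hz, hz'⟩
    simp only [dform, wedge, Matrix.cons_val_zero, Matrix.cons_val_one] at this
    rw [this]
    field_simp
    ring
  -- the curvature equation in terms of `m`, `n`, `p / d` and `q / d`
  set m : ℝ × ℝ → ℝ := fun z => (hderiv 1 p z - hderiv 0 q z) / d z with hm
  set n : ℝ × ℝ → ℝ := fun z => (m z * q z - hderiv 0 d z) / p z with hn
  set e : ℝ × ℝ → ℝ := fun z => q z / d z with he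
  set f : ℝ × ℝ → ℝ := fun z => p z / d z with hf
  have hms : ContDiffOn ℝ ∞ m D :=
    ((hp.hderiv 1 hD).sub (hq.hderiv 0 hD)).div hd fun z hz => (hd0 z hz).ne'
  have hns : ContDiffOn ℝ ∞ n D :=
    ((hms.mul hq).sub (hd.hderiv 0 hD)).div hp fun z hz => (hp0 z hz).ne'
  have hes : ContDiffOn ℝ ∞ e D := hq.div hd fun z hz => (hd0 z hz).ne'
  have hfs : ContDiffOn ℝ ∞ f D := hp.div hd fun z hz => (hd0 z hz).ne'
  have raw : ∀ z ∈ D, 0 < z.2 → z.2 * (z.2 * (hderiv 0 n z - hderiv 1 m z)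
      + (hderiv 1 f z - hderiv 0 e z)) = p z / d z - p z * d z := by
    intro z hz hz'
    have h := hcurv (fun z => m z - f z / z.2) (fun z => n z - e z / z.2)
      ((hms.mono hVD).sub ((hfs.mono hVD).div hy hy0))
      ((hns.mono hVD).sub ((hes.mono hVD).div hy hy0)) (fun z hz hz' => ?_)
      (fun z hz hz' => ?_) z hz hz'
    · have h1 := (hms.hasPartials hD hz).sub ((hfs.hasPartials hD hz).div .snd hz'.ne')
      have h2 := (hns.hasPartials hD hz).sub ((hes.hasPartials hD hz).div .snd hz'.ne')
      rw [h1.pderiv_one hz', h2.pderiv_zero hz'] at h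
      have hfz : f z = p z / d z := rfl
      rw [← hfz]
      field_simp at h
      linear_combination h
    · have := (hd0 z hz).ne'
      simp only [hm, hf]
      field_simp
    · have := (hd0 z hz).ne'
      have := (hp0 z hz).ne'
      simp only [hn, hf, he]
      field_simp
      ring
  -- At `y = 0` the equation `raw` reads `p/d = p d`, so `d² = 1` and `d = 1` by positivity.
  have d_bdry : ∀ z ∈ D, z.2 = 0 → d z - 1 = 0 := by
    intro z hz hz0
    have h := hD.eqOn_of_eqOn_interior
      (f := fun z => z.2 * (z.2 * (hderiv 0 n z - hderiv 1 m z) + (hderiv 1 f z - hderiv 0 e z)))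
      (g := fun z => p z / d z - p z * d z)
      (continuousOn_snd.mul ((continuousOn_snd.mul ((hns.hderiv 0 hD).sub
        (hms.hderiv 1 hD)).continuousOn).add
        ((hfs.hderiv 1 hD).sub (hes.hderiv 0 hD)).continuousOn))
      (hfs.sub (hp.mul hd)).continuousOn raw z hz
    have := hp0 z hz
    have hdz := hd0 z hz
    simp only [hz0, zero_mul] at h
    field_simp at h
    have h1 : p z * ((d z - 1) * (d z + 1)) = 0 := by linear_combination h
    rcases mul_eq_zero.1 ((mul_eq_zero.1 h1).resolve_left this.ne') with h2 | h2
    · exact h2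
    · linarith
  obtain ⟨ν, hν, hdν⟩ := hD.exists_eq_snd_mul (hd.sub contDiffOn_const) d_bdry
  have hdν' : ∀ z ∈ D, d z = 1 + z.2 * ν z := fun z hz => by linarith [hdν z hz]
  have hdpart : ∀ z ∈ D, HasPartials d (z.2 * hderiv 0 ν z) (ν z + z.2 * hderiv 1 ν z) z :=
    fun z hz => (((HasPartials.const 1).add
      (HasPartials.snd.mul (hν.hasPartials hD hz))).congr_coeff (by ring) (by ring)).congr_of_eqOn
        hD hz hdν'
  have raw2 : ∀ z ∈ D, z.2 * (hderiv 0 n z - hderiv 1 m z)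
      + (hderiv 1 f z - hderiv 0 e z) = -(p z * ν z * (d z + 1) / d z) := by
    refine hD.eqOn_of_eqOn_interior
      ((continuousOn_snd.mul ((hns.hderiv 0 hD).sub (hms.hderiv 1 hD)).continuousOn).add
        ((hfs.hderiv 1 hD).sub (hes.hderiv 0 hD)).continuousOn)
      (((hp.mul hν).mul (hd.add contDiffOn_const)).div hd
        fun z hz => (hd0 z hz).ne').neg.continuousOn fun z hz hz' => ?_
    have h := raw z hz hz'
    have hdz := (hd0 z hz).ne'
    refine mul_left_cancel₀ hz'.ne' (h.trans ?_)
    field_simp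
    linear_combination (-(p z) * (d z + 1)) * hdν z hz
  -- On the boundary `d = 1`, `d_x = 0` and `d_y = ν`, so `raw2` reads `p_y - pν - q_x = -2pν`.
  have σ_bdry : ∀ z ∈ D, z.2 = 0 → hderiv 1 p z - hderiv 0 q z + p z * ν z = 0 := by
    intro z hz hz0
    have h := raw2 z hz
    have hd1 : d z = 1 := by linarith [d_bdry z hz hz0]
    have hfz := ((hp.hasPartials hD hz).div (hdpart z hz) (hd0 z hz).ne').hderiv_one (hD.subset hz)
    have hez := ((hq.hasPartials hD hz).div (hdpart z hz) (hd0 z hz).ne').hderiv_zero (hD.subset hz)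
    rw [show hderiv 1 f z = _ from hfz, show hderiv 0 e z = _ from hez] at h
    simp only [hd1, hz0] at h
    norm_num at h
    linarith
  obtain ⟨s, hss, hs'⟩ := hD.exists_eq_snd_mul
    (((hp.hderiv 1 hD).sub (hq.hderiv 0 hD)).add (hp.mul hν)) σ_bdry
  set σ : ℝ × ℝ → ℝ := fun z => s z / d z with hσ
  have hσs : ContDiffOn ℝ ∞ σ D := hss.div hd fun z hz => (hd0 z hz).ne'
  have hσeq : ∀ z ∈ D, z.2 * d z * σ z = hderiv 1 p z - hderiv 0 q z + p z * ν z := by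
    intro z hz
    have := (hd0 z hz).ne'
    rw [hs' z hz]
    simp only [hσ]
    field_simp
  set τ : ℝ × ℝ → ℝ := fun w => (q w * σ w - hderiv 0 ν w) / p w with hτ
  have hτs : ContDiffOn ℝ ∞ τ D :=
    ((hq.mul hσs).sub (hν.hderiv 0 hD)).div hp fun z hz => (hp0 z hz).ne'
  refine ⟨p, q, ν, σ, hp, hq, hν, hσs, hp0, fun z hz => hdν' z hz ▸ hd0 z hz, fun z hz hz' => ?_,
    fun z hz => by rw [← hdν' z hz, hσeq z hz], ?_⟩
  · rw [← hdν' z hz]; exact hGz z hz hz'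
  refine hD.eqOn_of_eqOn_interior ((hτs.hderiv 0 hD).sub (hσs.hderiv 1 hD)).continuousOn
    (hσs.mul hν).neg.continuousOn fun z hz hz' => ?_
  have hyD : ContDiffOn ℝ ∞ (fun z : ℝ × ℝ => z.2) D := contDiffOn_snd
  -- In terms of `σ` and `τ` the spin connection is `(yσ - p/y) dx + (yτ - q/y) dy`. The singular
  -- terms of its curvature combine through the equation for `σ`, and a factor `y` cancels.
  have h := hcurv (fun z => z.2 * σ z - p z / z.2) (fun z => z.2 * τ z - q z / z.2)
    (((hyD.mul hσs).mono hVD).sub ((hp.mono hVD).div hy hy0))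
    (((hyD.mul hτs).mono hVD).sub ((hq.mono hVD).div hy hy0)) (fun z hz hz' => ?_)
    (fun z hz hz' => ?_) z hz hz'
  · have h1 := (HasPartials.snd.mul (hσs.hasPartials hD hz)).sub
      ((hp.hasPartials hD hz).div .snd hz'.ne')
    have h2 := (HasPartials.snd.mul (hτs.hasPartials hD hz)).sub
      ((hq.hasPartials hD hz).div .snd hz'.ne')
    rw [h1.pderiv_one hz', h2.pderiv_zero hz'] at h
    have e1 := hσeq z hz
    rw [hdν' z hz] at e1 h
    field_simp at h
    have hne := hz'.ne'
    refine mul_left_cancel₀ (pow_ne_zero 3 hne) ?_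
    linear_combination h + z.2 * e1
  · have e1 := hσeq z hz
    field_simp
    linear_combination z.2 * e1 - p z * hdν z hz
  · have := (hp0 z hz).ne'
    rw [(hdpart z hz).hderiv_zero (hD.subset hz)]
    simp only [hτ]
    field_simp
    ring

/-! ### The developing map of a hyperbolic 0-metric near the boundary -/

/-- The linear map `(P, Q) ↦ (a P + b Q, c P + d Q)`. -/
def planeMap (a b c d : ℝ) : ℝ × ℝ →L[ℝ] ℝ × ℝ :=
  a • (ContinuousLinearMap.fst ℝ ℝ ℝ).prod 0 + b • (ContinuousLinearMap.snd ℝ ℝ ℝ).prod 0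
    + c • (0 : ℝ × ℝ →L[ℝ] ℝ).prod (ContinuousLinearMap.fst ℝ ℝ ℝ)
    + d • (0 : ℝ × ℝ →L[ℝ] ℝ).prod (ContinuousLinearMap.snd ℝ ℝ ℝ)

theorem planeMap_apply (a b c d : ℝ) (r : ℝ × ℝ) :
    planeMap a b c d r = (a * r.1 + b * r.2, c * r.1 + d * r.2) := by
  ext <;> simp [planeMap]

theorem contDiffOn_planeMap {D : Set (ℝ × ℝ)} {a b c d : ℝ × ℝ → ℝ} (ha : ContDiffOn ℝ ∞ a D)
    (hb : ContDiffOn ℝ ∞ b D) (hc : ContDiffOn ℝ ∞ c D) (hd : ContDiffOn ℝ ∞ d D) :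
    ContDiffOn ℝ ∞ (fun z => planeMap (a z) (b z) (c z) (d z)) D :=
  (((ha.smul contDiffOn_const).add (hb.smul contDiffOn_const)).add
    (hc.smul contDiffOn_const)).add (hd.smul contDiffOn_const)

/-- The connection form `dx ⊗ B₀ + dy ⊗ B₁`. -/
def connectionForm (B₀ B₁ : ℝ × ℝ → ℝ × ℝ →L[ℝ] ℝ × ℝ) (z : ℝ × ℝ) :
    ℝ × ℝ →L[ℝ] ℝ × ℝ →L[ℝ] ℝ × ℝ :=
  (ContinuousLinearMap.fst ℝ ℝ ℝ).smulRight (B₀ z)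
    + (ContinuousLinearMap.snd ℝ ℝ ℝ).smulRight (B₁ z)

theorem connectionForm_apply (B₀ B₁ : ℝ × ℝ → ℝ × ℝ →L[ℝ] ℝ × ℝ) (z v r : ℝ × ℝ) :
    connectionForm B₀ B₁ z v r = v.1 • B₀ z r + v.2 • B₁ z r := by
  simp [connectionForm]

theorem contDiffOn_connectionForm {D : Set (ℝ × ℝ)} {B₀ B₁ : ℝ × ℝ → ℝ × ℝ →L[ℝ] ℝ × ℝ}
    (h₀ : ContDiffOn ℝ ∞ B₀ D) (h₁ : ContDiffOn ℝ ∞ B₁ D) :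
    ContDiffOn ℝ ∞ (connectionForm B₀ B₁) D :=
  (contDiffOn_const.smulRight h₀).add (contDiffOn_const.smulRight h₁)

set_option maxSynthPendingDepth 3 in
/-- Parallel sections of a flat connection near a boundary point of the half-plane. -/
theorem IsHalfOpen.exists_parallel {D : Set (ℝ × ℝ)} (hD : IsHalfOpen D)
    {A : ℝ × ℝ → ℝ × ℝ →L[ℝ] ℝ × ℝ →L[ℝ] ℝ × ℝ} (hA : ContDiffOn ℝ ∞ A D)
    (flat : ∀ z ∈ D, ∀ v w r, fderivWithin ℝ A closedHalfPlane z v w r + A z w (A z v r)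
      = fderivWithin ℝ A closedHalfPlane z w v r + A z v (A z w r))
    {x : ℝ} (hx : (x, (0 : ℝ)) ∈ D) :
    ∃ ε > 0, Set.Ioo (x - ε) (x + ε) ×ˢ Set.Ico 0 ε ⊆ D ∧ ∀ r₀ : ℝ × ℝ,
      ∃ r : ℝ × ℝ → ℝ × ℝ, r (x, 0) = r₀ ∧
        ContDiffOn ℝ ∞ r (Set.Ioo (x - ε) (x + ε) ×ˢ Set.Ico 0 ε) ∧
        ∀ z ∈ Set.Ioo (x - ε) (x + ε) ×ˢ Set.Ico 0 ε,
          HasFDerivWithinAt r ((A z).flip (r z)) closedHalfPlane z := by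
  obtain ⟨ε₀, hε₀, hb⟩ := hD.exists_baseBox_subset hx
  obtain ⟨C, hC⟩ := (isCompact_baseBox x ε₀).exists_bound_of_continuousOn (f := A)
    (hA.continuousOn.mono hb)
  have hC0 : 0 ≤ C := (norm_nonneg _).trans (hC _ (mem_baseBox_self x hε₀.le))
  -- The box is small enough for `‖A z (w - (x, 0))‖ ≤ 1 / 2`, as radial transport requires.
  set ε := min ε₀ (1 / (2 * (C + 1))) with hε
  have hεpos : 0 < ε := lt_min hε₀ (by positivity)
  have hle : ε ≤ ε₀ := min_le_left _ _
  have hsub : baseBox x ε ⊆ baseBox x ε₀ := Set.prod_mono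
    (Set.Icc_subset_Icc (by linarith) (by linarith)) (Set.Icc_subset_Icc_right hle)
  have hKD : baseBox x ε ⊆ D := hsub.trans hb
  have hN : Set.Ioo (x - ε) (x + ε) ×ˢ Set.Ico 0 ε ⊆ baseBox x ε :=
    Set.prod_mono Set.Ioo_subset_Icc_self Set.Ico_subset_Icc_self
  have hu := uniqueDiffOn_baseBox x hεpos
  have hAK : ContDiffOn ℝ ∞ A (baseBox x ε) := hA.mono hKD
  have hder : ∀ z ∈ baseBox x ε,
      HasFDerivWithinAt A (fderivWithin ℝ A closedHalfPlane z) (baseBox x ε) z := fun z hz => by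
    have h1 := ((hA.differentiableOn (by simp)) z (hKD hz)).mono_of_mem_nhdsWithin
      (hD.mem_nhdsWithin z (hKD hz))
    exact h1.hasFDerivWithinAt.mono (baseBox_subset_closedHalfPlane x ε)
  have hderc : ContinuousOn (fderivWithin ℝ A closedHalfPlane) (baseBox x ε) :=
    (hAK.fderivWithin hu (m := ∞) (by simp)).continuousOn.congr fun z hz =>
      ((hder z hz).fderivWithin (hu z hz)).symm
  have hsmall : ∀ z ∈ baseBox x ε, ∀ w ∈ baseBox x ε, ‖A z (w - (x, 0))‖ ≤ 1 / 2 := by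
    intro z hz w hw
    have h1 : ‖w - (x, 0)‖ ≤ ε := by
      rw [Prod.norm_def, max_le_iff, Real.norm_eq_abs, Real.norm_eq_abs, abs_le, abs_le]
      have h1 := hw.1.1
      have h2 := hw.1.2
      have h3 := hw.2.1
      have h4 := hw.2.2
      simp only [Prod.fst_sub, Prod.snd_sub]
      refine ⟨⟨?_, ?_⟩, ?_, ?_⟩ <;> linarith
    refine (ContinuousLinearMap.le_of_opNorm_le_of_le _ (hC z (hsub hz)) h1).trans ?_
    calc C * ε ≤ (C + 1) * (1 / (2 * (C + 1))) :=
          mul_le_mul (by linarith) (min_le_right _ _) hεpos.le (by positivity)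
      _ = 1 / 2 := by field_simp
  refine ⟨ε, hεpos, hN.trans hKD, fun r₀ => ?_⟩
  obtain ⟨r, hr0, hr⟩ := _root_.exists_parallel (convex_baseBox x ε) (isCompact_baseBox x ε) hder
    hderc
    (fun z hz => flat z (hKD hz)) (mem_baseBox_self x hεpos.le) hsmall r₀
  -- Bootstrapping: the derivative of `r` is a smooth bilinear expression in `A` and `r`.
  have hrs : ContDiffOn ℝ ∞ r (baseBox x ε) := by
    rw [contDiffOn_infty]
    intro n
    induction n with
    | zero => exact contDiffOn_zero.2 fun z hz => (hr z hz).continuousWithinAt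
    | succ n ih =>
      push_cast
      rw [contDiffOn_succ_iff_fderivWithin hu]
      refine ⟨fun w hw => (hr w hw).differentiableWithinAt, by simp, ?_⟩
      refine ContDiffOn.congr ?_ fun w hw => (hr w hw).fderivWithin (hu w hw)
      have hflip : ContDiffOn ℝ n (fun z => (A z).flip) (baseBox x ε) :=
        (ContinuousLinearMap.flipₗᵢ ℝ (ℝ × ℝ) (ℝ × ℝ) (ℝ × ℝ)).contDiff.comp_contDiffOn
          (contDiffOn_infty.1 hAK n)
      exact hflip.clm_apply ih
  refine ⟨r, hr0, hrs.mono hN, fun z hz => (hr z (hN hz)).mono_of_mem_nhdsWithin ?_⟩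
  have h1 : Set.Ioo (x - ε) (x + ε) ×ˢ Set.Iio ε ∈ 𝓝 z :=
    (isOpen_Ioo.prod isOpen_Iio).mem_nhds ⟨hz.1, hz.2.2⟩
  filter_upwards [self_mem_nhdsWithin, mem_nhdsWithin_of_mem_nhds h1] with w hw hw'
  exact ⟨⟨hw'.1.1.le, hw'.1.2.le⟩, hw, (Set.mem_Iio.1 hw'.2).le⟩

/-- `(P, Q)` is a parallel section of the flat connection of a hyperbolic normal form. -/
structure IsParallelSection (N : Set (ℝ × ℝ)) (p q ν σ P Q : ℝ × ℝ → ℝ) : Prop where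
  smooth_P : ContDiffOn ℝ ∞ P N
  smooth_Q : ContDiffOn ℝ ∞ Q N
  partials_P : ∀ z ∈ N, HasPartials P (Q z * σ z / 2)
    ((P z * ν z + Q z * ((q z * σ z - hderiv 0 ν z) / p z)) / 2) z
  partials_Q : ∀ z ∈ N, HasPartials Q (P z * (2 * p z - z.2 ^ 2 * σ z) / 2)
    ((P z * (2 * q z - z.2 ^ 2 * ((q z * σ z - hderiv 0 ν z) / p z)) - Q z * ν z) / 2) z

theorem IsParallelSection.mono {N N' : Set (ℝ × ℝ)} {p q ν σ P Q : ℝ × ℝ → ℝ}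
    (h : IsParallelSection N p q ν σ P Q) (hN : N' ⊆ N) : IsParallelSection N' p q ν σ P Q :=
  ⟨h.smooth_P.mono hN, h.smooth_Q.mono hN, fun z hz => h.partials_P z (hN hz),
    fun z hz => h.partials_Q z (hN hz)⟩

/-- The connection form is trace-free and smooth at `y = 0`. Its curvature has three independent
entries, which vanish by the definition of `τ`, by `σ_eq` and by `flat`. -/
theorem HyperbolicNormalForm.exists_isParallelSection {D : Set (ℝ × ℝ)} (hD : IsHalfOpen D)
    {G : ℝ × ℝ → Matrix (Fin 2) (Fin 2) ℝ} {p q ν σ : ℝ × ℝ → ℝ}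
    (h : HyperbolicNormalForm D G p q ν σ) {x : ℝ} (hx : (x, (0 : ℝ)) ∈ D) :
    ∃ ε > 0, Set.Ioo (x - ε) (x + ε) ×ˢ Set.Ico 0 ε ⊆ D ∧ ∀ P₀ Q₀ : ℝ, ∃ P Q : ℝ × ℝ → ℝ,
      P (x, 0) = P₀ ∧ Q (x, 0) = Q₀ ∧
      IsParallelSection (Set.Ioo (x - ε) (x + ε) ×ˢ Set.Ico 0 ε) p q ν σ P Q := by
  set τ : ℝ × ℝ → ℝ := fun w => (q w * σ w - hderiv 0 ν w) / p w with hτ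
  have hτs : ContDiffOn ℝ ∞ τ D :=
    ((h.smooth_q.mul h.smooth_σ).sub (h.smooth_ν.hderiv 0 hD)).div h.smooth_p
      fun z hz => (h.p_pos z hz).ne'
  have hτp : ∀ z ∈ D, hderiv 0 ν z = q z * σ z - p z * τ z := fun z hz => by
    have := (h.p_pos z hz).ne'
    simp only [hτ]
    field_simp
    ring
  have hy : ContDiffOn ℝ ∞ (fun z : ℝ × ℝ => z.2) D := contDiffOn_snd
  set s : ℝ × ℝ → ℝ := fun z => 2 * p z - z.2 ^ 2 * σ z with hs
  set t : ℝ × ℝ → ℝ := fun z => 2 * q z - z.2 ^ 2 * τ z with ht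
  have hss : ContDiffOn ℝ ∞ s D := (contDiffOn_const.mul h.smooth_p).sub ((hy.pow 2).mul h.smooth_σ)
  have hts : ContDiffOn ℝ ∞ t D := (contDiffOn_const.mul h.smooth_q).sub ((hy.pow 2).mul hτs)
  set A := connectionForm (fun z => planeMap 0 (σ z / 2) (s z / 2) 0)
    (fun z => planeMap (ν z / 2) (τ z / 2) (t z / 2) (-(ν z / 2))) with hAdef
  have hA : ContDiffOn ℝ ∞ A D := contDiffOn_connectionForm
    (contDiffOn_planeMap contDiffOn_const (h.smooth_σ.div_const 2) (hss.div_const 2)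
      contDiffOn_const)
    (contDiffOn_planeMap (h.smooth_ν.div_const 2) (hτs.div_const 2) (hts.div_const 2)
      (h.smooth_ν.div_const 2).neg)
  have hAapp : ∀ z v r, A z v r = (v.1 * (σ z / 2 * r.2) + v.2 * (ν z / 2 * r.1 + τ z / 2 * r.2),
      v.1 * (s z / 2 * r.1) + v.2 * (t z / 2 * r.1 - ν z / 2 * r.2)) := by
    intro z v r
    rw [hAdef, connectionForm_apply, planeMap_apply, planeMap_apply]
    ext <;>
      simp only [Prod.fst_add, Prod.snd_add, Prod.smul_fst, Prod.smul_snd, smul_eq_mul] <;> ring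
  have hA' : ∀ z ∈ D, ∀ v w r, fderivWithin ℝ A closedHalfPlane z v w r =
      (v.1 * (w.1 * (hderiv 0 σ z / 2 * r.2)
          + w.2 * (hderiv 0 ν z / 2 * r.1 + hderiv 0 τ z / 2 * r.2))
        + v.2 * (w.1 * (hderiv 1 σ z / 2 * r.2)
          + w.2 * (hderiv 1 ν z / 2 * r.1 + hderiv 1 τ z / 2 * r.2)),
       v.1 * (w.1 * (hderiv 0 s z / 2 * r.1)
          + w.2 * (hderiv 0 t z / 2 * r.1 - hderiv 0 ν z / 2 * r.2))
        + v.2 * (w.1 * (hderiv 1 s z / 2 * r.1)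
          + w.2 * (hderiv 1 t z / 2 * r.1 - hderiv 1 ν z / 2 * r.2))) := by
    intro z hz v w r
    have h1 := (((hA.differentiableOn (by simp)) z hz).mono_of_mem_nhdsWithin
      (hD.mem_nhdsWithin z hz)).hasFDerivWithinAt
    have h2 := (h1.clm_apply (hasFDerivWithinAt_const w z _)).clm_apply
      (hasFDerivWithinAt_const r z _)
    have huz := uniqueDiffOn_closedHalfPlane z (hD.subset hz)
    have hmul : ∀ {f : ℝ × ℝ → ℝ}, ContDiffOn ℝ ∞ f D → ∀ c : ℝ,
        HasPartials (fun z => f z / 2 * c) (hderiv 0 f z / 2 * c) (hderiv 1 f z / 2 * c) z :=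
      fun hf c => ((hf.hasPartials hD hz).mul (.const (c / 2))).congr_coeff (by ring) (by ring)
        |>.congr_of_eqOn hD hz fun w _ => by ring
    have hc : ∀ {f : ℝ × ℝ → ℝ} {a b : ℝ} (c : ℝ), HasPartials f a b z →
        HasPartials (fun z => c * f z) (c * a) (c * b) z := fun c hf =>
      ((HasPartials.const c).mul hf).congr_coeff (by ring) (by ring)
    have k1 := (hc w.1 (hmul h.smooth_σ r.2)).add
      (hc w.2 ((hmul h.smooth_ν r.1).add (hmul hτs r.2)))
    have k2 := (hc w.1 (hmul hss r.1)).add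
      (hc w.2 ((hmul hts r.1).sub (hmul h.smooth_ν r.2)))
    have h3 := HasFDerivWithinAt.prodMk k1 k2
    have h4 := huz.eq (h2.congr_of_eventuallyEq (Filter.Eventually.of_forall fun z =>
      (hAapp z w r).symm) (hAapp z w r).symm) h3
    have h5 := DFunLike.congr_fun h4 v
    simp at h5
    rw [h5]
    ext <;> simp <;> ring
  -- The upper off-diagonal entry of the curvature is `flat`, the lower one is `σ_eq` minus `y²/2`
  -- times `flat`. The diagonal entries vanish after `ν_x` is replaced by `qσ - pτ`.
  have hflat : ∀ z ∈ D, ∀ v w r, fderivWithin ℝ A closedHalfPlane z v w r + A z w (A z v r)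
      = fderivWithin ℝ A closedHalfPlane z w v r + A z v (A z w r) := by
    intro z hz v w r
    have hF11 := hτp z hz
    have hF21 := h.flat z hz
    have hF12 := h.σ_eq z hz
    have hsy : hderiv 1 s z = 2 * hderiv 1 p z - (2 * z.2 * σ z + z.2 ^ 2 * hderiv 1 σ z) :=
      ((((HasPartials.const 2).mul (h.smooth_p.hasPartials hD hz)).sub
        (HasPartials.snd.pow_two.mul (h.smooth_σ.hasPartials hD hz))).congr_coeff rfl
          (by ring)).hderiv_one (hD.subset hz)
    have htx : hderiv 0 t z = 2 * hderiv 0 q z - z.2 ^ 2 * hderiv 0 τ z :=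
      ((((HasPartials.const 2).mul (h.smooth_q.hasPartials hD hz)).sub
        (HasPartials.snd.pow_two.mul (hτs.hasPartials hD hz))).congr_coeff
          (by ring) rfl).hderiv_zero (hD.subset hz)
    have hsz : s z = 2 * p z - z.2 ^ 2 * σ z := rfl
    have htz : t z = 2 * q z - z.2 ^ 2 * τ z := rfl
    rw [hA' z hz, hA' z hz]
    simp only [hAapp]
    rw [hsy, htx, hF11, hsz, htz]
    ext
    · simp only [Prod.fst_add]
      linear_combination (v.1 * w.2 - v.2 * w.1) / 2 * r.2 * hF21
    · simp only [Prod.snd_add]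
      linear_combination (v.1 * w.2 - v.2 * w.1) * r.1 * (hF12 - z.2 ^ 2 / 2 * hF21)
  obtain ⟨ε, hε, hsub, hex⟩ := hD.exists_parallel hA hflat hx
  refine ⟨ε, hε, hsub, fun P₀ Q₀ => ?_⟩
  obtain ⟨r, hr0, hrs, hr⟩ := hex (P₀, Q₀)
  refine ⟨fun z => (r z).1, fun z => (r z).2, by simp [hr0], by simp [hr0], hrs.fst, hrs.snd,
    fun z hz => ?_, fun z hz => ?_⟩
  · refine HasFDerivWithinAt.congr_fderiv (hr z hz).fst ?_
    ext <;> simp [hAapp, hτ] <;> ring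
  · refine HasFDerivWithinAt.congr_fderiv (hr z hz).snd ?_
    ext <;> simp [hAapp, hτ, hs, ht] <;> ring

/-- A basis of parallel sections `(P₁, Q₁)`, `(P₂, Q₂)` of determinant one. -/
structure IsParallelBasis (N : Set (ℝ × ℝ)) (p q ν σ P₁ Q₁ P₂ Q₂ : ℝ × ℝ → ℝ) : Prop where
  first : IsParallelSection N p q ν σ P₁ Q₁
  second : IsParallelSection N p q ν σ P₂ Q₂
  det_eq : ∀ z ∈ N, P₁ z * Q₂ z - Q₁ z * P₂ z = 1
  pos : ∀ z ∈ N, 0 < Q₂ z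

/-- Initial values are the standard basis, so the determinant is one at `(x, 0)` and `Q₂ = 1` there.
Shrinking keeps `Q₂` positive. -/
theorem HyperbolicNormalForm.exists_isParallelBasis {D : Set (ℝ × ℝ)} (hD : IsHalfOpen D)
    {G : ℝ × ℝ → Matrix (Fin 2) (Fin 2) ℝ} {p q ν σ : ℝ × ℝ → ℝ}
    (h : HyperbolicNormalForm D G p q ν σ) {x : ℝ} (hx : (x, (0 : ℝ)) ∈ D) :
    ∃ N, IsHalfOpen N ∧ N ⊆ D ∧ (x, (0 : ℝ)) ∈ N ∧ ∃ P₁ Q₁ P₂ Q₂ : ℝ × ℝ → ℝ,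
      IsParallelBasis N p q ν σ P₁ Q₁ P₂ Q₂ := by
  obtain ⟨ε, hε, hsub, hex⟩ := h.exists_isParallelSection hD hx
  obtain ⟨P₁, Q₁, hP₁0, hQ₁0, h₁⟩ := hex 1 0
  obtain ⟨P₂, Q₂, hP₂0, hQ₂0, h₂⟩ := hex 0 1
  set N := Set.Ioo (x - ε) (x + ε) ×ˢ Set.Ico 0 ε with hN
  have hNeq : N = closedHalfPlane ∩ Set.Ioo (x - ε) (x + ε) ×ˢ Set.Iio ε := by
    ext z
    simp only [hN, closedHalfPlane, Set.mem_prod, Set.mem_Ico, Set.mem_inter_iff, Set.mem_ofPred_eq,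
      Set.mem_Iio]
    tauto
  have hNo : IsHalfOpen N := hNeq ▸ .of_isOpen (isOpen_Ioo.prod isOpen_Iio)
  have hxN : (x, (0 : ℝ)) ∈ N := ⟨⟨by simpa, by simpa⟩, le_rfl, hε⟩
  -- The system is trace-free, so the determinant of two parallel sections is constant.
  have hdet : ∀ z ∈ N, P₁ z * Q₂ z - Q₁ z * P₂ z = 1 := by
    intro z hz
    have hconst := Convex.is_const_of_fderivWithin_eq_zero (𝕜 := ℝ) (s := N)
      (f := fun z => P₁ z * Q₂ z - Q₁ z * P₂ z) ((convex_Ioo _ _).prod (convex_Ico _ _))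
      (((h₁.smooth_P.mul h₂.smooth_Q).sub (h₁.smooth_Q.mul h₂.smooth_P)).differentiableOn
        (by simp)) (fun w hw => ?_) hz hxN
    · simpa [hP₁0, hQ₁0, hP₂0, hQ₂0] using hconst
    · have h3 := (((h₁.partials_P w hw).mul (h₂.partials_Q w hw)).sub
        ((h₁.partials_Q w hw).mul (h₂.partials_P w hw))).congr_coeff (a' := 0) (b' := 0)
          (by ring) (by ring)
      have h4 := (HasFDerivWithinAt.mono h3 hNo.subset).fderivWithin (hNo.uniqueDiffOn w hw)
      rw [h4]
      simp
  refine ⟨N ∩ Q₂ ⁻¹' Set.Ioi 0, hNo.preimage_continuousOn h₂.smooth_Q.continuousOn isOpen_Ioi,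
    fun z hz => hsub hz.1, ⟨hxN, by simp [hQ₂0]⟩, P₁, Q₁, P₂, Q₂, h₁.mono Set.inter_subset_left,
    h₂.mono Set.inter_subset_left, fun z hz => hdet z hz.1, fun z hz => hz.2⟩

/-- The developing map `(Q₁ + i y P₁) / (Q₂ + i y P₂)` of a basis of parallel sections. -/
def developingMap (P₁ Q₁ P₂ Q₂ : ℝ × ℝ → ℝ) (z : ℝ × ℝ) : ℝ × ℝ :=
  ((z.2 ^ 2 * (P₁ z * P₂ z) + Q₁ z * Q₂ z) / (Q₂ z ^ 2 + z.2 ^ 2 * P₂ z ^ 2),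
    z.2 / (Q₂ z ^ 2 + z.2 ^ 2 * P₂ z ^ 2))

namespace IsParallelBasis

variable {N : Set (ℝ × ℝ)} {p q ν σ P₁ Q₁ P₂ Q₂ : ℝ × ℝ → ℝ}

theorem denom_pos (h : IsParallelBasis N p q ν σ P₁ Q₁ P₂ Q₂) {z : ℝ × ℝ} (hz : z ∈ N) :
    0 < Q₂ z ^ 2 + z.2 ^ 2 * P₂ z ^ 2 := by
  have := h.pos z hz
  positivity

theorem contDiffOn_developingMap (h : IsParallelBasis N p q ν σ P₁ Q₁ P₂ Q₂) :
    ContDiffOn ℝ ∞ (developingMap P₁ Q₁ P₂ Q₂) N := by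
  have hy : ContDiffOn ℝ ∞ (fun z : ℝ × ℝ => z.2) N := contDiffOn_snd
  have hR : ContDiffOn ℝ ∞ (fun z => Q₂ z ^ 2 + z.2 ^ 2 * P₂ z ^ 2) N :=
    (h.second.smooth_Q.pow 2).add ((hy.pow 2).mul (h.second.smooth_P.pow 2))
  exact ((((hy.pow 2).mul (h.first.smooth_P.mul h.second.smooth_P)).add
    (h.first.smooth_Q.mul h.second.smooth_Q)).div hR fun z hz => (h.denom_pos hz).ne').prodMk
      (hy.div hR fun z hz => (h.denom_pos hz).ne')

/-- The differential of the developing map `w` is `(p dx + (q + i d) dy) / (Q₂ + i y P₂)²`. -/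
theorem hasPartials_developingMap (h : IsParallelBasis N p q ν σ P₁ Q₁ P₂ Q₂)
    {z : ℝ × ℝ} (hz : z ∈ N) {R c e : ℝ} (hR : R = Q₂ z ^ 2 + z.2 ^ 2 * P₂ z ^ 2)
    (hc : c = Q₂ z ^ 2 - z.2 ^ 2 * P₂ z ^ 2) (he : e = 2 * z.2 * (P₂ z * Q₂ z)) :
    HasPartials (fun w => (developingMap P₁ Q₁ P₂ Q₂ w).1) (p z * c / R ^ 2)
        ((q z * c + (1 + z.2 * ν z) * e) / R ^ 2) z ∧
      HasPartials (fun w => (developingMap P₁ Q₁ P₂ Q₂ w).2) (-(p z * e) / R ^ 2)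
        (((1 + z.2 * ν z) * c - q z * e) / R ^ 2) z := by
  have hR0 := h.denom_pos hz
  have hRp := ((h.second.partials_Q z hz).pow_two).add
    (HasPartials.snd.pow_two.mul (h.second.partials_P z hz).pow_two)
  have hNp := (HasPartials.snd.pow_two.mul
    ((h.first.partials_P z hz).mul (h.second.partials_P z hz))).add
      ((h.first.partials_Q z hz).mul (h.second.partials_Q z hz))
  have hdet := h.det_eq z hz
  -- The function `τ` drops out of the differential of the developing map, so its value is
  -- irrelevant here.
  generalize (q z * σ z - hderiv 0 ν z) / p z = τ at *
  constructor
  · refine (hNp.div hRp hR0.ne').congr_coeff ?_ ?_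
    · rw [hR]
      congr 1
      rw [hc]
      linear_combination (p z * (Q₂ z ^ 2 - z.2 ^ 2 * P₂ z ^ 2)) * hdet
    · rw [hR]
      congr 1
      rw [hc, he]
      linear_combination (q z * (Q₂ z ^ 2 - z.2 ^ 2 * P₂ z ^ 2)
        + (1 + z.2 * ν z) * (2 * z.2 * (P₂ z * Q₂ z))) * hdet
  · refine (HasPartials.snd.div hRp hR0.ne').congr_coeff ?_ ?_
    · rw [hR]
      congr 1
      rw [he]
      ring
    · rw [hR]
      congr 1
      rw [hc, he]
      ring

end IsParallelBasis

/-! ### Coordinates of charts and their transition maps -/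

/-- The linear isomorphism `(x, y) ↦ !₂[y, x]`. -/
def coordEquiv : (ℝ × ℝ) ≃L[ℝ] EuclideanSpace ℝ (Fin 2) :=
  LinearEquiv.toContinuousLinearEquiv
    { toFun := fun z => !₂[z.2, z.1]
      invFun := fun v => (v 1, v 0)
      map_add' := fun z w => by ext i; fin_cases i <;> simp
      map_smul' := fun c z => by ext i; fin_cases i <;> simp
      left_inv := fun z => by simp
      right_inv := fun v => by ext i; fin_cases i <;> simp }

theorem coordEquiv_apply (z : ℝ × ℝ) : coordEquiv z = !₂[z.2, z.1] := rfl

theorem coordEquiv_mem_range {z : ℝ × ℝ} : coordEquiv z ∈ Set.range (𝓡∂ 2) ↔ 0 ≤ z.2 := by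
  rw [range_modelWithCornersEuclideanHalfSpace]
  simp [coordEquiv_apply]

theorem coordEquiv_preimage_range : coordEquiv ⁻¹' Set.range (𝓡∂ 2) = closedHalfPlane := by
  ext z
  exact coordEquiv_mem_range

section Coordinates

variable {M : Type*} [TopologicalSpace M]

/-- The coordinates of a point in the chart `ψ`. -/
def chartCoord (ψ : SurfaceChart M) (p : M) : ℝ × ℝ := coordEquiv.symm (ψ.extend (𝓡∂ 2) p)

/-- The transition map between two charts, in coordinates. -/
def transition (φ ψ : SurfaceChart M) (z : ℝ × ℝ) : ℝ × ℝ := chartCoord ψ (coordPt φ z)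

/-- The domain of the transition map between two charts. -/
def overlap (φ ψ : SurfaceChart M) : Set (ℝ × ℝ) := {z ∈ coordDom φ | coordPt φ z ∈ ψ.source}

theorem coordPt_eq (φ : SurfaceChart M) (z : ℝ × ℝ) :
    coordPt φ z = (φ.extend (𝓡∂ 2)).symm (coordEquiv z) := rfl

theorem bdryChart_eq (φ ψ : SurfaceChart M) (x : ℝ) : bdryChart φ ψ x = (transition φ ψ (x, 0)).1 :=
  rfl

theorem mem_coordDom_iff {φ : SurfaceChart M} {z : ℝ × ℝ} :
    z ∈ coordDom φ ↔ z ∈ closedHalfPlane ∧ (𝓡∂ 2).symm (coordEquiv z) ∈ φ.target := by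
  change coordEquiv z ∈ (φ.extend (𝓡∂ 2)).target ↔ _
  rw [OpenPartialHomeomorph.extend_target, Set.mem_inter_iff, coordEquiv_mem_range, and_comm]
  rfl

theorem isHalfOpen_coordDom (φ : SurfaceChart M) : IsHalfOpen (coordDom φ) := by
  have h : coordDom φ
      = closedHalfPlane ∩ (fun z => (𝓡∂ 2).symm (coordEquiv z)) ⁻¹' φ.target := by
    ext z
    exact mem_coordDom_iff
  rw [h]
  exact .of_isOpen (φ.open_target.preimage
    ((𝓡∂ 2).continuous_symm.comp coordEquiv.continuous))

theorem coordPt_mem_source {φ : SurfaceChart M} {z : ℝ × ℝ} (hz : z ∈ coordDom φ) :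
    coordPt φ z ∈ φ.source := by
  have := (φ.extend (𝓡∂ 2)).map_target hz
  rwa [OpenPartialHomeomorph.extend_source] at this

theorem chartCoord_coordPt {φ : SurfaceChart M} {z : ℝ × ℝ} (hz : z ∈ coordDom φ) :
    chartCoord φ (coordPt φ z) = z := by
  have : (φ.extend (𝓡∂ 2)) (coordPt φ z) = coordEquiv z := (φ.extend (𝓡∂ 2)).right_inv hz
  rw [chartCoord, this, ContinuousLinearEquiv.symm_apply_apply]

theorem chartCoord_mem_coordDom {ψ : SurfaceChart M} {p : M} (hp : p ∈ ψ.source) :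
    chartCoord ψ p ∈ coordDom ψ := by
  change coordEquiv (coordEquiv.symm _) ∈ (ψ.extend (𝓡∂ 2)).target
  rw [ContinuousLinearEquiv.apply_symm_apply]
  exact (ψ.extend (𝓡∂ 2)).map_source (by rwa [OpenPartialHomeomorph.extend_source])

theorem coordPt_chartCoord {ψ : SurfaceChart M} {p : M} (hp : p ∈ ψ.source) :
    coordPt ψ (chartCoord ψ p) = p := by
  rw [coordPt_eq, chartCoord, ContinuousLinearEquiv.apply_symm_apply,
    OpenPartialHomeomorph.extend_left_inv _ hp]

theorem continuousOn_coordPt (φ : SurfaceChart M) : ContinuousOn (coordPt φ) (coordDom φ) :=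
  (φ.continuousOn_extend_symm (I := 𝓡∂ 2)).comp coordEquiv.continuous.continuousOn fun _ hz => hz

theorem isHalfOpen_overlap (φ ψ : SurfaceChart M) : IsHalfOpen (overlap φ ψ) :=
  (isHalfOpen_coordDom φ).preimage_continuousOn (continuousOn_coordPt φ) ψ.open_source

variable {φ ψ : SurfaceChart M} {z : ℝ × ℝ}

theorem coordPt_transition (hz : z ∈ overlap φ ψ) : coordPt ψ (transition φ ψ z) = coordPt φ z :=
  coordPt_chartCoord hz.2

theorem transition_mem_overlap (hz : z ∈ overlap φ ψ) : transition φ ψ z ∈ overlap ψ φ :=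
  ⟨chartCoord_mem_coordDom hz.2, by
    rw [coordPt_transition hz]; exact coordPt_mem_source hz.1⟩

theorem transition_transition (hz : z ∈ overlap φ ψ) : transition ψ φ (transition φ ψ z) = z := by
  rw [transition, coordPt_transition hz, chartCoord_coordPt hz.1]

theorem transition_eq (φ ψ : SurfaceChart M) : transition φ ψ
    = coordEquiv.symm ∘ (ψ.extend (𝓡∂ 2) ∘ (φ.extend (𝓡∂ 2)).symm) ∘ coordEquiv := rfl

/-- The swap of coordinates in `coordEquiv` reverses orientation, but it enters by conjugation and
leaves the determinant unchanged. -/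
theorem det_fderivWithin_extend (φ ψ : SurfaceChart M) (hz : z ∈ closedHalfPlane) :
    (fderivWithin ℝ (ψ.extend (𝓡∂ 2) ∘ (φ.extend (𝓡∂ 2)).symm) (Set.range (𝓡∂ 2))
      (coordEquiv z)).det = (fderivWithin ℝ (transition φ ψ) closedHalfPlane z).det := by
  have hu : UniqueDiffWithinAt ℝ (Set.range (𝓡∂ 2)) (coordEquiv z) :=
    (𝓡∂ 2).uniqueDiffOn _ (coordEquiv_mem_range.2 hz)
  have hu' : UniqueDiffWithinAt ℝ (coordEquiv ⁻¹' Set.range (𝓡∂ 2)) z := by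
    rw [coordEquiv_preimage_range]; exact uniqueDiffOn_closedHalfPlane z hz
  rw [transition_eq, ← coordEquiv_preimage_range, coordEquiv.symm.comp_fderivWithin hu',
    coordEquiv.comp_right_fderivWithin hu']
  generalize fderivWithin ℝ (ψ.extend (𝓡∂ 2) ∘ (φ.extend (𝓡∂ 2)).symm) (Set.range (𝓡∂ 2))
    (coordEquiv z) = L
  exact (LinearMap.det_conj (L : EuclideanSpace ℝ (Fin 2) →ₗ[ℝ] EuclideanSpace ℝ (Fin 2))
    coordEquiv.symm.toLinearEquiv).symm

theorem positiveTransition_iff : PositiveTransition φ ψ ↔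
    ∀ z ∈ overlap φ ψ, 0 < (fderivWithin ℝ (transition φ ψ) closedHalfPlane z).det := by
  constructor
  · intro h z hz
    have := h (coordPt φ z) ⟨coordPt_mem_source hz.1, hz.2⟩
    rw [show (φ.extend (𝓡∂ 2)) (coordPt φ z) = coordEquiv z from
      (φ.extend (𝓡∂ 2)).right_inv hz.1, det_fderivWithin_extend _ _
        ((isHalfOpen_coordDom φ).subset hz.1)] at this
    exact this
  · intro h p hp
    have hz : chartCoord φ p ∈ overlap φ ψ := ⟨chartCoord_mem_coordDom hp.1, by
      rw [coordPt_chartCoord hp.1]; exact hp.2⟩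
    have := h _ hz
    rw [← det_fderivWithin_extend _ _ ((isHalfOpen_coordDom φ).subset hz.1), chartCoord,
      ContinuousLinearEquiv.apply_symm_apply] at this
    exact this

theorem det_prod_eq (L : ℝ × ℝ →L[ℝ] ℝ × ℝ) :
    L.det = (L (1, 0)).1 * (L (0, 1)).2 - (L (0, 1)).1 * (L (1, 0)).2 := by
  rw [ContinuousLinearMap.det, ← LinearMap.det_toMatrix (Module.Basis.finTwoProd ℝ),
    Matrix.det_fin_two]
  simp [LinearMap.toMatrix_apply]

/-- The Jacobian determinant in terms of partial derivatives. -/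
theorem det_eq_of_hasPartials {F : ℝ × ℝ → ℝ × ℝ} {a b a' b' : ℝ} (hz : z ∈ closedHalfPlane)
    (h₁ : HasPartials (fun w => (F w).1) a b z) (h₂ : HasPartials (fun w => (F w).2) a' b' z) :
    (fderivWithin ℝ F closedHalfPlane z).det = a * b' - b * a' := by
  have h : HasFDerivWithinAt F _ closedHalfPlane z := HasFDerivWithinAt.prodMk h₁ h₂
  rw [h.fderivWithin (uniqueDiffOn_closedHalfPlane z hz), det_prod_eq]
  simp

variable [ChartedSpace (EuclideanHalfSpace 2) M]

theorem contDiffOn_transition (hφ : φ ∈ IsManifold.maximalAtlas (𝓡∂ 2) ∞ M)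
    (hψ : ψ ∈ IsManifold.maximalAtlas (𝓡∂ 2) ∞ M) :
    ContDiffOn ℝ ∞ (transition φ ψ) (overlap φ ψ) := by
  have h := (𝓡∂ 2).contDiffOn_extendCoordChange hφ hψ
  rw [transition_eq]
  refine coordEquiv.symm.contDiff.comp_contDiffOn
    (h.comp coordEquiv.contDiff.contDiffOn fun z hz => ?_)
  refine ⟨hz.1, ?_⟩
  rw [OpenPartialHomeomorph.extend_source]
  exact hz.2

theorem transition_differentiable (hφ : φ ∈ IsManifold.maximalAtlas (𝓡∂ 2) ∞ M)
    (hψ : ψ ∈ IsManifold.maximalAtlas (𝓡∂ 2) ∞ M) (hz : z ∈ overlap φ ψ) :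
    DifferentiableWithinAt ℝ (transition φ ψ) closedHalfPlane z :=
  ((contDiffOn_transition hφ hψ).differentiableOn (by simp) z hz).mono_of_mem_nhdsWithin
    ((isHalfOpen_overlap φ ψ).mem_nhdsWithin z hz)

/-- Transition maps preserve the interior. -/
theorem transition_snd_pos (hφ : φ ∈ IsManifold.maximalAtlas (𝓡∂ 2) ∞ M)
    (hψ : ψ ∈ IsManifold.maximalAtlas (𝓡∂ 2) ∞ M) (hz : z ∈ overlap φ ψ) (hz' : 0 < z.2) :
    0 < (transition φ ψ z).2 := by
  have hmem := (isHalfOpen_overlap φ ψ).mem_nhds hz hz'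
  have h1 : HasFDerivAt (transition φ ψ) _ z :=
    ((transition_differentiable hφ hψ hz).differentiableAt
      (closedHalfPlane_mem_nhds hz')).hasFDerivAt
  have h2 := (transition_differentiable hψ hφ (transition_mem_overlap hz)).hasFDerivWithinAt
  have h3 := h2.comp_hasFDerivAt z h1 (Filter.eventually_of_mem hmem fun w hw =>
    (isHalfOpen_overlap ψ φ).subset (transition_mem_overlap hw))
  have h4 : HasFDerivAt (transition ψ φ ∘ transition φ ψ) (ContinuousLinearMap.id ℝ (ℝ × ℝ)) z :=
    (hasFDerivAt_id z).congr_of_eventuallyEq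
      (Filter.eventually_of_mem hmem fun w hw => transition_transition hw)
  have h5 := h3.unique h4
  have hinj : Function.Injective (fderiv ℝ (transition φ ψ) z) := fun v w hvw => by
    have hv := DFunLike.congr_fun h5 v
    have hw := DFunLike.congr_fun h5 w
    simp only [ContinuousLinearMap.comp_apply, ContinuousLinearMap.id_apply] at hv hw
    rw [← hv, ← hw, hvw]
  have hsurj : Function.Surjective (fderiv ℝ (transition φ ψ) z) :=
    (LinearMap.injective_iff_surjective
      (f := (fderiv ℝ (transition φ ψ) z : ℝ × ℝ →ₗ[ℝ] ℝ × ℝ))).1 hinj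
  -- A map into the half-plane with surjective derivative at an interior point cannot take that
  -- point to the boundary line, since its second component would have a local minimum there.
  have := h1.differentiableAt.mem_interior_convex_of_surjective_fderiv hmem
    convex_closedHalfPlane isClosed_closedHalfPlane
    ⟨(0, 1), by rw [interior_closedHalfPlane]; exact one_pos (α := ℝ)⟩
    (fun w hw => (isHalfOpen_overlap ψ φ).subset (transition_mem_overlap hw)) hsurj
  rwa [interior_closedHalfPlane] at this

/-- Otherwise the inverse transition map would send an interior point to the boundary. -/
theorem transition_snd_eq_zero (hφ : φ ∈ IsManifold.maximalAtlas (𝓡∂ 2) ∞ M)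
    (hψ : ψ ∈ IsManifold.maximalAtlas (𝓡∂ 2) ∞ M) (hz : z ∈ overlap φ ψ) (hz' : z.2 = 0) :
    (transition φ ψ z).2 = 0 := by
  have hm := transition_mem_overlap hz
  refine le_antisymm (not_lt.1 fun h => ?_) ((isHalfOpen_overlap ψ φ).snd_nonneg hm)
  have := transition_snd_pos hψ hφ hm h
  rw [transition_transition hz] at this
  exact this.ne' hz'

theorem mdifferentiableAt_coordPt (hψ : ψ ∈ IsManifold.maximalAtlas (𝓡∂ 2) ∞ M)
    (hz : z ∈ coordDom ψ) (hz' : 0 < z.2) :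
    MDifferentiableAt 𝓘(ℝ, ℝ × ℝ) (𝓡∂ 2) (coordPt ψ) z := by
  have h1 := contMDiffOn_extend_symm hψ
  have h2 : ContMDiffOn 𝓘(ℝ, ℝ × ℝ) (𝓡∂ 2) ∞ (coordPt ψ) (coordDom ψ) := by
    refine h1.comp coordEquiv.contDiff.contMDiff.contMDiffOn fun w hw => ?_
    rw [Set.mem_preimage, ← OpenPartialHomeomorph.extend_target']
    exact hw
  exact (h2.contMDiffAt ((isHalfOpen_coordDom ψ).mem_nhds hz hz')).mdifferentiableAt (by simp)

/-- The change of coordinates formula for the matrix of a field of bilinear forms. -/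
theorem coordMatrix_eq (b : ∀ p : M, LinearMap.BilinForm ℝ (TangentSpace (𝓡∂ 2) p))
    (hφ : φ ∈ IsManifold.maximalAtlas (𝓡∂ 2) ∞ M) (hψ : ψ ∈ IsManifold.maximalAtlas (𝓡∂ 2) ∞ M)
    (hz : z ∈ overlap φ ψ) (hz' : 0 < z.2) {J : Matrix (Fin 2) (Fin 2) ℝ}
    (h₀ : HasPartials (fun w => (transition φ ψ w).1) (J 0 0) (J 0 1) z)
    (h₁ : HasPartials (fun w => (transition φ ψ w).2) (J 1 0) (J 1 1) z) :
    coordMatrix b φ z = J.transpose * coordMatrix b ψ (transition φ ψ z) * J := by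
  set E := EuclideanSpace ℝ (Fin 2)
  -- Tangent spaces at all points are definitionally the model space `E`. Working on `E` avoids
  -- transport along `coordPt ψ (transition φ ψ z) = coordPt φ z`.
  let B : M → E → E → ℝ := fun p v w => b p v w
  have hB : ∀ p v v' w, B p (v + v') w = B p v w + B p v' w := fun p v v' w =>
    LinearMap.BilinForm.add_left (B := b p) v v' w
  have hB' : ∀ p v w w', B p v (w + w') = B p v w + B p v w' := fun p v w w' =>
    LinearMap.BilinForm.add_right (B := b p) v w w'
  have hBs : ∀ p (c : ℝ) v w, B p (c • v) w = c * B p v w := fun p c v w =>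
    LinearMap.BilinForm.smul_left (B := b p) c v w
  have hBs' : ∀ p (c : ℝ) v w, B p v (c • w) = c * B p v w := fun p c v w =>
    LinearMap.BilinForm.smul_right (B := b p) c v w
  let dφ : ℝ × ℝ →L[ℝ] E := mfderiv 𝓘(ℝ, ℝ × ℝ) (𝓡∂ 2) (coordPt φ) z
  let dψ : ℝ × ℝ →L[ℝ] E := mfderiv 𝓘(ℝ, ℝ × ℝ) (𝓡∂ 2) (coordPt ψ) (transition φ ψ z)
  have hmem := (isHalfOpen_overlap φ ψ).mem_nhds hz hz'
  have hev : coordPt φ =ᶠ[𝓝 z] coordPt ψ ∘ transition φ ψ :=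
    Filter.eventually_of_mem hmem fun w hw => (coordPt_transition hw).symm
  have hder : HasFDerivAt (transition φ ψ) _ z := (h₀.hasFDerivAt hz').prodMk (h₁.hasFDerivAt hz')
  have hm := transition_mem_overlap hz
  have hcomp : (mfderiv 𝓘(ℝ, ℝ × ℝ) (𝓡∂ 2) (coordPt ψ ∘ transition φ ψ) z : ℝ × ℝ →L[ℝ] E)
      = dψ.comp (fderiv ℝ (transition φ ψ) z) := by
    have h := mfderiv_comp (I := 𝓘(ℝ, ℝ × ℝ)) (I' := 𝓘(ℝ, ℝ × ℝ)) (I'' := 𝓡∂ 2) z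
      (mdifferentiableAt_coordPt hψ hm.1 (transition_snd_pos hφ hψ hz hz'))
      hder.differentiableAt.mdifferentiableAt
    rw [mfderiv_eq_fderiv] at h
    exact h
  have hchain : dφ = dψ.comp (fderiv ℝ (transition φ ψ) z) :=
    Eq.trans hev.mfderiv_eq hcomp
  have hcol : ∀ j, dφ (basisVec j) = J 0 j • dψ (basisVec 0) + J 1 j • dψ (basisVec 1) := by
    intro j
    rw [hchain, ContinuousLinearMap.comp_apply, ← map_smul, ← map_smul, ← map_add, hder.fderiv]
    congr 1
    fin_cases j <;> ext <;> simp [basisVec]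
  have hφ' : ∀ i j, coordMatrix b φ z i j = B (coordPt φ z) (dφ (basisVec i)) (dφ (basisVec j)) :=
    fun i j => rfl
  have hψ' : ∀ i j, coordMatrix b ψ (transition φ ψ z) i j
      = B (coordPt φ z) (dψ (basisVec i)) (dψ (basisVec j)) := by
    intro i j
    rw [← coordPt_transition hz]
    rfl
  ext i j
  rw [hφ', hcol, hcol]
  simp only [Matrix.mul_apply, Fin.sum_univ_two, Matrix.transpose_apply, hψ', hB, hB', hBs, hBs']
  ring

end Coordinates

/-! ### Construction of charts from coordinate changes -/

/-- The coordinates `(x, y)` of a point of the model half-space. -/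
def halfCoord (p : EuclideanHalfSpace 2) : ℝ × ℝ := coordEquiv.symm ((𝓡∂ 2) p)

/-- The point of the model half-space with coordinates `(x, y)`. -/
def halfPoint (z : ℝ × ℝ) : EuclideanHalfSpace 2 := (𝓡∂ 2).symm (coordEquiv z)

theorem continuous_halfCoord : Continuous halfCoord :=
  coordEquiv.symm.continuous.comp (𝓡∂ 2).continuous

theorem continuous_halfPoint : Continuous halfPoint :=
  (𝓡∂ 2).continuous_symm.comp coordEquiv.continuous

theorem halfCoord_mem (p : EuclideanHalfSpace 2) : halfCoord p ∈ closedHalfPlane := by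
  rw [← coordEquiv_preimage_range, Set.mem_preimage, halfCoord,
    ContinuousLinearEquiv.apply_symm_apply]
  exact Set.mem_range_self p

theorem halfPoint_halfCoord (p : EuclideanHalfSpace 2) : halfPoint (halfCoord p) = p := by
  rw [halfPoint, halfCoord, ContinuousLinearEquiv.apply_symm_apply, (𝓡∂ 2).left_inv]

theorem halfCoord_halfPoint {z : ℝ × ℝ} (hz : z ∈ closedHalfPlane) :
    halfCoord (halfPoint z) = z := by
  rw [halfPoint, halfCoord, (𝓡∂ 2).right_inv (coordEquiv_mem_range.2 hz),
    ContinuousLinearEquiv.symm_apply_apply]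

theorem IsHalfOpen.isOpen_preimage_halfCoord {N : Set (ℝ × ℝ)} (hN : IsHalfOpen N) :
    IsOpen (halfCoord ⁻¹' N) :=
  isOpen_iff_mem_nhds.2 fun p hp =>
    (tendsto_nhdsWithin_iff.2 ⟨continuous_halfCoord.tendsto p,
      Filter.Eventually.of_forall halfCoord_mem⟩) (hN.mem_nhdsWithin _ hp)

/-- The partial homeomorphism of the half-space given by mutually inverse maps of coordinates. -/
def halfSpaceHomeomorph {N N' : Set (ℝ × ℝ)} (hN : IsHalfOpen N) (hN' : IsHalfOpen N')
    {F G : ℝ × ℝ → ℝ × ℝ} (hF : ContinuousOn F N) (hG : ContinuousOn G N')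
    (hFN : Set.MapsTo F N N') (hGN : Set.MapsTo G N' N)
    (hGF : ∀ z ∈ N, G (F z) = z) (hFG : ∀ w ∈ N', F (G w) = w) :
    OpenPartialHomeomorph (EuclideanHalfSpace 2) (EuclideanHalfSpace 2) where
  toFun p := halfPoint (F (halfCoord p))
  invFun p := halfPoint (G (halfCoord p))
  source := halfCoord ⁻¹' N
  target := halfCoord ⁻¹' N'
  map_source' p hp := by
    rw [Set.mem_preimage, halfCoord_halfPoint (hN'.subset (hFN hp))]
    exact hFN hp
  map_target' p hp := by
    rw [Set.mem_preimage, halfCoord_halfPoint (hN.subset (hGN hp))]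
    exact hGN hp
  left_inv' p hp := by
    rw [halfCoord_halfPoint (hN'.subset (hFN hp)), hGF _ hp, halfPoint_halfCoord]
  right_inv' p hp := by
    rw [halfCoord_halfPoint (hN.subset (hGN hp)), hFG _ hp, halfPoint_halfCoord]
  open_source := hN.isOpen_preimage_halfCoord
  open_target := hN'.isOpen_preimage_halfCoord
  continuousOn_toFun := continuous_halfPoint.comp_continuousOn
    (hF.comp continuous_halfCoord.continuousOn fun _ hp => hp)
  continuousOn_invFun := continuous_halfPoint.comp_continuousOn
    (hG.comp continuous_halfCoord.continuousOn fun _ hp => hp)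

theorem contDiffOn_halfSpace {N N' : Set (ℝ × ℝ)} (hN' : IsHalfOpen N') {F : ℝ × ℝ → ℝ × ℝ}
    (hF : ContDiffOn ℝ ∞ F N) (hFN : Set.MapsTo F N N') :
    ContDiffOn ℝ ∞ ((𝓡∂ 2) ∘ (fun p => halfPoint (F (halfCoord p))) ∘ (𝓡∂ 2).symm)
      ((𝓡∂ 2).symm ⁻¹' (halfCoord ⁻¹' N) ∩ Set.range (𝓡∂ 2)) := by
  have hcoord : ∀ v ∈ Set.range (𝓡∂ 2), halfCoord ((𝓡∂ 2).symm v) = coordEquiv.symm v :=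
    fun v hv => by rw [halfCoord, (𝓡∂ 2).right_inv hv]
  have h : ContDiffOn ℝ ∞ (coordEquiv ∘ F ∘ coordEquiv.symm)
      ((𝓡∂ 2).symm ⁻¹' (halfCoord ⁻¹' N) ∩ Set.range (𝓡∂ 2)) := by
    refine coordEquiv.contDiff.comp_contDiffOn
      (hF.comp coordEquiv.symm.contDiff.contDiffOn fun v hv => ?_)
    rw [← hcoord v hv.2]
    exact hv.1
  refine h.congr fun v hv => ?_
  have hv' : coordEquiv.symm v ∈ N := by
    rw [← hcoord v hv.2]
    exact hv.1
  simp only [Function.comp_apply]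
  rw [hcoord v hv.2, halfPoint, (𝓡∂ 2).right_inv (coordEquiv_mem_range.2 (hN'.subset (hFN hv')))]

section Charts

variable {M : Type*} [TopologicalSpace M] [ChartedSpace (EuclideanHalfSpace 2) M]
  {φ ψ χ : SurfaceChart M}

theorem trans_mem_maximalAtlas [IsManifold (𝓡∂ 2) ∞ M]
    (hφ : φ ∈ IsManifold.maximalAtlas (𝓡∂ 2) ∞ M)
    {e : OpenPartialHomeomorph (EuclideanHalfSpace 2) (EuclideanHalfSpace 2)}
    (he : e ∈ contDiffGroupoid ∞ (𝓡∂ 2)) :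
    φ ≫ₕ e ∈ IsManifold.maximalAtlas (𝓡∂ 2) ∞ M := by
  intro e' he'
  have he'' : e' ∈ IsManifold.maximalAtlas (𝓡∂ 2) ∞ M :=
    StructureGroupoid.subset_maximalAtlas _ he'
  constructor
  · rw [OpenPartialHomeomorph.trans_symm_eq_symm_trans_symm, OpenPartialHomeomorph.trans_assoc]
    exact (contDiffGroupoid ∞ (𝓡∂ 2)).trans ((contDiffGroupoid ∞ (𝓡∂ 2)).symm he)
      (StructureGroupoid.compatible_of_mem_maximalAtlas hφ he'')
  · rw [← OpenPartialHomeomorph.trans_assoc]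
    exact (contDiffGroupoid ∞ (𝓡∂ 2)).trans
      (StructureGroupoid.compatible_of_mem_maximalAtlas he'' hφ) he

/-- A smooth change of coordinates turns a chart into a new chart. -/
theorem exists_chart_of_coordinate_change [IsManifold (𝓡∂ 2) ∞ M]
    (hφ : φ ∈ IsManifold.maximalAtlas (𝓡∂ 2) ∞ M)
    {N N' : Set (ℝ × ℝ)} (hN : IsHalfOpen N) (hN' : IsHalfOpen N') (hNφ : N ⊆ coordDom φ)
    {F G : ℝ × ℝ → ℝ × ℝ} (hF : ContDiffOn ℝ ∞ F N) (hG : ContDiffOn ℝ ∞ G N')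
    (hFN : Set.MapsTo F N N') (hGN : Set.MapsTo G N' N)
    (hGF : ∀ z ∈ N, G (F z) = z) (hFG : ∀ w ∈ N', F (G w) = w) :
    ∃ ψ ∈ IsManifold.maximalAtlas (𝓡∂ 2) ∞ M, ψ.source ⊆ φ.source ∧ overlap φ ψ = N ∧
      ∀ z ∈ N, transition φ ψ z = F z := by
  set e := halfSpaceHomeomorph hN hN' hF.continuousOn hG.continuousOn hFN hGN hGF hFG with he
  have hmem : e ∈ contDiffGroupoid ∞ (𝓡∂ 2) := by
    rw [contDiffGroupoid, mem_groupoid_of_pregroupoid]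
    exact ⟨contDiffOn_halfSpace hN' hF hFN, contDiffOn_halfSpace hN hG hGN⟩
  have hcoord : ∀ z ∈ coordDom φ, halfCoord (φ (coordPt φ z)) = z := fun z hz =>
    chartCoord_coordPt hz
  have hsrc : (φ ≫ₕ e).source = φ.source ∩ φ ⁻¹' (halfCoord ⁻¹' N) :=
    OpenPartialHomeomorph.trans_source φ e
  refine ⟨φ ≫ₕ e, trans_mem_maximalAtlas hφ hmem, ?_, ?_, ?_⟩
  · rw [hsrc]
    exact Set.inter_subset_left
  · ext z
    constructor
    · rintro ⟨hz, hz'⟩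
      rw [hsrc] at hz'
      have := hz'.2
      rwa [Set.mem_preimage, Set.mem_preimage, hcoord z hz] at this
    · intro hz
      refine ⟨hNφ hz, ?_⟩
      rw [hsrc]
      refine ⟨coordPt_mem_source (hNφ hz), ?_⟩
      rwa [Set.mem_preimage, Set.mem_preimage, hcoord z (hNφ hz)]
  · intro z hz
    change halfCoord (halfPoint (F (halfCoord (φ (coordPt φ z))))) = F z
    rw [hcoord z (hNφ hz), halfCoord_halfPoint (hN'.subset (hFN hz))]

/-- The cocycle property for the Jacobian determinants of transition maps. -/
theorem det_transition (hφ : φ ∈ IsManifold.maximalAtlas (𝓡∂ 2) ∞ M)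
    (hψ : ψ ∈ IsManifold.maximalAtlas (𝓡∂ 2) ∞ M) (hχ : χ ∈ IsManifold.maximalAtlas (𝓡∂ 2) ∞ M)
    {z : ℝ × ℝ} (hz : z ∈ overlap φ ψ) (hz' : z ∈ overlap φ χ) :
    (fderivWithin ℝ (transition φ χ) closedHalfPlane z).det =
      (fderivWithin ℝ (transition ψ χ) closedHalfPlane (transition φ ψ z)).det
        * (fderivWithin ℝ (transition φ ψ) closedHalfPlane z).det := by
  have hO := (isHalfOpen_overlap φ ψ).inter (isHalfOpen_overlap φ χ)
  have hw : transition φ ψ z ∈ overlap ψ χ :=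
    ⟨(transition_mem_overlap hz).1, by rw [coordPt_transition hz]; exact hz'.2⟩
  have hzO : z ∈ overlap φ ψ ∩ overlap φ χ := ⟨hz, hz'⟩
  have h1 := (transition_differentiable hφ hψ hz).hasFDerivWithinAt
  have h2 := (transition_differentiable hψ hχ hw).hasFDerivWithinAt
  have h3 := h2.comp (t := closedHalfPlane) z (h1.mono hO.subset) fun w hw =>
    (isHalfOpen_overlap ψ φ).subset (transition_mem_overlap hw.1)
  have h4 : HasFDerivWithinAt (transition φ χ) _ (overlap φ ψ ∩ overlap φ χ) z :=
    h3.congr (fun w hw => by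
      simp only [Function.comp_apply, transition, coordPt_chartCoord hw.1.2])
      (by simp only [Function.comp_apply, transition, coordPt_chartCoord hz.2])
  have h5 := (h4.mono_of_mem_nhdsWithin (hO.mem_nhdsWithin z hzO)).fderivWithin
    (uniqueDiffOn_closedHalfPlane z (hO.subset hzO))
  rw [h5]
  exact LinearMap.det_comp _ _

/-- By maximality it suffices to compare `ψ` with every oriented chart `χ`. As `ψ` lives inside the
domain of `φ`, the cocycle property reduces this to the pairs `φ, χ` and `φ, ψ`. -/
theorem SurfaceOrientation.mem_charts_of_det_pos (o : SurfaceOrientation M) (hφ : φ ∈ o.charts)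
    (hψ : ψ ∈ IsManifold.maximalAtlas (𝓡∂ 2) ∞ M) (hsrc : ψ.source ⊆ φ.source)
    (hdet : ∀ z ∈ overlap φ ψ, 0 < (fderivWithin ℝ (transition φ ψ) closedHalfPlane z).det) :
    ψ ∈ o.charts := by
  refine o.maximal ψ hψ fun χ hχ => positiveTransition_iff.2 fun w hw => ?_
  have hφ' := o.subset_maximalAtlas hφ
  have hw' : w ∈ overlap ψ φ := ⟨hw.1, hsrc (coordPt_mem_source hw.1)⟩
  have hz := transition_mem_overlap hw'
  have hz' : transition ψ φ w ∈ overlap φ χ := ⟨hz.1, by rw [coordPt_transition hw']; exact hw.2⟩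
  have h := det_transition hφ' hψ (o.subset_maximalAtlas hχ) hz hz'
  rw [transition_transition hw'] at h
  have h1 := positiveTransition_iff.1 (o.positive φ hφ χ hχ) _ hz'
  have h2 := hdet _ hz
  rw [h] at h1
  exact pos_of_mul_pos_left h1 h2.le

end Charts

/-! ### Existence of hyperbolic charts -/

section Existence

variable {M : Type*} [TopologicalSpace M] [ChartedSpace (EuclideanHalfSpace 2) M]

theorem IsHyperbolic.exists_normalForm {o : SurfaceOrientation M} {g : ZeroMetric M}
    (hg : IsHyperbolic o g) {φ : SurfaceChart M} (hφ : φ ∈ o.charts) :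
    ∃ p q ν σ, HyperbolicNormalForm (coordDom φ) (g.matrix φ) p q ν σ := by
  obtain ⟨H, hs, hpos, hH⟩ := g.extends_to_boundary φ (o.subset_maximalAtlas hφ)
  exact (isHalfOpen_coordDom φ).exists_normalForm hs hpos hH
    (hg φ hφ _ (isHalfOpen_coordDom φ).isOpen_interior (fun _ h => h.1) fun _ h => h.2)

/-- The developing map preserves the boundary line and the interior and pulls the half-plane metric
back to `g`. Its Jacobian determinant `p d / R²` is positive up to the boundary, so it is locally
invertible there and orientation-preserving. -/
theorem IsParallelBasis.exists_hyperbolicChart [IsManifold (𝓡∂ 2) ∞ M]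
    {o : SurfaceOrientation M} {g : ZeroMetric M}
    {φ : SurfaceChart M} (hφ : φ ∈ o.charts) {p q ν σ P₁ Q₁ P₂ Q₂ : ℝ × ℝ → ℝ}
    (h : HyperbolicNormalForm (coordDom φ) (g.matrix φ) p q ν σ) {N : Set (ℝ × ℝ)}
    (hN : IsHalfOpen N) (hNφ : N ⊆ coordDom φ) (hb : IsParallelBasis N p q ν σ P₁ Q₁ P₂ Q₂)
    {x : ℝ} (hx : (x, (0 : ℝ)) ∈ N) :
    ∃ ψ, IsHyperbolicChart o g ψ ∧ overlap φ ψ ⊆ N ∧ (x, (0 : ℝ)) ∈ overlap φ ψ ∧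
      ∀ z ∈ overlap φ ψ, transition φ ψ z = developingMap P₁ Q₁ P₂ Q₂ z := by
  have hφ' := o.subset_maximalAtlas hφ
  set F := developingMap P₁ Q₁ P₂ Q₂ with hFdef
  have hF := hb.contDiffOn_developingMap
  have hcons : ∀ z ∈ N, ∃ (R : ℝ) (J : Matrix (Fin 2) (Fin 2) ℝ), 0 < R ∧ (F z).2 = z.2 / R ∧
      HasPartials (fun w => (F w).1) (J 0 0) (J 0 1) z ∧
      HasPartials (fun w => (F w).2) (J 1 0) (J 1 1) z ∧
      0 < J.det ∧ (0 < z.2 → g.matrix φ z = J.transpose * (((F z).2 ^ 2)⁻¹ • 1) * J) := by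
    intro z hz
    obtain ⟨k1, k2⟩ := hb.hasPartials_developingMap hz rfl rfl rfl
    have hR := hb.denom_pos hz
    have hFz : (F z).2 = z.2 / (Q₂ z ^ 2 + z.2 ^ 2 * P₂ z ^ 2) := rfl
    -- With `c + ie = (Q₂ + iyP₂)²` and `R = |Q₂ + iyP₂|²` this is `|c + ie|² = R²`; it is the only
    -- relation between `c`, `e`, `R` needed below.
    have hce : (Q₂ z ^ 2 - z.2 ^ 2 * P₂ z ^ 2) ^ 2 + (2 * z.2 * (P₂ z * Q₂ z)) ^ 2
        = (Q₂ z ^ 2 + z.2 ^ 2 * P₂ z ^ 2) ^ 2 := by ring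
    generalize Q₂ z ^ 2 + z.2 ^ 2 * P₂ z ^ 2 = R at *
    generalize Q₂ z ^ 2 - z.2 ^ 2 * P₂ z ^ 2 = c at *
    generalize 2 * z.2 * (P₂ z * Q₂ z) = e at *
    have hp := h.p_pos z (hNφ hz)
    have hd := h.d_pos z (hNφ hz)
    refine ⟨R, !![p z * c / R ^ 2, (q z * c + (1 + z.2 * ν z) * e) / R ^ 2;
      -(p z * e) / R ^ 2, ((1 + z.2 * ν z) * c - q z * e) / R ^ 2], hR, hFz, by simpa using k1,
      by simpa using k2, ?_, fun hz' => ?_⟩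
    · have : (!![p z * c / R ^ 2, (q z * c + (1 + z.2 * ν z) * e) / R ^ 2;
          -(p z * e) / R ^ 2, ((1 + z.2 * ν z) * c - q z * e) / R ^ 2]).det
          = p z * (1 + z.2 * ν z) / R ^ 2 := by
        rw [Matrix.det_fin_two_of]
        field_simp
        linear_combination (1 + z.2 * ν z) * hce
      rw [this]
      positivity
    · obtain ⟨h1, h2, h3, h4⟩ := h.matrix_eq z (hNφ hz) hz'
      generalize 1 + z.2 * ν z = d at *
      ext i j
      fin_cases i <;> fin_cases j <;>
        simp [h1, h2, h3, h4, hFz, Matrix.mul_apply, Fin.sum_univ_two]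
      · field_simp
        linear_combination -hce
      · field_simp
        linear_combination -(q z) * hce
      · field_simp
        linear_combination -(q z) * hce
      · field_simp
        linear_combination -(q z ^ 2 + d ^ 2) * hce
  obtain ⟨R, J, hR, hF2, k1, k2, hJ, -⟩ := hcons _ hx
  have hdiff : DifferentiableWithinAt ℝ F closedHalfPlane (x, 0) :=
    ((hF.differentiableOn (by simp)) _ hx).mono_of_mem_nhdsWithin (hN.mem_nhdsWithin _ hx)
  have hdet : (fderivWithin ℝ F closedHalfPlane (x, 0)).det ≠ 0 := by
    rw [det_eq_of_hasPartials (hN.subset hx) k1 k2, ← Matrix.det_fin_two]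
    exact hJ.ne'
  obtain ⟨N₁, N₂, G, hN₁, hN₁N, hxN₁, hN₂, hFN, hGN, hGF, hFG, hG⟩ := hN.exists_local_inverse hF
    (fun z hz hz0 => by
      obtain ⟨R, J, hR, hF2, -⟩ := hcons z hz
      rw [hF2, hz0, zero_div])
    (fun z hz hz0 => by
      obtain ⟨R, J, hR, hF2, -⟩ := hcons z hz
      rw [hF2]
      positivity) hx
    (L := (fderivWithin ℝ F closedHalfPlane (x, 0)).toContinuousLinearEquivOfDetNeZero hdet)
    hdiff.hasFDerivWithinAt
  obtain ⟨ψ, hψ, hsrc, hover, htrans⟩ := exists_chart_of_coordinate_change hφ' hN₁ hN₂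
    (hN₁N.trans hNφ) (hF.mono hN₁N) hG hFN hGN hGF hFG
  rw [← hover] at htrans hN₁N hN₁ hxN₁
  have hpart : ∀ z ∈ overlap φ ψ, ∃ J : Matrix (Fin 2) (Fin 2) ℝ,
      HasPartials (fun w => (transition φ ψ w).1) (J 0 0) (J 0 1) z ∧
      HasPartials (fun w => (transition φ ψ w).2) (J 1 0) (J 1 1) z ∧ 0 < J.det ∧
      (0 < z.2 → g.matrix φ z = J.transpose * (((transition φ ψ z).2 ^ 2)⁻¹ • 1) * J) := by
    intro z hz
    obtain ⟨R, J, -, -, k1, k2, hJ, hm⟩ := hcons z (hN₁N hz)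
    refine ⟨J, k1.congr_of_eqOn hN₁ hz fun w hw => by rw [htrans w hw],
      k2.congr_of_eqOn hN₁ hz fun w hw => by rw [htrans w hw], hJ, fun hz' => ?_⟩
    rw [htrans z hz]
    exact hm hz'
  refine ⟨ψ, ⟨o.mem_charts_of_det_pos hφ hψ hsrc fun z hz => ?_, fun w hw hw' => ?_⟩, hN₁N, hxN₁,
    htrans⟩
  · obtain ⟨J, k1, k2, hJ, -⟩ := hpart z hz
    rw [det_eq_of_hasPartials (hN₁.subset hz) k1 k2, ← Matrix.det_fin_two]
    exact hJ
  · have hwo : w ∈ overlap ψ φ := ⟨hw, hsrc (coordPt_mem_source hw)⟩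
    have hz := transition_mem_overlap hwo
    have hz' := transition_snd_pos hψ hφ' hwo hw'
    obtain ⟨J, k1, k2, hJ, hm⟩ := hpart _ hz
    have e1 := hm hz'
    have e2 : g.matrix φ _ = _ := coordMatrix_eq g.form hφ' hψ hz hz' k1 k2
    rw [e1, transition_transition hwo] at e2
    have hJu : IsUnit J := (Matrix.isUnit_iff_isUnit_det J).2 (isUnit_iff_ne_zero.2 hJ.ne')
    have hJu' : IsUnit J.transpose := (Matrix.isUnit_iff_isUnit_det _).2
      (isUnit_iff_ne_zero.2 (by rw [Matrix.det_transpose]; exact hJ.ne'))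
    -- Both sides are the matrix of `g` in `φ`, transported by the same invertible Jacobian matrix.
    exact (hJu'.mul_left_cancel (hJu.mul_right_cancel e2)).symm

end Existence

/-! ### Rigidity of hyperbolic charts -/

theorem eq_of_hasDerivAt_zero {s : Set ℝ} (hs : Convex ℝ s) (ho : IsOpen s) {u : ℝ → ℝ}
    (hu : ∀ t ∈ s, HasDerivAt u 0 t) {t t₀ : ℝ} (ht : t ∈ s) (ht₀ : t₀ ∈ s) : u t = u t₀ :=
  ho.is_const_of_deriv_eq_zero hs.isPreconnected
    (fun t ht => (hu t ht).differentiableAt.differentiableWithinAt)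
    (fun t ht => (hu t ht).deriv) ht ht₀

theorem exists_affine_of_hasDerivAt {f f' : ℝ → ℝ} {s : Set ℝ} (hs : Convex ℝ s) (ho : IsOpen s)
    {t₀ : ℝ} (ht₀ : t₀ ∈ s)
    (hf : ∀ t ∈ s, HasDerivAt f (f' t) t) (hf' : ∀ t ∈ s, HasDerivAt f' 0 t) :
    ∃ γ δ : ℝ, ∀ t ∈ s, f t = γ * t + δ ∧ f' t = γ := by
  have h1 : ∀ t ∈ s, f' t = f' t₀ := fun t ht => eq_of_hasDerivAt_zero hs ho hf' ht ht₀
  refine ⟨f' t₀, f t₀ - f' t₀ * t₀, fun t ht => ⟨?_, h1 t ht⟩⟩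
  have h2 := eq_of_hasDerivAt_zero hs ho (u := fun t => f t - f' t₀ * t) (fun t ht => by
    have := (hf t ht).sub ((hasDerivAt_id t).const_mul (f' t₀))
    exact this.congr_deriv (by simp [h1 t ht])) ht ht₀
  linarith

/-- A function with positive derivative and vanishing Schwarzian derivative is a Möbius
transformation. -/
theorem exists_moebius_of_schwarzian {f w w' w'' : ℝ → ℝ} {s : Set ℝ} (hs : Convex ℝ s)
    (ho : IsOpen s) {t₀ : ℝ} (ht₀ : t₀ ∈ s) (hf : ∀ t ∈ s, HasDerivAt f (w t) t)
    (hw : ∀ t ∈ s, HasDerivAt w (w' t) t) (hw' : ∀ t ∈ s, HasDerivAt w' (w'' t) t)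
    (hpos : ∀ t ∈ s, 0 < w t) (hS : ∀ t ∈ s, 2 * w t * w'' t = 3 * w' t ^ 2) :
    ∃ h : Matrix.SpecialLinearGroup (Fin 2) ℝ, ∀ t ∈ s, ∃ r : ℝ, r ≠ 0 ∧
      ![f t, 1] = r • ((h : Matrix (Fin 2) (Fin 2) ℝ).mulVec ![t, 1]) := by
  -- The functions `(f')^(-1/2)` and `f (f')^(-1/2)` have vanishing second derivative when the
  -- Schwarzian derivative of `f` vanishes. Hence both are affine, and `f` is their quotient.
  set k : ℝ → ℝ := fun t => (√(w t))⁻¹ with hk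
  set k' : ℝ → ℝ := fun t => -(w' t * k t ^ 3) / 2 with hk'
  have hkpos : ∀ t ∈ s, 0 < k t := fun t ht => inv_pos.2 (Real.sqrt_pos.2 (hpos t ht))
  have hkw : ∀ t ∈ s, k t ^ 2 * w t = 1 := fun t ht => by
    simp only [hk]
    rw [inv_pow, Real.sq_sqrt (hpos t ht).le, inv_mul_cancel₀ (hpos t ht).ne']
  have d1 : ∀ t ∈ s, HasDerivAt k (k' t) t := fun t ht => by
    have h1 := ((hw t ht).sqrt (hpos t ht).ne').inv (Real.sqrt_pos.2 (hpos t ht)).ne'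
    refine h1.congr_deriv ?_
    have := Real.sqrt_pos.2 (hpos t ht)
    simp only [hk', hk]
    field_simp
  have d2 : ∀ t ∈ s, HasDerivAt k' 0 t := fun t ht => by
    have h1 := (((hw' t ht).mul ((d1 t ht).pow 3)).neg).div_const 2
    refine h1.congr_deriv ?_
    have hS' := hS t ht
    have hkw' := hkw t ht
    have hkp := hkpos t ht
    simp only [hk']
    push_cast
    have e : w'' t = 3 * w' t ^ 2 * k t ^ 2 / 2 := by
      linear_combination (k t ^ 2 / 2) * hS' - w'' t * hkw'
    rw [e]
    simp only [Pi.pow_apply]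
    ring
  have d3 : ∀ t ∈ s, HasDerivAt (fun t => f t * k t) ((k t)⁻¹ + f t * k' t) t := fun t ht => by
    refine ((hf t ht).mul (d1 t ht)).congr_deriv ?_
    have hkw' := hkw t ht
    have hkp := hkpos t ht
    field_simp
    linear_combination hkw'
  have d4 : ∀ t ∈ s, HasDerivAt (fun t => (k t)⁻¹ + f t * k' t) 0 t := fun t ht => by
    refine (((d1 t ht).inv (hkpos t ht).ne').add ((hf t ht).mul (d2 t ht))).congr_deriv ?_
    have hkw' := hkw t ht
    have hkp := hkpos t ht
    field_simp
    linear_combination k' t * hkw'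
  obtain ⟨γ, δ, h1⟩ := exists_affine_of_hasDerivAt hs ho ht₀ d1 d2
  obtain ⟨α, β, h2⟩ := exists_affine_of_hasDerivAt hs ho ht₀ d3 d4
  have hdet : α * δ - β * γ = 1 := by
    obtain ⟨a1, a2⟩ := h1 t₀ ht₀
    obtain ⟨b1, b2⟩ := h2 t₀ ht₀
    have hkp := (hkpos t₀ ht₀).ne'
    have e1 : (k t₀)⁻¹ * k t₀ = 1 := inv_mul_cancel₀ hkp
    rw [a2] at b2
    have e2 : δ = k t₀ - γ * t₀ := by linarith
    have e3 : β = f t₀ * k t₀ - α * t₀ := by linarith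
    rw [e2, e3, ← b2]
    linear_combination e1
  refine ⟨⟨!![α, β; γ, δ], by rw [Matrix.det_fin_two_of, hdet]⟩, fun t ht =>
    ⟨(k t)⁻¹, inv_ne_zero (hkpos t ht).ne', ?_⟩⟩
  have hkp := (hkpos t ht).ne'
  have b := (h2 t ht).1
  have a := (h1 t ht).1
  ext i
  fin_cases i
  · simp [Matrix.vecHead, Matrix.vecTail]
    field_simp
    linarith
  · simp [Matrix.vecHead, Matrix.vecTail]
    rw [show t * γ + δ = k t by rw [a]; ring, inv_mul_cancel₀ hkp]

section Rigidity

variable {M : Type*} [TopologicalSpace M] [ChartedSpace (EuclideanHalfSpace 2) M]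

/-- The boundary transition maps of hyperbolic charts are Möbius transformations. -/
theorem IsHyperbolicChart.exists_moebius {o : SurfaceOrientation M} {g : ZeroMetric M}
    {ψ₀ ψ : SurfaceChart M} (h₀ : IsHyperbolicChart o g ψ₀) (h₁ : IsHyperbolicChart o g ψ)
    {t₀ : ℝ} (ht₀ : (t₀, (0 : ℝ)) ∈ overlap ψ₀ ψ) :
    ∃ h : Matrix.SpecialLinearGroup (Fin 2) ℝ, ∀ᶠ t in 𝓝 t₀, ∃ r : ℝ, r ≠ 0 ∧
      ![(transition ψ₀ ψ (t, 0)).1, 1]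
        = r • ((h : Matrix (Fin 2) (Fin 2) ℝ).mulVec ![t, 1]) := by
  have hψ₀ := o.subset_maximalAtlas h₀.1
  have hψ := o.subset_maximalAtlas h₁.1
  set O := overlap ψ₀ ψ with hOdef
  have hO : IsHalfOpen O := isHalfOpen_overlap ψ₀ ψ
  set X : ℝ × ℝ → ℝ := fun z => (transition ψ₀ ψ z).1 with hX
  set Y : ℝ × ℝ → ℝ := fun z => (transition ψ₀ ψ z).2 with hY
  have hXs : ContDiffOn ℝ ∞ X O := (contDiffOn_transition hψ₀ hψ).fst
  have hYs : ContDiffOn ℝ ∞ Y O := (contDiffOn_transition hψ₀ hψ).snd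
  have hdet : ∀ z ∈ O, 0 < hderiv 0 X z * hderiv 1 Y z - hderiv 1 X z * hderiv 0 Y z := by
    intro z hz
    rw [← det_eq_of_hasPartials (hO.subset hz) (hXs.hasPartials hO hz) (hYs.hasPartials hO hz)]
    exact positiveTransition_iff.1 (o.positive _ h₀.1 _ h₁.1) z hz
  -- An orientation-preserving isometry is conformal: the Cauchy–Riemann equations hold, and the
  -- conformal factor is the ratio of the heights.
  have conf : ∀ z ∈ O, 0 < z.2 → hderiv 0 X z = hderiv 1 Y z ∧ hderiv 1 X z = -hderiv 0 Y z ∧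
      z.2 ^ 2 * (hderiv 1 Y z ^ 2 + hderiv 0 Y z ^ 2) = Y z ^ 2 := by
    intro z hz hz'
    have hY0 : 0 < Y z := transition_snd_pos hψ₀ hψ hz hz'
    have e := coordMatrix_eq (J := !![hderiv 0 X z, hderiv 1 X z; hderiv 0 Y z, hderiv 1 Y z])
      g.form hψ₀ hψ hz hz' (hXs.hasPartials hO hz) (hYs.hasPartials hO hz)
    have e₀ : coordMatrix g.form ψ₀ z = _ := h₀.2 z hz.1 hz'
    have e₁ : coordMatrix g.form ψ (transition ψ₀ ψ z) = _ :=
      h₁.2 _ (transition_mem_overlap hz).1 hY0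
    rw [e₀, e₁] at e
    have c00 := congrFun (congrFun e 0) 0
    have c01 := congrFun (congrFun e 0) 1
    have c11 := congrFun (congrFun e 1) 1
    have hYz : (transition ψ₀ ψ z).2 = Y z := rfl
    simp [Matrix.mul_apply, Fin.sum_univ_two, hYz] at c00 c01 c11
    have hd := hdet z hz
    generalize hderiv 0 X z = a at *
    generalize hderiv 1 X z = b at *
    generalize hderiv 0 Y z = a' at *
    generalize hderiv 1 Y z = b' at *
    field_simp at c00 c01 c11
    have s1 : z.2 ^ 2 * (a ^ 2 + a' ^ 2) = Y z ^ 2 := by linear_combination -c00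
    have s2 : z.2 ^ 2 * (b ^ 2 + b' ^ 2) = Y z ^ 2 := by linear_combination -c11
    have s3 : a * b + a' * b' = 0 := by linear_combination -c01
    have s4 : a ^ 2 + a' ^ 2 = b ^ 2 + b' ^ 2 := by
      have := hz'.ne'
      exact mul_left_cancel₀ (pow_ne_zero 2 this) (s1.trans s2.symm)
    -- Lagrange's identity for orthogonal columns of equal length: the squared determinant is the
    -- squared conformal factor. Positivity of the determinant selects the sign.
    have s5 : (a * b' - b * a' - (a ^ 2 + a' ^ 2)) * (a * b' - b * a' + (a ^ 2 + a' ^ 2)) = 0 := by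
      linear_combination -(a ^ 2 + a' ^ 2) * s4 - (a * b + a' * b') * s3
    have s6 : a * b' - b * a' = a ^ 2 + a' ^ 2 := by
      rcases mul_eq_zero.1 s5 with s | s
      · linarith
      · nlinarith [sq_nonneg a, sq_nonneg a']
    have s7 : (a - b') ^ 2 + (b + a') ^ 2 = 0 := by linear_combination -2 * s6 - s4
    have s8 : a - b' = 0 := by nlinarith [sq_nonneg (a - b'), sq_nonneg (b + a')]
    have s9 : b + a' = 0 := by nlinarith [sq_nonneg (a - b'), sq_nonneg (b + a')]
    refine ⟨by linarith, by linarith, ?_⟩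
    rw [← s1, show b' = a by linarith]
  have CR1 : ∀ z ∈ O, hderiv 0 X z = hderiv 1 Y z := hO.eqOn_of_eqOn_interior
    (hXs.hderiv 0 hO).continuousOn (hYs.hderiv 1 hO).continuousOn fun z hz hz' => (conf z hz hz').1
  have CR2 : ∀ z ∈ O, hderiv 1 X z = -hderiv 0 Y z := hO.eqOn_of_eqOn_interior
    (hXs.hderiv 1 hO).continuousOn (hYs.hderiv 0 hO).neg.continuousOn
    fun z hz hz' => (conf z hz hz').2.1
  -- On the boundary `W = Y_y = X_x`, so `W(t, 0)` is the derivative of the boundary transition map.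
  obtain ⟨W, hWs, hYW⟩ := hO.exists_eq_snd_mul hYs fun z hz hz' =>
    transition_snd_eq_zero hψ₀ hψ hz hz'
  have hYp : ∀ z ∈ O, HasPartials Y (z.2 * hderiv 0 W z) (W z + z.2 * hderiv 1 W z) z :=
    fun z hz => ((HasPartials.snd.mul (hWs.hasPartials hO hz)).congr_coeff (by ring)
      (by ring)).congr_of_eqOn hO hz hYW
  have hY0 : ∀ z ∈ O, hderiv 0 Y z = z.2 * hderiv 0 W z := fun z hz =>
    (hYp z hz).hderiv_zero (hO.subset hz)
  have hY1 : ∀ z ∈ O, hderiv 1 Y z = W z + z.2 * hderiv 1 W z := fun z hz =>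
    (hYp z hz).hderiv_one (hO.subset hz)
  have hy : ContinuousOn (fun z : ℝ × ℝ => z.2) O := continuousOn_snd
  have hWx := (hWs.hderiv 0 hO)
  have hWy := (hWs.hderiv 1 hO)
  -- Continuity alone gives `W ≥ 0` on the boundary; strict positivity there needs the Jacobian
  -- determinant, which is `W²` at `y = 0`.
  have hWabs : ∀ z ∈ O, |W z| = W z := hO.eqOn_of_eqOn_interior hWs.continuousOn.abs
    hWs.continuousOn fun z hz hz' => by
      have hYpos : 0 < Y z := transition_snd_pos hψ₀ hψ hz hz'
      rw [hYW z hz] at hYpos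
      exact abs_of_pos (pos_of_mul_pos_right hYpos hz'.le)
  have hWpos : ∀ z ∈ O, z.2 = 0 → 0 < W z := by
    intro z hz hz0
    have h1 := hdet z hz
    rw [CR1 z hz, CR2 z hz, hY0 z hz, hY1 z hz, hz0] at h1
    have h2 : W z ≠ 0 := fun h => by simp [h] at h1
    rw [← hWabs z hz]
    exact abs_pos.2 h2
  -- The isometry equation after substituting `Y = yW` and dividing by `y³`. At `y = 0` it forces
  -- `W_y = 0`, so `W_y = yV`.
  have E1 : ∀ z ∈ O, 2 * W z * hderiv 1 W z
      + z.2 * (hderiv 1 W z ^ 2 + hderiv 0 W z ^ 2) = 0 :=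
    hO.eqOn_of_eqOn_interior
      (((continuousOn_const.mul hWs.continuousOn).mul hWy.continuousOn).add
        (hy.mul ((hWy.continuousOn.pow 2).add (hWx.continuousOn.pow 2)))) continuousOn_const
      fun z hz hz' => by
        have h1 := (conf z hz hz').2.2
        rw [hY0 z hz, hY1 z hz, hYW z hz] at h1
        refine mul_left_cancel₀ (pow_ne_zero 3 hz'.ne') ?_
        linear_combination h1
  obtain ⟨V, hVs, hWV⟩ := hO.exists_eq_snd_mul hWy fun z hz hz0 => by
    have h1 := E1 z hz
    rw [hz0, zero_mul, add_zero] at h1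
    exact (mul_eq_zero.1 h1).resolve_left (mul_ne_zero two_ne_zero (hWpos z hz hz0).ne')
  have E2 : ∀ z ∈ O, 2 * W z * V z + z.2 ^ 2 * V z ^ 2 + hderiv 0 W z ^ 2 = 0 :=
    hO.eqOn_of_eqOn_interior
      (((continuousOn_const.mul hWs.continuousOn).mul hVs.continuousOn).add
        ((hy.pow 2).mul (hVs.continuousOn.pow 2)) |>.add (hWx.continuousOn.pow 2))
      continuousOn_const fun z hz hz' => by
        have h1 := E1 z hz
        rw [hWV z hz] at h1
        refine mul_left_cancel₀ hz'.ne' ?_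
        linear_combination h1
  have hWyy : ∀ z ∈ O, hderiv 1 (hderiv 1 W) z = V z + z.2 * hderiv 1 V z := fun z hz =>
    (((HasPartials.snd.mul (hVs.hasPartials hO hz)).congr_coeff rfl (by ring)).congr_of_eqOn hO hz
      hWV).hderiv_one (hO.subset hz)
  -- Symmetry of the second derivatives of `X`, that is, harmonicity of `Y = yW`, divided by `y`.
  have E3 : ∀ z ∈ O, hderiv 0 (hderiv 0 W) z + 2 * V z + hderiv 1 (hderiv 1 W) z = 0 :=
    hO.eqOn_of_eqOn_interior
      (((hWx.hderiv 0 hO).continuousOn.add (continuousOn_const.mul hVs.continuousOn)).add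
        (hWy.hderiv 1 hO).continuousOn) continuousOn_const fun z hz hz' => by
        have a1 : hderiv 0 (hderiv 1 X) z = -(z.2 * hderiv 0 (hderiv 0 W) z) :=
          ((((HasPartials.snd.mul (hWx.hasPartials hO hz)).neg).congr_coeff (by ring)
            rfl).congr_of_eqOn hO hz fun w hw => by
              rw [CR2 w hw, hY0 w hw]).hderiv_zero (hO.subset hz)
        have a2 : hderiv 1 (hderiv 0 X) z
            = 2 * hderiv 1 W z + z.2 * hderiv 1 (hderiv 1 W) z :=
          ((((hWs.hasPartials hO hz).add (HasPartials.snd.mul (hWy.hasPartials hO hz))).congr_coeff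
            rfl (by ring)).congr_of_eqOn hO hz fun w hw => by
              rw [CR1 w hw, hY1 w hw]).hderiv_one (hO.subset hz)
        have a3 := hXs.hderiv_comm hO hz
        rw [a1, a2] at a3
        have a4 := hWV z hz
        refine mul_left_cancel₀ hz'.ne' ?_
        linear_combination -a3 - 2 * a4
  obtain ⟨ε, hε, hball⟩ := Metric.isOpen_iff.1 hO.isOpen_boundary t₀ ht₀
  obtain ⟨h, hh⟩ := exists_moebius_of_schwarzian (s := Metric.ball t₀ ε)
    (f := fun t => X (t, 0)) (w := fun t => W (t, 0)) (w' := fun t => hderiv 0 W (t, 0))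
    (w'' := fun t => hderiv 0 (hderiv 0 W) (t, 0)) (convex_ball _ _) Metric.isOpen_ball
    (Metric.mem_ball_self hε)
    (fun t ht => by
      have ht' : (t, (0 : ℝ)) ∈ O := hball ht
      have h1 := (hXs.hasPartials hO ht').hasDerivAt_fst (hO.subset ht')
      rw [CR1 _ ht', hY1 _ ht'] at h1
      simpa using h1)
    (fun t ht => (hWs.hasPartials hO (hball ht)).hasDerivAt_fst (hO.subset (hball ht)))
    (fun t ht => (hWx.hasPartials hO (hball ht)).hasDerivAt_fst (hO.subset (hball ht)))
    (fun t ht => hWpos _ (hball ht) rfl)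
    (fun t ht => by
      have ht' : (t, (0 : ℝ)) ∈ O := hball ht
      have h1 := E2 _ ht'
      have h2 := E3 _ ht'
      rw [hWyy _ ht'] at h2
      simp only [] at h1 h2
      -- At `y = 0` one has `W_yy = V`, hence `W_xx = -3V` by `E3` and `2WV = -W_x²` by `E2`.
      -- Eliminating `V` gives `2 W W_xx = 3 W_x²`, the vanishing of the Schwarzian derivative.
      linear_combination 2 * W (t, 0) * h2 - 3 * h1)
  exact ⟨h, Filter.eventually_of_mem (Metric.ball_mem_nhds t₀ hε) hh⟩

end Rigidity

/-! ### Volume form and geodesic curvature of horizontal curves in normal form -/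

theorem geodesicCurvature_horizontal (G : ℝ × ℝ → Matrix (Fin 2) (Fin 2) ℝ) (x y : ℝ) :
    geodesicCurvature G (fun t => (x + t, y)) 0
      = volCoeff G (x, y) * christoffel G 1 0 0 (x, y) / √(G (x, y) 0 0) ^ 3 := by
  have h0 : velocity (fun t => (x + t, y)) 0 = fun _ => 1 := by
    funext t
    simp [velocity]
  have h1 : velocity (fun t => (x + t, y)) 1 = fun _ => 0 := by
    funext t
    simp [velocity]
  simp [geodesicCurvature, acceleration, h0, h1]

namespace HyperbolicNormalForm

variable {D : Set (ℝ × ℝ)} {G : ℝ × ℝ → Matrix (Fin 2) (Fin 2) ℝ} {p q ν σ : ℝ × ℝ → ℝ} {z : ℝ × ℝ}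

theorem volCoeff_eq (h : HyperbolicNormalForm D G p q ν σ) (hz : z ∈ D) (hz' : 0 < z.2) :
    volCoeff G z = (z.2 ^ 2)⁻¹ * (p z * (1 + z.2 * ν z)) := by
  obtain ⟨h1, h2, h3, h4⟩ := h.matrix_eq z hz hz'
  have hp := h.p_pos z hz
  have hd := h.d_pos z hz
  rw [volCoeff, Matrix.det_fin_two, h1, h2, h3, h4]
  generalize 1 + z.2 * ν z = d at *
  rw [← Real.sqrt_sq (show 0 ≤ (z.2 ^ 2)⁻¹ * (p z * d) by positivity)]
  congr 1
  ring

/-- Only `∂ₓG₀₀`, `∂ᵧG₀₀` and `∂ₓG₀₁` enter, so the lower right entry of the matrix is never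
differentiated. -/
theorem christoffel_eq (h : HyperbolicNormalForm D G p q ν σ) (hD : IsHalfOpen D) (hz : z ∈ D)
    (hz' : 0 < z.2) : christoffel G 1 0 0 z * (1 + z.2 * ν z) ^ 2
      = p z * (p z / z.2 + hderiv 0 q z - hderiv 1 p z) := by
  have hV : IsHalfOpen (D ∩ Prod.snd ⁻¹' Set.Ioi 0) :=
    hD.preimage_continuousOn continuousOn_snd isOpen_Ioi
  have hzV : z ∈ D ∩ Prod.snd ⁻¹' Set.Ioi 0 := ⟨hz, hz'⟩
  have py := ((HasPartials.snd (z := z)).pow_two).inv (pow_ne_zero 2 hz'.ne')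
  have pp := h.smooth_p.hasPartials hD hz
  have pq := h.smooth_q.hasPartials hD hz
  have k00 := (py.mul pp.pow_two).congr_of_eqOn (g := fun w => G w 0 0) hV hzV
    fun w hw => (h.matrix_eq w hw.1 hw.2).1
  have k01 := (py.mul (pp.mul pq)).congr_of_eqOn (g := fun w => G w 0 1) hV hzV
    fun w hw => (h.matrix_eq w hw.1 hw.2).2.1
  obtain ⟨h1, h2, h3, h4⟩ := h.matrix_eq z hz hz'
  have hp := h.p_pos z hz
  have hd := h.d_pos z hz
  have hdet : (G z).det = (z.2 ^ 2)⁻¹ ^ 2 * p z ^ 2 * (1 + z.2 * ν z) ^ 2 := by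
    rw [Matrix.det_fin_two, h1, h2, h3, h4]
    ring
  have hinv10 : (G z)⁻¹ 1 0 = -(G z 1 0) / (G z).det := by
    rw [Matrix.inv_def, Matrix.adjugate_fin_two]
    simp
    ring
  have hinv11 : (G z)⁻¹ 1 1 = G z 0 0 / (G z).det := by
    rw [Matrix.inv_def, Matrix.adjugate_fin_two]
    simp
    ring
  rw [christoffel, Fin.sum_univ_two, hinv10, hinv11, hdet, h1, h3, k00.pderiv_zero hz',
    k00.pderiv_one hz', k01.pderiv_zero hz']
  generalize 1 + z.2 * ν z = d at *
  field_simp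
  ring

/-- The geodesic curvature of a horizontal curve. -/
theorem geodesicCurvature_sub_one_div (h : HyperbolicNormalForm D G p q ν σ) (hD : IsHalfOpen D)
    {x y : ℝ} (hz : (x, y) ∈ D) (hy : 0 < y) :
    (geodesicCurvature G (fun t => (x + t, y)) 0 - 1) / y ^ 2 = -(σ (x, y) / p (x, y)) := by
  have e1 := h.volCoeff_eq hz hy
  have e2 := h.christoffel_eq hD hz hy
  have e3 := h.σ_eq _ hz
  have hp := h.p_pos _ hz
  have hd := h.d_pos _ hz
  have e4 : √(G (x, y) 0 0) = p (x, y) / y := by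
    rw [(h.matrix_eq _ hz hy).1]
    refine (Real.sqrt_eq_iff_mul_self_eq (by positivity) (by positivity)).2 ?_
    ring
  rw [geodesicCurvature_horizontal, e1, e4]
  simp only at *
  set d := 1 + y * ν (x, y) with hdef
  have e5 : christoffel G 1 0 0 (x, y)
      = p (x, y) * (p (x, y) / y + hderiv 0 q (x, y) - hderiv 1 p (x, y)) / d ^ 2 := by
    rw [eq_div_iff (pow_ne_zero 2 hd.ne'), e2]
  have e6 : hderiv 0 q (x, y) = hderiv 1 p (x, y) + p (x, y) * ν (x, y) - y * d * σ (x, y) := by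
    linarith
  rw [e5, e6]
  field_simp
  rw [hdef]
  ring

theorem tendsto_boundary (h : HyperbolicNormalForm D G p q ν σ) (hD : IsHalfOpen D) {x : ℝ}
    (hx : (x, (0 : ℝ)) ∈ D) :
    Filter.Tendsto (fun y => (geodesicCurvature G (fun t => (x + t, y)) 0 - 1) / y ^ 2) (𝓝[>] 0)
      (𝓝 (-(σ (x, 0) / p (x, 0)))) := by
  have hline : Filter.Tendsto (fun y : ℝ => (x, y)) (𝓝[>] 0) (𝓝[D] (x, 0)) := by
    rw [hD.nhdsWithin_eq hx]
    exact tendsto_nhdsWithin_iff.2 ⟨((by fun_prop : Continuous fun y : ℝ => (x, y)).tendsto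
      0).mono_left nhdsWithin_le_nhds, Filter.eventually_of_mem self_mem_nhdsWithin
        fun y hy => le_of_lt (Set.mem_Ioi.1 hy)⟩
  have hcont : ContinuousWithinAt (fun z => -(σ z / p z)) D (x, 0) :=
    ((h.smooth_σ.continuousOn.div h.smooth_p.continuousOn fun z hz =>
      (h.p_pos z hz).ne').neg) _ hx
  refine (hcont.tendsto.comp hline).congr' ?_
  filter_upwards [self_mem_nhdsWithin, hline self_mem_nhdsWithin] with y hy hyD
  exact (h.geodesicCurvature_sub_one_div hD hyD hy).symm

/-- Since `d = 1 + yν`, the density is `y⁻² p + y⁻¹ pν`, and `p - p(x, 0)` is divisible by `y`. The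
condition on `(z.1, 0)` makes this boundary value meaningful. -/
theorem exists_volCoeff_eq (h : HyperbolicNormalForm D G p q ν σ) (hD : IsHalfOpen D) :
    ∃ r : ℝ × ℝ → ℝ, ContDiffOn ℝ ∞ r {z ∈ D | (z.1, (0 : ℝ)) ∈ D} ∧
      ∀ z ∈ D, (z.1, (0 : ℝ)) ∈ D → 0 < z.2 →
        volCoeff G z = (z.2 ^ 2)⁻¹ * p (z.1, 0) + z.2⁻¹ * r z := by
  set D' := {z ∈ D | (z.1, (0 : ℝ)) ∈ D} with hD'def
  have hD' : IsHalfOpen D' := hD.preimage_continuousOn continuousOn_fst hD.isOpen_boundary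
  have hsub : D' ⊆ D := fun z hz => hz.1
  have hline : ContDiffOn ℝ ∞ (fun z : ℝ × ℝ => p (z.1, 0)) D' :=
    h.smooth_p.comp (contDiff_fst.prodMk contDiff_const).contDiffOn fun z hz => hz.2
  obtain ⟨r, hr, hpr⟩ := hD'.exists_eq_snd_mul (f := fun z => p z - p (z.1, 0))
    ((h.smooth_p.mono hsub).sub hline) (fun z hz hz0 => by
      rw [show z = (z.1, 0) from Prod.ext rfl hz0]
      exact sub_self _)
  refine ⟨fun z => r z + p z * ν z,
    hr.add ((h.smooth_p.mul h.smooth_ν).mono hsub), fun z hz hz0 hz' => ?_⟩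
  have e : p z - p (z.1, 0) = z.2 * r z := hpr z ⟨hz, hz0⟩
  rw [h.volCoeff_eq hz hz', show p (z.1, 0) = p z - z.2 * r z by linarith]
  field_simp
  ring

end HyperbolicNormalForm

/-! ### Solutions of Hill's equation -/

/-- `u₁`, `u₂` are solutions of `u'' + T u = 0` on `J` with derivatives `w₁`, `w₂` and Wronskian
`u₁ u₂' - u₁' u₂ = -1`. -/
structure IsHillBasis (J : Set ℝ) (T u₁ u₂ w₁ w₂ : ℝ → ℝ) : Prop where
  deriv_fst : ∀ x ∈ J, HasDerivAt u₁ (w₁ x) x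
  deriv_snd : ∀ x ∈ J, HasDerivAt u₂ (w₂ x) x
  deriv_deriv_fst : ∀ x ∈ J, HasDerivAt w₁ (-(T x * u₁ x)) x
  deriv_deriv_snd : ∀ x ∈ J, HasDerivAt w₂ (-(T x * u₂ x)) x
  wronskian : ∀ x ∈ J, u₁ x * w₂ x - w₁ x * u₂ x = -1

/-- Local existence for Hill's equation. -/
theorem exists_hill_solution {T : ℝ → ℝ} {x₀ : ℝ} (hT : ContDiffAt ℝ 1 T x₀) (c d : ℝ) :
    ∃ u w : ℝ → ℝ, u x₀ = c ∧ w x₀ = d ∧ ∀ᶠ x in 𝓝 x₀, HasDerivAt u (w x) x ∧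
      HasDerivAt w (-(T x * u x)) x := by
  -- Time is added as a first coordinate of speed one, which makes the first-order system
  -- autonomous.
  have hf : ContDiffAt ℝ 1 (fun v : ℝ × ℝ × ℝ => ((1 : ℝ), v.2.2, -(T v.1 * v.2.1)))
      (x₀, c, d) := by
    have h1 : ContDiffAt ℝ 1 (fun v : ℝ × ℝ × ℝ => T v.1) (x₀, c, d) :=
      ContDiffAt.comp (x₀, c, d) (g := T) hT contDiffAt_fst
    fun_prop
  obtain ⟨α, hα0, ε, hε, hα⟩ :=
    hf.exists_forall_mem_closedBall_exists_eq_forall_mem_Ioo_hasDerivAt₀ x₀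
  have hx₀ : x₀ ∈ Set.Ioo (x₀ - ε) (x₀ + ε) := ⟨by linarith, by linarith⟩
  have h1 : ∀ t ∈ Set.Ioo (x₀ - ε) (x₀ + ε), HasDerivAt (fun t => (α t).1) 1 t := fun t ht =>
    (hα t ht).fst
  have htime : ∀ t ∈ Set.Ioo (x₀ - ε) (x₀ + ε), (α t).1 = t := fun t ht => by
    have h2 := eq_of_hasDerivAt_zero (convex_Ioo _ _) isOpen_Ioo (u := fun t => (α t).1 - t)
      (fun s hs => ((h1 s hs).sub (hasDerivAt_id s)).congr_deriv (sub_self 1)) ht hx₀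
    rw [hα0] at h2
    linarith
  refine ⟨fun t => (α t).2.1, fun t => (α t).2.2, congrArg (fun v => v.2.1) hα0,
    congrArg (fun v => v.2.2) hα0,
    Filter.eventually_of_mem (isOpen_Ioo.mem_nhds hx₀) fun t ht => ⟨(hα t ht).snd.fst, ?_⟩⟩
  have h3 : HasDerivAt (fun t => (α t).2.2) (-(T (α t).1 * (α t).2.1)) t := (hα t ht).snd.snd
  rwa [htime t ht] at h3

theorem exists_isHillBasis {T : ℝ → ℝ} {x₀ : ℝ} {U : Set ℝ} (hU : IsOpen U) (hx₀ : x₀ ∈ U)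
    (hT : ContDiffOn ℝ ∞ T U) : ∃ ε > 0, Metric.ball x₀ ε ⊆ U ∧ ∃ u₁ u₂ w₁ w₂ : ℝ → ℝ,
      IsHillBasis (Metric.ball x₀ ε) T u₁ u₂ w₁ w₂ := by
  have hT1 : ContDiffAt ℝ 1 T x₀ := (hT.contDiffAt (hU.mem_nhds hx₀)).of_le (by norm_cast)
  -- Initial data `(1, 0)` and `(0, -1)` give Wronskian `-1` at `x₀`.
  obtain ⟨u₁, w₁, a₁, b₁, h₁⟩ := exists_hill_solution hT1 1 0
  obtain ⟨u₂, w₂, a₂, b₂, h₂⟩ := exists_hill_solution hT1 0 (-1)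
  obtain ⟨ε, hε, h⟩ := Metric.eventually_nhds_iff_ball.1 ((h₁.and h₂).and (hU.mem_nhds hx₀))
  refine ⟨ε, hε, fun x hx => (h x hx).2, u₁, u₂, w₁, w₂, fun x hx => (h x hx).1.1.1,
    fun x hx => (h x hx).1.2.1, fun x hx => (h x hx).1.1.2, fun x hx => (h x hx).1.2.2,
    fun x hx => ?_⟩
  have hc := eq_of_hasDerivAt_zero (convex_ball x₀ ε) Metric.isOpen_ball
    (u := fun x => u₁ x * w₂ x - w₁ x * u₂ x) (fun t ht => by
      obtain ⟨⟨⟨k1, k2⟩, k3, k4⟩, -⟩ := h t ht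
      exact ((k1.mul k4).sub (k2.mul k3)).congr_deriv (by ring)) hx (Metric.mem_ball_self hε)
  rw [a₁, b₁, a₂, b₂] at hc
  linarith

theorem contDiffOn_of_hill {J : Set ℝ} (hJ : IsOpen J) {T u w : ℝ → ℝ} (hT : ContDiffOn ℝ ∞ T J)
    (hu : ∀ x ∈ J, HasDerivAt u (w x) x) (hw : ∀ x ∈ J, HasDerivAt w (-(T x * u x)) x) :
    ContDiffOn ℝ ∞ u J := by
  have hdu : DifferentiableOn ℝ u J := fun x hx => (hu x hx).differentiableAt.differentiableWithinAt
  have hdw : DifferentiableOn ℝ w J := fun x hx => (hw x hx).differentiableAt.differentiableWithinAt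
  have key : ∀ n : ℕ, ContDiffOn ℝ n u J ∧ ContDiffOn ℝ n w J := by
    intro n
    induction n with
    | zero => exact ⟨contDiffOn_zero.2 hdu.continuousOn, contDiffOn_zero.2 hdw.continuousOn⟩
    | succ n ih =>
      push_cast
      rw [contDiffOn_succ_iff_deriv_of_isOpen hJ, contDiffOn_succ_iff_deriv_of_isOpen hJ]
      exact ⟨⟨hdu, by simp, ih.2.congr fun x hx => (hu x hx).deriv⟩, hdw, by simp,
        ((hT.of_le (by exact_mod_cast le_top)).mul ih.1).neg.congr fun x hx => (hw x hx).deriv⟩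
  exact contDiffOn_infty.2 fun n => (key n).1

namespace IsHillBasis

variable {J : Set ℝ} {T T' u₁ u₂ w₁ w₂ v₁ v₂ z₁ z₂ : ℝ → ℝ}

/-- Two bases of solutions with the same Wronskian are related by `SL(2, ℝ)`. -/
theorem exists_specialLinearGroup (hu : IsHillBasis J T u₁ u₂ w₁ w₂)
    (hv : IsHillBasis J T v₁ v₂ z₁ z₂) (hJ : IsOpen J) (hJ' : Convex ℝ J) {x₀ : ℝ} (hx₀ : x₀ ∈ J) :
    ∃ C : Matrix.SpecialLinearGroup (Fin 2) ℝ, ∀ x ∈ J,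
      ![u₁ x, u₂ x] = (C : Matrix (Fin 2) (Fin 2) ℝ).mulVec ![v₁ x, v₂ x] := by
  have comb : ∀ {u w : ℝ → ℝ}, (∀ x ∈ J, HasDerivAt u (w x) x) →
      (∀ x ∈ J, HasDerivAt w (-(T x * u x)) x) →
      ∃ α β : ℝ, ∀ x ∈ J, u x = α * v₁ x + β * v₂ x ∧ w x = α * z₁ x + β * z₂ x := by
    intro u w hu hw
    -- Cramer's rule: the coefficients are Wronskians with `v₁`, `v₂`, which are constant because
    -- both functions solve the same equation.
    refine ⟨-(u x₀ * z₂ x₀ - w x₀ * v₂ x₀), u x₀ * z₁ x₀ - w x₀ * v₁ x₀, fun x hx => ?_⟩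
    have c1 := eq_of_hasDerivAt_zero hJ' hJ (u := fun x => u x * z₂ x - w x * v₂ x)
      (fun t ht => (((hu t ht).mul (hv.deriv_deriv_snd t ht)).sub
        ((hw t ht).mul (hv.deriv_snd t ht))).congr_deriv (by ring)) hx hx₀
    have c2 := eq_of_hasDerivAt_zero hJ' hJ (u := fun x => u x * z₁ x - w x * v₁ x)
      (fun t ht => (((hu t ht).mul (hv.deriv_deriv_fst t ht)).sub
        ((hw t ht).mul (hv.deriv_fst t ht))).congr_deriv (by ring)) hx hx₀
    have c3 := hv.wronskian x hx
    beta_reduce at c1 c2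
    rw [← c1, ← c2]
    exact ⟨by linear_combination u x * c3, by linear_combination w x * c3⟩
  obtain ⟨α, β, h1⟩ := comb hu.deriv_fst hu.deriv_deriv_fst
  obtain ⟨γ, δ, h2⟩ := comb hu.deriv_snd hu.deriv_deriv_snd
  have hdet : α * δ - β * γ = 1 := by
    have e1 := hu.wronskian x₀ hx₀
    have e2 := hv.wronskian x₀ hx₀
    rw [(h1 x₀ hx₀).1, (h1 x₀ hx₀).2, (h2 x₀ hx₀).1, (h2 x₀ hx₀).2] at e1
    linear_combination -e1 + (α * δ - β * γ) * e2
  refine ⟨⟨!![α, β; γ, δ], by rw [Matrix.det_fin_two_of, hdet]⟩, fun x hx => ?_⟩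
  ext i
  fin_cases i
  · simp [Matrix.vecHead, Matrix.vecTail, (h1 x hx).1, mul_comm]
  · simp [Matrix.vecHead, Matrix.vecTail, (h2 x hx).1, mul_comm]

theorem exists_mulVec (hv : IsHillBasis J T v₁ v₂ z₁ z₂)
    (C : Matrix.SpecialLinearGroup (Fin 2) ℝ) : ∃ u₁ u₂ w₁ w₂, IsHillBasis J T u₁ u₂ w₁ w₂ ∧
      ∀ x, ![u₁ x, u₂ x] = (C : Matrix (Fin 2) (Fin 2) ℝ).mulVec ![v₁ x, v₂ x] := by
  obtain ⟨A, hA⟩ := C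
  have hdet : A 0 0 * A 1 1 - A 0 1 * A 1 0 = 1 := by
    rw [← Matrix.det_fin_two, hA]
  refine ⟨fun x => A 0 0 * v₁ x + A 0 1 * v₂ x, fun x => A 1 0 * v₁ x + A 1 1 * v₂ x,
    fun x => A 0 0 * z₁ x + A 0 1 * z₂ x, fun x => A 1 0 * z₁ x + A 1 1 * z₂ x,
    ⟨fun x hx => ((hv.deriv_fst x hx).const_mul _).add ((hv.deriv_snd x hx).const_mul _),
    fun x hx => ((hv.deriv_fst x hx).const_mul _).add ((hv.deriv_snd x hx).const_mul _),
    fun x hx => (((hv.deriv_deriv_fst x hx).const_mul _).add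
      ((hv.deriv_deriv_snd x hx).const_mul _)).congr_deriv (by ring),
    fun x hx => (((hv.deriv_deriv_fst x hx).const_mul _).add
      ((hv.deriv_deriv_snd x hx).const_mul _)).congr_deriv (by ring), fun x hx => ?_⟩, fun x => ?_⟩
  · have e := hv.wronskian x hx
    linear_combination (A 0 0 * A 1 1 - A 0 1 * A 1 0) * e - hdet
  · ext i
    fin_cases i <;> simp [Matrix.mulVec, dotProduct, Fin.sum_univ_two]

/-- Hill's equation is determined by the projective class of a basis of solutions. -/
theorem potential_eq (hu : IsHillBasis J T u₁ u₂ w₁ w₂) (hv : IsHillBasis J T' v₁ v₂ z₁ z₂)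
    (hJ : IsOpen J) (h : ∀ x ∈ J, ∃ s : ℝ, s ≠ 0 ∧ ![u₁ x, u₂ x] = s • ![v₁ x, v₂ x]) {x : ℝ}
    (hx : x ∈ J) : T x = T' x := by
  -- The proportionality factor is only given pointwise; this Wronskian-type expression recovers it
  -- as a differentiable function.
  set s : ℝ → ℝ := fun x => -(u₁ x * z₂ x - u₂ x * z₁ x) with hs
  have hus : ∀ x ∈ J, u₁ x = s x * v₁ x ∧ u₂ x = s x * v₂ x := by
    intro x hx
    obtain ⟨r, -, hr⟩ := h x hx
    have e1 : u₁ x = r * v₁ x := by simpa using congrFun hr 0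
    have e2 : u₂ x = r * v₂ x := by simpa using congrFun hr 1
    have e3 : s x = r := by
      simp only [hs, e1, e2]
      linear_combination -r * hv.wronskian x hx
    rw [e3]
    exact ⟨e1, e2⟩
  set s' : ℝ → ℝ := fun x => -(w₁ x * z₂ x - w₂ x * z₁ x) with hs'
  have hsd : ∀ x ∈ J, HasDerivAt s (s' x) x := fun x hx => by
    refine ((((hu.deriv_fst x hx).mul (hv.deriv_deriv_snd x hx)).sub
      ((hu.deriv_snd x hx).mul (hv.deriv_deriv_fst x hx))).neg).congr_deriv ?_
    obtain ⟨e1, e2⟩ := hus x hx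
    simp only [hs', e1, e2]
    ring
  have hw₁ : ∀ x ∈ J, w₁ x = s' x * v₁ x + s x * z₁ x := fun x hx =>
    (hu.deriv_fst x hx).unique (((hsd x hx).mul (hv.deriv_fst x hx)).congr_of_eventuallyEq
      (Filter.eventually_of_mem (hJ.mem_nhds hx) fun y hy => (hus y hy).1))
  have hw₂ : ∀ x ∈ J, w₂ x = s' x * v₂ x + s x * z₂ x := fun x hx =>
    (hu.deriv_snd x hx).unique (((hsd x hx).mul (hv.deriv_snd x hx)).congr_of_eventuallyEq
      (Filter.eventually_of_mem (hJ.mem_nhds hx) fun y hy => (hus y hy).2))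
  -- The Wronskian scales by `s²`, so equal Wronskians force `s² = 1`. Thus `s` has derivative zero
  -- and the two bases satisfy the same equation.
  have hs2 : ∀ x ∈ J, s x * s x = 1 := fun x hx => by
    have e := hu.wronskian x hx
    rw [hw₁ x hx, hw₂ x hx, (hus x hx).1, (hus x hx).2] at e
    linear_combination -e + s x ^ 2 * hv.wronskian x hx
  have hs0 : ∀ x ∈ J, s' x = 0 := fun x hx => by
    have e : s' x * s x + s x * s' x = 0 := ((hsd x hx).mul (hsd x hx)).unique
      ((hasDerivAt_const x (1 : ℝ)).congr_of_eventuallyEq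
        (Filter.eventually_of_mem (hJ.mem_nhds hx) hs2))
    linear_combination (s x / 2) * e - s' x * hs2 x hx
  have d1 : -(T x * u₁ x) = s x * -(T' x * v₁ x) := by
    have := (hu.deriv_deriv_fst x hx).unique (((hsd x hx).mul
      (hv.deriv_deriv_fst x hx)).congr_of_eventuallyEq (Filter.eventually_of_mem (hJ.mem_nhds hx)
        fun y hy => by rw [hw₁ y hy, hs0 y hy, zero_mul, zero_add]; rfl))
    rwa [hs0 x hx, zero_mul, zero_add] at this
  have d2 : -(T x * u₂ x) = s x * -(T' x * v₂ x) := by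
    have := (hu.deriv_deriv_snd x hx).unique (((hsd x hx).mul
      (hv.deriv_deriv_snd x hx)).congr_of_eventuallyEq (Filter.eventually_of_mem (hJ.mem_nhds hx)
        fun y hy => by rw [hw₂ y hy, hs0 y hy, zero_mul, zero_add]; rfl))
    rwa [hs0 x hx, zero_mul, zero_add] at this
  obtain ⟨e1, e2⟩ := hus x hx
  have f1 : (T x - T' x) * u₁ x = 0 := by rw [e1] at d1 ⊢; linear_combination -d1
  have f2 : (T x - T' x) * u₂ x = 0 := by rw [e2] at d2 ⊢; linear_combination -d2
  have e := hu.wronskian x hx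
  linear_combination (T x - T' x) * e - w₂ x * f1 + w₁ x * f2

end IsHillBasis

namespace IsHillBasis

variable {J J' : Set ℝ} {T T' u₁ u₂ w₁ w₂ : ℝ → ℝ}

theorem mono (h : IsHillBasis J T u₁ u₂ w₁ w₂) (hJ : J' ⊆ J) : IsHillBasis J' T u₁ u₂ w₁ w₂ :=
  ⟨fun x hx => h.deriv_fst x (hJ hx), fun x hx => h.deriv_snd x (hJ hx),
    fun x hx => h.deriv_deriv_fst x (hJ hx), fun x hx => h.deriv_deriv_snd x (hJ hx),
    fun x hx => h.wronskian x (hJ hx)⟩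

theorem congr (h : IsHillBasis J T u₁ u₂ w₁ w₂) (hT : ∀ x ∈ J, T x = T' x) :
    IsHillBasis J T' u₁ u₂ w₁ w₂ :=
  ⟨h.deriv_fst, h.deriv_snd, fun x hx => hT x hx ▸ h.deriv_deriv_fst x hx,
    fun x hx => hT x hx ▸ h.deriv_deriv_snd x hx, h.wronskian⟩

theorem of_deriv (hJ : IsOpen J) (h₁ : ContDiffOn ℝ ∞ u₁ J) (h₂ : ContDiffOn ℝ ∞ u₂ J)
    (e₁ : ∀ x ∈ J, deriv (deriv u₁) x + T x * u₁ x = 0)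
    (e₂ : ∀ x ∈ J, deriv (deriv u₂) x + T x * u₂ x = 0)
    (hW : ∀ x ∈ J, u₁ x * deriv u₂ x - deriv u₁ x * u₂ x = -1) :
    IsHillBasis J T u₁ u₂ (deriv u₁) (deriv u₂) := by
  have key : ∀ {f : ℝ → ℝ}, ContDiffOn ℝ ∞ f J → ∀ x ∈ J, HasDerivAt f (deriv f x) x :=
    fun hf x hx => ((hf.differentiableOn (by simp)).differentiableAt (hJ.mem_nhds hx)).hasDerivAt
  have h₁' := ((contDiffOn_infty_iff_deriv_of_isOpen hJ).1 h₁).2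
  have h₂' := ((contDiffOn_infty_iff_deriv_of_isOpen hJ).1 h₂).2
  exact ⟨key h₁, key h₂, fun x hx => (key h₁' x hx).congr_deriv (by linarith [e₁ x hx]),
    fun x hx => (key h₂' x hx).congr_deriv (by linarith [e₂ x hx]), hW⟩

end IsHillBasis

theorem deriv_deriv_of_hill {J : Set ℝ} (hJ : IsOpen J) {T u w : ℝ → ℝ}
    (hu : ∀ x ∈ J, HasDerivAt u (w x) x) (hw : ∀ x ∈ J, HasDerivAt w (-(T x * u x)) x) :
    ∀ x ∈ J, deriv (deriv u) x + T x * u x = 0 := by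
  intro x hx
  have h : deriv u =ᶠ[𝓝 x] w :=
    Filter.eventually_of_mem (hJ.mem_nhds hx) fun y hy => (hu y hy).deriv
  rw [h.deriv_eq, (hw x hx).deriv, neg_add_cancel]

/-! ### The Hill potential of a hyperbolic 0-metric in normal form -/

/-- The Hill potential in terms of the coefficients of the normal form. -/
def normalFormPotential (p σ : ℝ × ℝ → ℝ) (x : ℝ) : ℝ :=
  (1 / 2) * (hderiv 0 (hderiv 0 p) (x, 0) / p (x, 0)
    - (3 / 2) * (hderiv 0 p (x, 0) / p (x, 0)) ^ 2)
    + (p (x, 0)) ^ 2 / 2 * (-(σ (x, 0) / p (x, 0)))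

theorem contDiffOn_boundary {D : Set (ℝ × ℝ)} {f : ℝ × ℝ → ℝ} (hf : ContDiffOn ℝ ∞ f D) :
    ContDiffOn ℝ ∞ (fun x => f (x, 0)) {x : ℝ | (x, (0 : ℝ)) ∈ D} :=
  hf.comp (contDiff_id.prodMk contDiff_const).contDiffOn fun _ hx => hx

theorem hasDerivAt_boundary {D : Set (ℝ × ℝ)} (hD : IsHalfOpen D) {f : ℝ × ℝ → ℝ}
    (hf : ContDiffOn ℝ ∞ f D) {x : ℝ} (hx : (x, (0 : ℝ)) ∈ D) :
    HasDerivAt (fun x => f (x, 0)) (hderiv 0 f (x, 0)) x :=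
  (hf.hasPartials hD hx).hasDerivAt_fst (hD.subset hx)

namespace HyperbolicNormalForm

variable {D : Set (ℝ × ℝ)} {G : ℝ × ℝ → Matrix (Fin 2) (Fin 2) ℝ} {p q ν σ : ℝ × ℝ → ℝ}

theorem contDiffOn_normalFormPotential (h : HyperbolicNormalForm D G p q ν σ) (hD : IsHalfOpen D) :
    ContDiffOn ℝ ∞ (normalFormPotential p σ) {x : ℝ | (x, (0 : ℝ)) ∈ D} := by
  have hp := contDiffOn_boundary h.smooth_p
  have hp1 := contDiffOn_boundary (h.smooth_p.hderiv 0 hD)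
  have hp2 := contDiffOn_boundary ((h.smooth_p.hderiv 0 hD).hderiv 0 hD)
  have hs := contDiffOn_boundary h.smooth_σ
  have h0 : ∀ x ∈ {x : ℝ | (x, (0 : ℝ)) ∈ D}, p (x, 0) ≠ 0 := fun x hx => (h.p_pos _ hx).ne'
  exact (contDiffOn_const.mul ((hp2.div hp h0).sub
    (contDiffOn_const.mul ((hp1.div hp h0).pow 2)))).add
    (((hp.pow 2).div_const 2).mul (hs.div hp h0).neg)

theorem normalFormPotential_eq (h : HyperbolicNormalForm D G p q ν σ) (hD : IsHalfOpen D) {x : ℝ}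
    (hx : (x, (0 : ℝ)) ∈ D) : normalFormPotential p σ x
      = (1 / 2) * (deriv (deriv fun x => p (x, 0)) x / p (x, 0)
        - (3 / 2) * (deriv (fun x => p (x, 0)) x / p (x, 0)) ^ 2)
        + (p (x, 0)) ^ 2 / 2 * (-(σ (x, 0) / p (x, 0))) := by
  have e : deriv (fun x => p (x, 0)) =ᶠ[𝓝 x] fun x => hderiv 0 p (x, 0) :=
    Filter.eventually_of_mem (hD.isOpen_boundary.mem_nhds hx)
      fun y hy => (hasDerivAt_boundary hD h.smooth_p hy).deriv
  rw [e.deriv_eq, e.eq_of_nhds, (hasDerivAt_boundary hD (h.smooth_p.hderiv 0 hD) hx).deriv]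
  rfl

/-- A parallel basis restricts to a basis of solutions of Hill's equation on the boundary. -/
theorem isHillBasis (h : HyperbolicNormalForm D G p q ν σ) (hD : IsHalfOpen D)
    {N : Set (ℝ × ℝ)} (hND : N ⊆ D) {P₁ Q₁ P₂ Q₂ : ℝ × ℝ → ℝ}
    (hb : IsParallelBasis N p q ν σ P₁ Q₁ P₂ Q₂) :
    IsHillBasis {x : ℝ | (x, (0 : ℝ)) ∈ N} (normalFormPotential p σ)
      (fun x => Q₁ (x, 0) / √(p (x, 0))) (fun x => Q₂ (x, 0) / √(p (x, 0)))
      (fun x => P₁ (x, 0) * √(p (x, 0)) - Q₁ (x, 0) * hderiv 0 p (x, 0) / (2 * √(p (x, 0)) ^ 3))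
      (fun x => P₂ (x, 0) * √(p (x, 0))
        - Q₂ (x, 0) * hderiv 0 p (x, 0) / (2 * √(p (x, 0)) ^ 3)) := by
  -- Liouville's substitution: on the boundary `Q' = pP` and `P' = σQ/2`, and division of `Q` by
  -- `√p` removes the first-order term. This produces the Schwarzian-type expression in `p`.
  have key : ∀ {P Q : ℝ × ℝ → ℝ}, IsParallelSection N p q ν σ P Q → ∀ x, (x, (0 : ℝ)) ∈ N →
      HasDerivAt (fun x => Q (x, 0) / √(p (x, 0)))
        (P (x, 0) * √(p (x, 0)) - Q (x, 0) * hderiv 0 p (x, 0) / (2 * √(p (x, 0)) ^ 3)) x ∧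
      HasDerivAt (fun x => P (x, 0) * √(p (x, 0))
        - Q (x, 0) * hderiv 0 p (x, 0) / (2 * √(p (x, 0)) ^ 3))
        (-(normalFormPotential p σ x * (Q (x, 0) / √(p (x, 0))))) x := by
    intro P Q hs x hx
    have hp := h.p_pos _ (hND hx)
    have dP := (hs.partials_P _ hx).hasDerivAt_fst (hD.subset (hND hx))
    have dQ := (hs.partials_Q _ hx).hasDerivAt_fst (hD.subset (hND hx))
    have da := hasDerivAt_boundary hD h.smooth_p (hND hx)
    have da' := hasDerivAt_boundary hD (h.smooth_p.hderiv 0 hD) (hND hx)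
    have dr := da.sqrt hp.ne'
    have hr : 0 < √(p (x, 0)) := Real.sqrt_pos.2 hp
    have hr2 : p (x, 0) = √(p (x, 0)) ^ 2 := (Real.sq_sqrt hp.le).symm
    have dQ' : HasDerivAt (fun x => Q (x, 0)) (P (x, 0) * √(p (x, 0)) ^ 2) x :=
      dQ.congr_deriv (by rw [← hr2]; ring)
    constructor
    · refine (dQ'.div dr hr.ne').congr_deriv ?_
      field_simp
    · refine ((dP.mul dr).sub ((dQ'.mul da').div ((dr.pow 3).const_mul 2)
        (mul_ne_zero two_ne_zero (pow_ne_zero 3 hr.ne')))).congr_deriv ?_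
      simp only [normalFormPotential, Pi.mul_apply, Pi.pow_apply]
      rw [hr2]
      generalize √(p (x, 0)) = r at *
      simp only [Real.sqrt_sq hr.le]
      field_simp
      ring
  refine ⟨fun x hx => (key hb.first x hx).1, fun x hx => (key hb.second x hx).1,
    fun x hx => (key hb.first x hx).2, fun x hx => (key hb.second x hx).2, fun x hx => ?_⟩
  have hr : 0 < √(p (x, 0)) := Real.sqrt_pos.2 (h.p_pos _ (hND hx))
  have e := hb.det_eq _ hx
  field_simp
  linear_combination -(2 * √(p (x, 0)) ^ 4) * e

end HyperbolicNormalForm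

/-! ### The projective structure on the boundary -/

section Projective

variable {M : Type*} [TopologicalSpace M] [ChartedSpace (EuclideanHalfSpace 2) M]

/-- Compatibility with one hyperbolic chart implies compatibility with all of them, since boundary
transition maps between hyperbolic charts are Möbius. -/
theorem IsHyperbolicChart.isProjectiveBoundaryChart {o : SurfaceOrientation M} {g : ZeroMetric M}
    {φ ψ₀ : SurfaceChart M} (hφ : φ ∈ o.charts) (h₀ : IsHyperbolicChart o g ψ₀) {J : Set ℝ}
    {v₁ v₂ : ℝ → ℝ} (hJ : IsOpen J) (hJφ : ∀ x ∈ J, (x, (0 : ℝ)) ∈ overlap φ ψ₀)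
    (hv₂ : ∀ x ∈ J, v₂ x ≠ 0) (hv : ∀ x ∈ J, (transition φ ψ₀ (x, 0)).1 = v₁ x / v₂ x) :
    IsProjectiveBoundaryChart o g φ J v₁ v₂ := by
  intro ψ hψ x₀ hx₀ hsrc
  have hφm := o.subset_maximalAtlas hφ
  have hψ₀m := o.subset_maximalAtlas h₀.1
  set f : ℝ → ℝ := fun x => (transition φ ψ₀ (x, 0)).1 with hf
  have hbd : ∀ x ∈ J, transition φ ψ₀ (x, 0) = (f x, 0) := fun x hx =>
    Prod.ext rfl (transition_snd_eq_zero hφm hψ₀m (hJφ x hx) rfl)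
  have hpt : ∀ x ∈ J, coordPt ψ₀ (f x, 0) = coordPt φ (x, 0) := fun x hx => by
    rw [← hbd x hx, coordPt_transition (hJφ x hx)]
  have hmem : (f x₀, (0 : ℝ)) ∈ overlap ψ₀ ψ := by
    refine ⟨?_, by rwa [hpt x₀ hx₀]⟩
    rw [← hbd x₀ hx₀]
    exact (transition_mem_overlap (hJφ x₀ hx₀)).1
  obtain ⟨h, hh⟩ := h₀.exists_moebius hψ hmem
  have hfc : ContinuousAt f x₀ :=
    ((contDiffOn_boundary (contDiffOn_transition hφm hψ₀m).fst).continuousOn.continuousAt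
      ((isHalfOpen_overlap φ ψ₀).isOpen_boundary.mem_nhds (hJφ x₀ hx₀)))
  refine ⟨h⁻¹, ?_⟩
  filter_upwards [hfc.eventually hh, hJ.mem_nhds hx₀] with x hx hxJ
  obtain ⟨r, hr, e⟩ := hx
  refine ⟨v₂ x * r⁻¹, mul_ne_zero (hv₂ x hxJ) (inv_ne_zero hr), ?_⟩
  have e1 : (transition ψ₀ ψ (f x, 0)).1 = bdryChart φ ψ x := by
    rw [bdryChart_eq, transition, transition, hpt x hxJ]
  have hinv : ((h⁻¹ : Matrix.SpecialLinearGroup (Fin 2) ℝ) : Matrix (Fin 2) (Fin 2) ℝ)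
      * (h : Matrix (Fin 2) (Fin 2) ℝ) = 1 := by
    rw [← Matrix.SpecialLinearGroup.coe_mul, inv_mul_cancel, Matrix.SpecialLinearGroup.coe_one]
  rw [← e1, e, Matrix.mulVec_smul, Matrix.mulVec_mulVec, hinv, Matrix.one_mulVec, smul_smul,
    mul_assoc, inv_mul_cancel₀ hr, mul_one]
  have e2 : f x = v₁ x / v₂ x := hv x hxJ
  have hv₂x := hv₂ x hxJ
  rw [e2]
  ext i
  fin_cases i <;> simp
  field_simp

/-- One parallel basis supplies both sides of the correspondence: its developing map is a hyperbolic
chart, and its boundary values divided by `√p` are a Hill basis with the same quotient `Q₁/Q₂`. -/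
theorem HyperbolicNormalForm.exists_boundary_basis [IsManifold (𝓡∂ 2) ∞ M]
    {o : SurfaceOrientation M} {g : ZeroMetric M}
    {φ : SurfaceChart M} (hφ : φ ∈ o.charts) {p q ν σ : ℝ × ℝ → ℝ}
    (h : HyperbolicNormalForm (coordDom φ) (g.matrix φ) p q ν σ) {x₀ : ℝ} (hx₀ : x₀ ∈ bdryDom φ) :
    (∃ ψ, IsHyperbolicChart o g ψ ∧ coordPt φ (x₀, 0) ∈ ψ.source) ∧
    ∃ J, IsOpen J ∧ x₀ ∈ J ∧ ∃ v₁ v₂ z₁ z₂ : ℝ → ℝ,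
      IsHillBasis J (normalFormPotential p σ) v₁ v₂ z₁ z₂ ∧
      IsProjectiveBoundaryChart o g φ J v₁ v₂ := by
  have hD := isHalfOpen_coordDom φ
  obtain ⟨N, hN, hND, hxN, P₁, Q₁, P₂, Q₂, hb⟩ := h.exists_isParallelBasis hD hx₀
  obtain ⟨ψ, hψ, hsub, hmem, htrans⟩ := hb.exists_hyperbolicChart hφ h hN hND hxN
  refine ⟨⟨ψ, hψ, hmem.2⟩, {x | (x, (0 : ℝ)) ∈ overlap φ ψ},
    (isHalfOpen_overlap φ ψ).isOpen_boundary, hmem, _, _, _, _,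
    (h.isHillBasis hD hND hb).mono fun x hx => hsub hx,
    hψ.isProjectiveBoundaryChart hφ (isHalfOpen_overlap φ ψ).isOpen_boundary (fun x hx => hx)
      (fun x hx => ?_) fun x hx => ?_⟩
  · exact (div_pos (hb.pos _ (hsub hx)) (Real.sqrt_pos.2 (h.p_pos _ (hND (hsub hx))))).ne'
  · have h1 := hb.pos _ (hsub hx)
    have h2 := Real.sqrt_pos.2 (h.p_pos _ (hND (hsub hx)))
    rw [htrans _ hx, developingMap]
    field_simp
    ring

/-- Any normalised pair of solutions is locally an `SL(2, ℝ)`-image of the basis coming from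
parallel sections, which is already a projective chart. -/
theorem isHillPotential_of_eq [IsManifold (𝓡∂ 2) ∞ M] {o : SurfaceOrientation M} {g : ZeroMetric M}
    {φ : SurfaceChart M} (hφ : φ ∈ o.charts) {p q ν σ : ℝ × ℝ → ℝ}
    (h : HyperbolicNormalForm (coordDom φ) (g.matrix φ) p q ν σ) {T : ℝ → ℝ}
    (hT : ∀ x ∈ bdryDom φ, T x = normalFormPotential p σ x) : IsHillPotential o g φ T := by
  refine ⟨(h.contDiffOn_normalFormPotential (isHalfOpen_coordDom φ)).congr hT,
    fun x hx => (h.exists_boundary_basis hφ hx).1, ?_⟩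
  intro J hJ hJφ u₁ u₂ hu₁ hu₂ e₁ e₂ hW ψ hψ x₀ hx₀ hsrc
  obtain ⟨-, J', hJ', hx₀', v₁, v₂, z₁, z₂, hv, hproj⟩ := h.exists_boundary_basis hφ (hJφ hx₀)
  obtain ⟨ε, hε, hball⟩ := Metric.isOpen_iff.1 (hJ.inter hJ') x₀ ⟨hx₀, hx₀'⟩
  have hu := ((IsHillBasis.of_deriv hJ hu₁ hu₂ e₁ e₂ hW).congr
    fun x hx => hT x (hJφ hx)).mono fun x hx => (hball hx).1
  obtain ⟨C, hC⟩ := hu.exists_specialLinearGroup (hv.mono fun x hx => (hball hx).2)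
    Metric.isOpen_ball (convex_ball _ _) (Metric.mem_ball_self hε)
  obtain ⟨k, hk⟩ := hproj ψ hψ x₀ hx₀' hsrc
  refine ⟨C * k, ?_⟩
  filter_upwards [hk, Metric.ball_mem_nhds x₀ hε] with x ⟨s, hs, e⟩ hx
  refine ⟨s, hs, ?_⟩
  rw [hC x hx, e, Matrix.mulVec_smul, Matrix.mulVec_mulVec, Matrix.SpecialLinearGroup.coe_mul]

/-- Local solutions for `T` and those coming from parallel sections are both related by `SL(2, ℝ)`
to the same hyperbolic chart. After a constant change of basis they are proportional, so their
potentials agree. -/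
theorem IsHillPotential.eq_normalFormPotential [IsManifold (𝓡∂ 2) ∞ M] {o : SurfaceOrientation M}
    {g : ZeroMetric M} {φ : SurfaceChart M} (hφ : φ ∈ o.charts) {p q ν σ : ℝ × ℝ → ℝ}
    (h : HyperbolicNormalForm (coordDom φ) (g.matrix φ) p q ν σ) {T : ℝ → ℝ}
    (hT : IsHillPotential o g φ T) {x : ℝ} (hx : x ∈ bdryDom φ) :
    T x = normalFormPotential p σ x := by
  obtain ⟨hTs, -, hTp⟩ := hT
  obtain ⟨⟨ψ, hψ, hsrc⟩, J', hJ', hx', v₁, v₂, z₁, z₂, hv, hproj⟩ := h.exists_boundary_basis hφ hx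
  obtain ⟨ε, hε, hball, u₁, u₂, w₁, w₂, hu⟩ :=
    exists_isHillBasis (isHalfOpen_coordDom φ).isOpen_boundary hx hTs
  have ho : IsOpen (Metric.ball x ε) := Metric.isOpen_ball
  obtain ⟨k, hk⟩ := hTp _ ho hball u₁ u₂
    (contDiffOn_of_hill ho (hTs.mono hball) hu.deriv_fst hu.deriv_deriv_fst)
    (contDiffOn_of_hill ho (hTs.mono hball) hu.deriv_snd hu.deriv_deriv_snd)
    (deriv_deriv_of_hill ho hu.deriv_fst hu.deriv_deriv_fst)
    (deriv_deriv_of_hill ho hu.deriv_snd hu.deriv_deriv_snd)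
    (fun y hy => by rw [(hu.deriv_fst y hy).deriv, (hu.deriv_snd y hy).deriv, hu.wronskian y hy])
    ψ hψ x (Metric.mem_ball_self hε) hsrc
  obtain ⟨l, hl⟩ := hproj ψ hψ x hx' hsrc
  -- If `u ∼ k (f : 1)` and `v ∼ l (f : 1)`, then `k l⁻¹ v ∼ u`.
  obtain ⟨y₁, y₂, _, _, hy, hyl⟩ := hv.exists_mulVec (k * l⁻¹)
  obtain ⟨δ, hδ, hboth⟩ := Metric.eventually_nhds_iff_ball.1
    ((hk.and hl).and ((ho.eventually_mem (Metric.mem_ball_self hε)).and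
      (hJ'.eventually_mem hx')))
  refine (hu.mono fun t ht => (hboth t ht).2.1).potential_eq (hy.mono fun t ht => (hboth t ht).2.2)
    Metric.isOpen_ball (fun t ht => ?_) (Metric.mem_ball_self hδ)
  obtain ⟨⟨⟨r, hr, er⟩, s, hs, es⟩, -⟩ := hboth t ht
  refine ⟨r * s⁻¹, mul_ne_zero hr (inv_ne_zero hs), ?_⟩
  have hinv : ((k * l⁻¹ : Matrix.SpecialLinearGroup (Fin 2) ℝ) : Matrix (Fin 2) (Fin 2) ℝ)
      * (l : Matrix (Fin 2) (Fin 2) ℝ) = k := by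
    rw [← Matrix.SpecialLinearGroup.coe_mul, inv_mul_cancel_right]
  rw [hyl, es, er, Matrix.mulVec_smul, Matrix.mulVec_mulVec, hinv, smul_smul, mul_assoc,
    inv_mul_cancel₀ hs, mul_one]

end Projective

end

/-! ### The Hill potential in terms of volume and geodesic curvature. -/

theorem theorem7p3 {M : Type*} [TopologicalSpace M] [ChartedSpace (EuclideanHalfSpace 2) M]
    [IsManifold (𝓡∂ 2) ∞ M] (o : SurfaceOrientation M) (g : ZeroMetric M)
    (hg : IsHyperbolic o g) (φ : SurfaceChart M) (hφ : φ ∈ o.charts) :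
    ∃ a c : ℝ → ℝ,
      ContDiffOn ℝ ∞ a (bdryDom φ) ∧ (∀ x ∈ bdryDom φ, 0 < a x) ∧
      IsVolumeLeadingCoeff g φ a ∧
      ContDiffOn ℝ ∞ c (bdryDom φ) ∧
      (∀ x ∈ bdryDom φ,
        Filter.Tendsto (fun y => (horizontalCurvature g φ x y - 1) / y ^ 2) (𝓝[>] 0) (𝓝 (c x))) ∧
      ∀ T : ℝ → ℝ, IsHillPotential o g φ T ↔
        ∀ x ∈ bdryDom φ,
          T x = (1 / 2) * (deriv (deriv a) x / a x - (3 / 2) * (deriv a x / a x) ^ 2)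
            + (a x) ^ 2 / 2 * c x := by
  obtain ⟨p, q, ν, σ, h⟩ := hg.exists_normalForm hφ
  have hD := isHalfOpen_coordDom φ
  refine ⟨fun x => p (x, 0), fun x => -(σ (x, 0) / p (x, 0)), contDiffOn_boundary h.smooth_p,
    fun x hx => h.p_pos _ hx, h.exists_volCoeff_eq hD,
    ((contDiffOn_boundary h.smooth_σ).div (contDiffOn_boundary h.smooth_p)
      fun x hx => (h.p_pos _ hx).ne').neg, fun x hx => h.tendsto_boundary hD hx,
    fun T => ⟨fun hT x hx => ?_, fun hT => isHillPotential_of_eq hφ h fun x hx => ?_⟩⟩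
  · rw [hT.eq_normalFormPotential hφ h hx, h.normalFormPotential_eq hD hx]
  · rw [hT x hx, h.normalFormPotential_eq hD hx]
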